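/- Let $\ell,n,k$ be positive integers with $k$ even. A $k$XOR instance $\mathcal I$ over $[n]$ is a finite family, repetitions allowed, of constraints $(S_i,b_i)$ with $S_i\in\binom{[n]}{k}$ and $b_i\in\{\pm1\}$. $\mathcal R_{n,k}(m)$ denotes the law of $m$ independent constraints, each with a uniformly random scope $S_i$ and an independent uniformly random sign $b_i$; the Poissonized law $\widetilde{\mathcal R}_{n,k}(m)$ first draws $\boldsymbol m\sim\mathrm{Poi}(m)$ and then an instance from $\mathcal R_{n,k}(\boldsymbol m)$. The $\ell$-Kikuchi matrix of $\mathcal I$ is the real symmetric matrix $\mathcal K_\ell(\mathcal I)=\sum_i b_i K_{S_i}$ indexed by $\binom{[n]}{\ell}$, where $K_S(T,U)=1$ if the symmetric difference of $T$ and $U$ equals $S$, and $K_S(T,U)=0$ otherwise. Put $$\delta_{\ell,n,k}=\binom{k}{k/2}\binom{n-k}{\ell-k/2}\Big/\binom n\ell .$$ **Theorem.** For every even $k\ge 2$ and every $0<\kappa\le 1$ there is a constant $K=K(k,\kappa)\ge 1$ such that the following holds for all positive integers $\ell\ge k/2$ and $n\ge K k\ell$ and all $0<\epsilon\le\frac{\kappa}{2+\kappa}$.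 Suppose that $m$ (a nonnegative integer for $\mathcal R_{n,k}(m)$, a nonnegative real for $\widetilde{\mathcal R}_{n,k}(m)$) satisfies $$\Delta:=\frac mn\ \ge\ C_\kappa\,(n/\ell)^{(k-2)/2},\qquad C_\kappa=\frac{2(1+\epsilon)(1+\kappa)}{\kappa^2}\binom{k}{k/2}^{-1}\ln n .$$ Then, for $\mathcal I$ drawn from $\mathcal R_{n,k}(m)$ or from $\widetilde{\mathcal R}_{n,k}(m)$, $$\lambda_{\max}(\mathcal K_\ell(\mathcal I))\ \le\ \kappa\,\delta_{\ell,n,k}\,m$$ except with probability at most $3n^{-\epsilon\ell}$. -/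

import Mathlib

open MeasureTheory ProbabilityTheory
open scoped NNReal ENNReal symmDiff

/-- The `j`-element subsets of `[n]`. -/
abbrev KSubset (n j : ℕ) : Type := {S : Finset (Fin n) // S.card = j}

instance KSubset.measurableSpace (n j : ℕ) : MeasurableSpace (KSubset n j) := ⊤

instance KSubset.discreteMeasurableSpace (n j : ℕ) : DiscreteMeasurableSpace (KSubset n j) :=
  ⟨fun _ => trivial⟩

instance signs_discreteMeasurableSpace : DiscreteMeasurableSpace ℤˣ :=
  ⟨fun s => ⟨Units.val '' s, MeasurableSet.of_discrete, Set.preimage_image_eq s Units.val_injective⟩⟩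

/-- A constraint `x^S = b`: a scope `S` of cardinality `k` and a right-hand side `b = ±1`. -/
abbrev XORConstraint (n k : ℕ) : Type := KSubset n k × ℤˣ

/-- A `k`XOR instance over `[n]`: a number `M` of constraints, and the `M` constraints
(repetitions allowed). -/
abbrev XORInstance (n k : ℕ) : Type := Σ M : ℕ, (Fin M → XORConstraint n k)

/-- The law of one random constraint: a uniformly random scope and, independently, a
Rademacher right-hand side. -/
noncomputable def constraintLaw (n k : ℕ) : Measure (XORConstraint n k) :=
  (uniformOn (Set.univ : Set (KSubset n k))).prod (uniformOn (Set.univ : Set ℤˣ))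

/-- `R_{n,k}(m)`: `m` independent random constraints. -/
noncomputable def randomXOR (n k m : ℕ) : Measure (XORInstance n k) :=
  (Measure.pi (fun _ : Fin m => constraintLaw n k)).map (Sigma.mk m)

/-- The Poissonized law: first `M ∼ Poi(m)`, then an instance from `R_{n,k}(M)`. -/
noncomputable def poissonXOR (n k : ℕ) (m : ℝ≥0) : Measure (XORInstance n k) :=
  (poissonMeasure m).bind (fun M => randomXOR n k M)

/-- Adjacency matrix of the Kikuchi matching of `S`: the `ℓ`-sets `T`, `U` are matched iff
`T ∆ U = S`. -/
noncomputable def kikuchiMatching {n k : ℕ} (ℓ : ℕ) (S : KSubset n k) :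
    Matrix (KSubset n ℓ) (KSubset n ℓ) ℝ :=
  Matrix.of fun T U => if T.1 ∆ U.1 = S.1 then 1 else 0

/-- The Kikuchi matrix `∑ᵢ bᵢ K_{Sᵢ}` of the instance `(S₁, b₁), …, (S_M, b_M)`. -/
noncomputable def kikuchiMatrix {n k : ℕ} (ℓ : ℕ) (I : XORInstance n k) :
    Matrix (KSubset n ℓ) (KSubset n ℓ) ℝ :=
  ∑ i : Fin I.1, (((I.2 i).2 : ℤ) : ℝ) • kikuchiMatching ℓ (I.2 i).1

/-- The largest eigenvalue of a real symmetric matrix. -/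
noncomputable def lambdaMax {ι : Type*} [Fintype ι] [DecidableEq ι] (A : Matrix ι ι ℝ) : ℝ :=
  sSup (spectrum ℝ A)

theorem isHermitian_kikuchiMatrix {n k : ℕ} (ℓ : ℕ) (I : XORInstance n k) :
    (kikuchiMatrix ℓ I).IsHermitian := by
  ext T U
  simp [kikuchiMatrix, kikuchiMatching, Matrix.sum_apply, symmDiff_comm]

theorem isGreatest_lambdaMax {ι : Type*} [Fintype ι] [DecidableEq ι] [Nonempty ι]
    {A : Matrix ι ι ℝ} (hA : A.IsHermitian) : IsGreatest (spectrum ℝ A) (lambdaMax A) := by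
  have h := hA.spectrum_real_eq_range_eigenvalues
  have hf : (spectrum ℝ A).Finite := h ▸ Set.finite_range _
  have hn : (spectrum ℝ A).Nonempty := h ▸ Set.range_nonempty _
  exact ⟨hn.csSup_mem hf, fun x hx => le_csSup hf.bddAbove hx⟩

/-- `δ_{ℓ,n,k} = C(k,k/2) C(n-k,ℓ-k/2) / C(n,ℓ)`: the fraction of `ℓ`-sets touched by any one
Kikuchi matching. -/
noncomputable def kikuchiDelta (ℓ n k : ℕ) : ℝ :=
  (k.choose (k / 2) : ℝ) * ((n - k).choose (ℓ - k / 2) : ℝ) / (n.choose ℓ : ℝ)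

/-- `C_κ = 2(1+ε)(1+κ)/κ² · C(k,k/2)⁻¹ · ln n`. -/
noncomputable def aliceConst (κ ε : ℝ) (n k : ℕ) : ℝ :=
  2 * (1 + ε) * (1 + κ) / κ ^ 2 * (k.choose (k / 2) : ℝ)⁻¹ * Real.log n

/-! ### Spectral calculus: traces of powers, quadratic forms, exponentials -/

section SpectralBounds

open Matrix

variable {ι : Type*} [Fintype ι] [DecidableEq ι]

/-! Write k = 2h and let d = δm, the average degree in the Kikuchi graph. Two different arguments
are needed, according to whether d is large enough for a matrix Chernoff bound.

Dense case. The trace of a power of the Kikuchi matrix expands over words of constraints. Averaging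
over signs gives each word a nonnegative weight, and a product of random matchings is dominated by
the corresponding product of 0/1 scalars: a fresh constraint matches every vertex with the same
probability δ, and a repeated one can only lose mass (`IsRegularMatchingFamily.sum_orderedProd_le`).
So the exponential moment of λ_max is at most C(n,ℓ) times that of a scalar sum of signed
Bernoulli(δ) variables. Markov's inequality with θ = κ bounds the failure probability by C(n,ℓ)
exp(d(cosh κ - 1 - κ²)), which is at most n^(-εℓ) as soon as κ² d ≥ (2+κ)(1+ε) ℓ ln n.

The hypothesis on m gives κ² d ≥ 2(1+ε)(1+κ) ℓ ln n · PQ, where P and Q compare falling factorials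
of ℓ and n-ℓ with ℓ^h and n^h. If ℓ exceeds a constant L(k,κ) and n/ℓ is large, P and Q are close to
1 and the spare factor (1+κ)/(1+κ/2) pays for them. If ℓ ≤ L, P may be a small constant and the
Chernoff condition may fail; but then d has exact order log n (`dense_or_sparse`).

Sparse case. It remains to see that λ_max is o(log n) for bounded ℓ and d of order log n. Cutting
each scope into two halves of size h, in each of the C(k,h) possible ways, turns the instance into
sparse signed graphs on the h-subsets, and the Kikuchi quadratic form is a sum of quadratic forms of
these graphs (`lambdaMax_kikuchiMatrix_le`). Their norm is bounded by the trace method with p of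
order log n. Only closed walks using every edge evenly survive the signs. Weighted by the edge
density x to the number of visited vertices, such walks are no more numerous than even closed walks
on about 2p + x|V| = O(log n) vertices (`sum_pow_card_image_le`). The latter are counted by the
trace moment of a dense random sign matrix, which a net and Khintchine's inequality bound by
(O(p))^p (`card_evenClosedWalks_le`). Against (η log n)^(2p) this wins by a factor (O(1)/p)^p,
smaller than any fixed power of n.

The Poissonized law follows by summing the Chernoff bound over the number of constraints in the
dense case, and by a Poisson tail bound at 2m in the sparse case. -/

theorem exists_orthogonal_diagonalization {A : Matrix ι ι ℝ} (hA : A.IsHermitian) :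
    ∃ U : Matrix ι ι ℝ, Uᵀ * U = 1 ∧ U * Uᵀ = 1 ∧ A = U * diagonal hA.eigenvalues * Uᵀ := by
  refine ⟨hA.eigenvectorUnitary, ?_, ?_, ?_⟩
  · exact (Matrix.mem_unitaryGroup_iff').1 hA.eigenvectorUnitary.2
  · exact (Matrix.mem_unitaryGroup_iff).1 hA.eigenvectorUnitary.2
  · have h := hA.spectral_theorem
    rw [Unitary.conjStarAlgAut_apply] at h
    exact h

theorem pow_conj_diagonal {U : Matrix ι ι ℝ} (hU : Uᵀ * U = 1) (hU' : U * Uᵀ = 1) (d : ι → ℝ)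
    (q : ℕ) : (U * diagonal d * Uᵀ) ^ q = U * diagonal (d ^ q) * Uᵀ := by
  induction q with
  | zero => simp [hU']
  | succ q ih =>
    rw [pow_succ, ih, pow_succ,
      show diagonal (d ^ q * d) = diagonal (d ^ q) * diagonal d from
        (diagonal_mul_diagonal _ _).symm]
    calc U * diagonal (d ^ q) * Uᵀ * (U * diagonal d * Uᵀ)
        = U * diagonal (d ^ q) * (Uᵀ * U) * diagonal d * Uᵀ := by simp only [Matrix.mul_assoc]
      _ = _ := by rw [hU, Matrix.mul_one]; simp only [Matrix.mul_assoc]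

theorem trace_pow_eq_sum_eigenvalues {A : Matrix ι ι ℝ} (hA : A.IsHermitian) (q : ℕ) :
    (A ^ q).trace = ∑ j, hA.eigenvalues j ^ q := by
  obtain ⟨U, hU, hU', h⟩ := exists_orthogonal_diagonalization hA
  conv_lhs => rw [h, pow_conj_diagonal hU hU', trace_mul_comm, ← Matrix.mul_assoc, hU,
    Matrix.one_mul, trace_diagonal]
  rfl

theorem exists_quadratic_form_diagonalization {A : Matrix ι ι ℝ} (hA : A.IsHermitian) (x : ι → ℝ) :
    ∃ y : ι → ℝ, y ⬝ᵥ y = x ⬝ᵥ x ∧ x ⬝ᵥ A *ᵥ x = ∑ j, hA.eigenvalues j * y j ^ 2 := by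
  obtain ⟨U, hU, hU', h⟩ := exists_orthogonal_diagonalization hA
  refine ⟨Uᵀ *ᵥ x, ?_, ?_⟩
  · rw [dotProduct_mulVec, vecMul_transpose, mulVec_mulVec, hU', one_mulVec]
  · conv_lhs => rw [h, ← mulVec_mulVec, ← mulVec_mulVec, dotProduct_mulVec, ← mulVec_transpose]
    simp only [dotProduct, mulVec_diagonal]
    exact Finset.sum_congr rfl fun j _ => by ring

theorem quadratic_form_le {A : Matrix ι ι ℝ} (hA : A.IsHermitian) {τ : ℝ}
    (h : ∀ j, |hA.eigenvalues j| ≤ τ) (x : ι → ℝ) : |x ⬝ᵥ A *ᵥ x| ≤ τ * (x ⬝ᵥ x) := by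
  obtain ⟨y, hy, hxy⟩ := exists_quadratic_form_diagonalization hA x
  rw [hxy, ← hy, dotProduct, Finset.mul_sum]
  refine (Finset.abs_sum_le_sum_abs _ _).trans (Finset.sum_le_sum fun j _ => ?_)
  rw [abs_mul, abs_of_nonneg (sq_nonneg (y j)), ← sq]
  exact mul_le_mul_of_nonneg_right (h j) (sq_nonneg _)

/-- A bound on an even trace moment controls the quadratic form. -/
theorem quadratic_form_le_of_trace_pow_le {A : Matrix ι ι ℝ} (hA : A.IsHermitian) {τ : ℝ}
    (hτ : 0 ≤ τ) {p : ℕ} (hp : p ≠ 0) (h : (A ^ (2 * p)).trace ≤ τ ^ (2 * p)) (x : ι → ℝ) :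
    x ⬝ᵥ A *ᵥ x ≤ τ * (x ⬝ᵥ x) := by
  refine (le_abs_self _).trans (quadratic_form_le hA (fun j => ?_) x)
  rw [trace_pow_eq_sum_eigenvalues hA] at h
  have h1 : hA.eigenvalues j ^ (2 * p) ≤ τ ^ (2 * p) :=
    (Finset.single_le_sum (f := fun j => hA.eigenvalues j ^ (2 * p))
      (fun i _ => (even_two_mul p).pow_nonneg _) (Finset.mem_univ j)).trans h
  rw [← (even_two_mul p).pow_abs] at h1
  exact le_of_pow_le_pow_left₀ (by omega) hτ h1

/-- Eigenvalues of symmetric matrices are attained by unit vectors. -/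
theorem exists_eigenvector {A : Matrix ι ι ℝ} (hA : A.IsHermitian) (j : ι) :
    ∃ v : ι → ℝ, v ⬝ᵥ v = 1 ∧ A *ᵥ v = hA.eigenvalues j • v := by
  obtain ⟨U, hU, hU', h⟩ := exists_orthogonal_diagonalization hA
  refine ⟨U *ᵥ Pi.single j 1, ?_, ?_⟩
  · rw [dotProduct_mulVec, ← mulVec_transpose, mulVec_mulVec, hU, one_mulVec]
    simp
  · conv_lhs => rw [h, ← mulVec_mulVec, mulVec_mulVec (M := Uᵀ), hU, one_mulVec]
    rw [← mulVec_mulVec]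
    have : diagonal hA.eigenvalues *ᵥ (Pi.single j 1 : ι → ℝ)
        = hA.eigenvalues j • Pi.single j 1 := by
      ext i
      rw [mulVec_diagonal]
      by_cases hij : i = j
      · subst hij; simp
      · simp [hij]
    rw [this, mulVec_smul]

theorem exists_eigenvector_lambdaMax [Nonempty ι] {A : Matrix ι ι ℝ} (hA : A.IsHermitian) :
    ∃ v : ι → ℝ, v ⬝ᵥ v = 1 ∧ v ⬝ᵥ A *ᵥ v = lambdaMax A := by
  have h := (isGreatest_lambdaMax hA).1
  rw [hA.spectrum_real_eq_range_eigenvalues] at h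
  obtain ⟨j, hj⟩ := h
  obtain ⟨v, hv, hAv⟩ := exists_eigenvector hA j
  exact ⟨v, hv, by rw [hAv, dotProduct_smul, hv, hj, smul_eq_mul, mul_one]⟩

theorem hasSum_trace_exp {A : Matrix ι ι ℝ} (hA : A.IsHermitian) (θ : ℝ) :
    HasSum (fun q : ℕ => θ ^ q / q.factorial * (A ^ q).trace)
      (∑ j, Real.exp (θ * hA.eigenvalues j)) := by
  simp_rw [trace_pow_eq_sum_eigenvalues hA, Finset.mul_sum]
  refine hasSum_sum fun j _ => ?_
  have := NormedSpace.expSeries_div_hasSum_exp (θ * hA.eigenvalues j)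
  rw [← Real.exp_eq_exp_ℝ] at this
  refine this.congr_fun fun q => ?_
  rw [mul_pow]; ring

theorem exp_mul_lambdaMax_le [Nonempty ι] {A : Matrix ι ι ℝ} (hA : A.IsHermitian) (θ : ℝ) :
    Real.exp (θ * lambdaMax A) ≤ ∑ j, Real.exp (θ * hA.eigenvalues j) := by
  have h := (isGreatest_lambdaMax hA).1
  rw [hA.spectrum_real_eq_range_eigenvalues] at h
  obtain ⟨j, hj⟩ := h
  rw [← hj]
  exact Finset.single_le_sum (f := fun j => Real.exp (θ * hA.eigenvalues j))
    (fun i _ => (Real.exp_pos _).le) (Finset.mem_univ j)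

end SpectralBounds

/-! ### Trace moments of signed multigraphs and even closed walks -/

section ClosedWalks

open Matrix Finset

theorem matrix_pow_apply_eq_sum_walks {V : Type*} [Fintype V] [DecidableEq V]
    (A : Matrix V V ℝ) (q : ℕ) (x y : V) :
    (A ^ q) x y = ∑ w : Fin (q + 1) → V, if w 0 = x ∧ w (Fin.last q) = y then
      ∏ t : Fin q, A (w t.castSucc) (w t.succ) else 0 := by
  induction q generalizing x with
  | zero =>
    rw [← (Equiv.funUnique (Fin 1) V).symm.sum_comp]
    simp only [pow_zero, Matrix.one_apply, univ_eq_empty, prod_empty]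
    by_cases h : x = y
    · subst h; simp
    · rw [if_neg h]; symm
      refine Finset.sum_eq_zero fun z _ => if_neg ?_
      rintro ⟨h1, h2⟩
      exact h (h1.symm.trans h2)
  | succ q ih =>
    rw [pow_succ', Matrix.mul_apply, ← (Fin.consEquiv (fun _ : Fin (q + 2) => V)).sum_comp,
      Fintype.sum_prod_type]
    simp_rw [ih, Finset.mul_sum]
    rw [Finset.sum_comm, Finset.sum_comm (s := (univ : Finset V))]
    refine Finset.sum_congr rfl fun w _ => ?_
    have hl : Fin.last (q + 1) = (Fin.last q).succ := rfl
    simp only [Fin.consEquiv_apply, Fin.cons_zero, hl, Fin.cons_succ, Fin.prod_univ_succ,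
      Fin.castSucc_zero, ← Fin.succ_castSucc]
    rw [Finset.sum_eq_single (w 0) (fun z _ hz => by rw [if_neg (fun h => hz h.1.symm), mul_zero])
      (by simp), Finset.sum_eq_single x (fun z _ hz => by rw [if_neg (fun h => hz h.1)]) (by simp)]
    simp

theorem trace_pow_eq_sum_closed_walks {V : Type*} [Fintype V] [DecidableEq V]
    (A : Matrix V V ℝ) (q : ℕ) :
    (A ^ q).trace = ∑ w : Fin (q + 1) → V with w 0 = w (Fin.last q),
      ∏ t : Fin q, A (w t.castSucc) (w t.succ) := by
  simp only [Matrix.trace, Matrix.diag_apply, matrix_pow_apply_eq_sum_walks]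
  rw [Finset.sum_comm, Finset.sum_filter]
  refine Finset.sum_congr rfl fun w _ => ?_
  rw [Finset.sum_eq_single (w 0) (fun z _ hz => by rw [if_neg (fun h => hz h.1.symm)]) (by simp)]
  simp [eq_comm]

/-- The edge traversed by the walk `w` at time `t`. -/
def walkEdge {V : Type*} {q : ℕ} (w : Fin (q + 1) → V) (t : Fin q) : Sym2 V :=
  s(w t.castSucc, w t.succ)

open Classical in
/-- The closed walks of length `q` in the complete graph with loops on `V` that traverse every
edge an even number of times. -/
noncomputable def evenClosedWalks (V : Type*) [Fintype V] (q : ℕ) : Finset (Fin (q + 1) → V) :=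
  {w | w 0 = w (Fin.last q) ∧ ∀ s, Even #{t | walkEdge w t = walkEdge w s}}

/-- The weights of the random signed multigraph with edges `pos i` and signs `b i`. -/
noncomputable def signedWeight {V : Type*} [DecidableEq V] {I : Type*} [Fintype I]
    (pos : I → Sym2 V) (b : I → ℤˣ) (e : Sym2 V) : ℝ :=
  ∑ i, if pos i = e then (((b i : ℤˣ) : ℤ) : ℝ) else 0

/-- The adjacency matrix of the signed multigraph with edges `pos i` and signs `b i`. -/
noncomputable def signedAdjacency {V : Type*} [DecidableEq V] {I : Type*} [Fintype I]
    (pos : I → Sym2 V) (b : I → ℤˣ) : Matrix V V ℝ :=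
  Matrix.of fun x y => signedWeight pos b s(x, y)

theorem isHermitian_signedAdjacency {V : Type*} [DecidableEq V] {I : Type*} [Fintype I]
    (pos : I → Sym2 V) (b : I → ℤˣ) :
    (signedAdjacency pos b).IsHermitian := by
  ext x y
  simp [signedAdjacency, Sym2.eq_swap]

theorem signedWeight_mul {V : Type*} [DecidableEq V] {I : Type*} [Fintype I]
    (pos : I → Sym2 V) (b : I → ℤˣ) (e e' : Sym2 V) :
    signedWeight pos ((fun i => if pos i = e then -1 else 1) * b) e'
      = (if e' = e then -1 else 1) * signedWeight pos b e' := by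
  unfold signedWeight
  rw [Finset.mul_sum]
  refine Finset.sum_congr rfl fun i _ => ?_
  by_cases h : pos i = e'
  · subst h
    by_cases h' : pos i = e <;> simp [h']
  · simp [h]

/-- Flipping the signs of all edges placed at a position that the walk traverses an odd number of
times is an involution that negates the summand. -/
theorem sum_prod_signedWeight_eq_zero {V : Type*} [DecidableEq V] {I : Type*} [Fintype I] [DecidableEq I]
    (pos : I → Sym2 V) {q : ℕ} (w : Fin (q + 1) → V) (s : Fin q)
    (hs : ¬ Even #{t | walkEdge w t = walkEdge w s}) :
    ∑ b : I → ℤˣ, ∏ t, signedWeight pos b (walkEdge w t) = 0 := by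
  set c : I → ℤˣ := fun i => if pos i = walkEdge w s then -1 else 1
  have h : ∑ b : I → ℤˣ, ∏ t, signedWeight pos b (walkEdge w t)
      = - ∑ b : I → ℤˣ, ∏ t, signedWeight pos b (walkEdge w t) := by
    refine (Fintype.sum_equiv (Equiv.mulLeft c)
      (fun b : I → ℤˣ => ∏ t, signedWeight pos (c * b) (walkEdge w t)) _ (fun b => rfl)).symm.trans
      ?_
    rw [← Finset.sum_neg_distrib]
    refine Finset.sum_congr rfl fun b _ => ?_
    simp only [c, signedWeight_mul, Finset.prod_mul_distrib]
    rw [Finset.prod_ite, Finset.prod_const, Finset.prod_const_one,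
      (Nat.not_even_iff_odd.1 hs).neg_one_pow]
    ring
  linarith

theorem sum_trace_signedAdjacency_pow {V : Type*} [Fintype V] [DecidableEq V] {I : Type*} [Fintype I] [DecidableEq I]
    (pos : I → Sym2 V) (q : ℕ) :
    ∑ b : I → ℤˣ, (signedAdjacency pos b ^ q).trace
      = ∑ w ∈ evenClosedWalks V q, ∑ b : I → ℤˣ, ∏ t, signedWeight pos b (walkEdge w t) := by
  classical
  simp_rw [trace_pow_eq_sum_closed_walks]
  rw [Finset.sum_comm]
  symm
  refine Finset.sum_subset_zero_on_sdiff ?_ ?_ (fun w _ => rfl)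
  · intro w hw
    simp only [evenClosedWalks, mem_filter, mem_univ, true_and] at hw ⊢
    exact hw.1
  · intro w hw
    simp only [evenClosedWalks, mem_sdiff, mem_filter, mem_univ, true_and, not_and, not_forall]
      at hw
    obtain ⟨s, hs⟩ := hw.2 hw.1
    exact sum_prod_signedWeight_eq_zero pos w s (by convert hs)

theorem abs_signedWeight_le {V : Type*} [DecidableEq V] {I : Type*} [Fintype I]
    (pos : I → Sym2 V) (b : I → ℤˣ) (e : Sym2 V) :
    |signedWeight pos b e| ≤ #{i | pos i = e} := by
  unfold signedWeight
  rw [← Finset.sum_filter]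
  refine (Finset.abs_sum_le_sum_abs _ _).trans (le_of_eq ?_)
  rw [Finset.card_eq_sum_ones, Nat.cast_sum]
  refine Finset.sum_congr rfl fun i _ => ?_
  rcases Int.units_eq_one_or (b i) with h | h <;> simp [h]

/-- The signed count of a walk, when no edge has multiplicity above `c`. -/
theorem sum_prod_signedWeight_le {V : Type*} [DecidableEq V] {I : Type*} [Fintype I] [DecidableEq I]
    (pos : I → Sym2 V) (c : ℕ)
    (hc : ∀ e, #{i | pos i = e} ≤ c) {q : ℕ} (w : Fin (q + 1) → V) :
    ∑ b : I → ℤˣ, ∏ t, signedWeight pos b (walkEdge w t)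
      ≤ 2 ^ Fintype.card I * (c : ℝ) ^ q *
        (if univ.image (walkEdge w) ⊆ univ.image pos then 1 else 0) := by
  have key : ∀ b : I → ℤˣ, ∏ t, signedWeight pos b (walkEdge w t) ≤ (c : ℝ) ^ q *
        (if univ.image (walkEdge w) ⊆ univ.image pos then 1 else 0) := by
    intro b
    split_ifs with h
    · refine (le_abs_self _).trans ?_
      rw [Finset.abs_prod, mul_one]
      refine (Finset.prod_le_prod (fun t _ => abs_nonneg _)
        (fun t _ => (abs_signedWeight_le pos b _).trans (Nat.cast_le.2 (hc _)))).trans ?_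
      simp
    · obtain ⟨e, he, hne⟩ := Finset.not_subset.1 h
      obtain ⟨t, _, rfl⟩ := Finset.mem_image.1 he
      rw [mul_zero, Finset.prod_eq_zero (Finset.mem_univ t)]
      unfold signedWeight
      exact Finset.sum_eq_zero fun i _ => if_neg fun hi =>
        hne (Finset.mem_image.2 ⟨i, mem_univ _, hi⟩)
  refine (Finset.sum_le_sum fun b _ => key b).trans (le_of_eq ?_)
  rw [Finset.sum_const, Finset.card_univ, nsmul_eq_mul, mul_assoc]
  simp

/-- The number of even closed walks as a moment of a random sign matrix. -/
theorem card_evenClosedWalks_mul {V : Type*} [Fintype V] [DecidableEq V]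
    (q : ℕ) :
    (2 : ℝ) ^ Fintype.card (Sym2 V) * #(evenClosedWalks V q)
      = ∑ b : Sym2 V → ℤˣ, (signedAdjacency id b ^ q).trace := by
  classical
  rw [sum_trace_signedAdjacency_pow, mul_comm, ← nsmul_eq_mul, ← Finset.sum_const]
  refine Finset.sum_congr rfl fun w hw => ?_
  have h1 : ∀ b : Sym2 V → ℤˣ, ∏ t, signedWeight id b (walkEdge w t) = 1 := by
    intro b
    simp only [signedWeight, id]
    simp only [Finset.sum_ite_eq', Finset.mem_univ, if_true]
    -- Grouping the times by the traversed edge leaves even powers of signs.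
    rw [← Finset.prod_fiberwise_of_maps_to (g := walkEdge w) (t := univ.image (walkEdge w))
      (fun t _ => Finset.mem_image_of_mem _ (Finset.mem_univ t))]
    refine Finset.prod_eq_one fun e he => ?_
    obtain ⟨s, _, rfl⟩ := Finset.mem_image.1 he
    rw [Finset.prod_congr rfl (g := fun _ => (((b (walkEdge w s) : ℤˣ) : ℤ) : ℝ))
      (fun t ht => by rw [(Finset.mem_filter.1 ht).2]), Finset.prod_const]
    simp only [evenClosedWalks, mem_filter, mem_univ, true_and] at hw
    have hev : Even #{t | walkEdge w t = walkEdge w s} := by convert hw.2 s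
    rcases Int.units_eq_one_or (b (walkEdge w s)) with h | h
    · simp [h]
    · rw [h]; push_cast; exact hev.neg_one_pow
  simp [h1]

/-- A walk visits at most one more vertex than it traverses distinct edges. -/
theorem card_image_walk_le {V : Type*} [DecidableEq V] {q : ℕ} (w : Fin (q + 1) → V) :
    #(univ.image w) ≤ #(univ.image (walkEdge w)) + 1 := by
  induction q with
  | zero => simp
  | succ q ih =>
    have ih' := ih (fun i : Fin (q + 1) => w i.castSucc)
    have hv : univ.image w = insert (w (Fin.last _)) (univ.image fun i : Fin (q + 1) => w i.castSucc) := by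
      ext x
      simp only [mem_image, mem_univ, true_and, mem_insert]
      constructor
      · rintro ⟨i, rfl⟩
        induction i using Fin.lastCases with
        | last => exact Or.inl rfl
        | cast i => exact Or.inr ⟨i, rfl⟩
      · rintro (rfl | ⟨i, rfl⟩)
        exacts [⟨_, rfl⟩, ⟨_, rfl⟩]
    have hsub : univ.image (walkEdge fun i : Fin (q + 1) => w i.castSucc) ⊆ univ.image (walkEdge w) := by
      intro e he
      obtain ⟨t, _, rfl⟩ := Finset.mem_image.1 he
      exact Finset.mem_image.2 ⟨t.castSucc, mem_univ _, rfl⟩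
    by_cases hnew : w (Fin.last _) ∈ univ.image fun i : Fin (q + 1) => w i.castSucc
    · rw [hv, Finset.insert_eq_of_mem hnew]
      exact ih'.trans (Nat.succ_le_succ (Finset.card_le_card hsub))
    · rw [hv, Finset.card_insert_of_notMem hnew]
      -- A new last vertex makes the last edge new: an earlier edge equal to it would contain that
      -- vertex.
      have hlt : #(univ.image (walkEdge fun i : Fin (q + 1) => w i.castSucc)) < #(univ.image (walkEdge w)) := by
        refine Finset.card_lt_card ⟨hsub, fun h => ?_⟩
        have := h (Finset.mem_image_of_mem (walkEdge w) (mem_univ (Fin.last q)))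
        obtain ⟨t, _, ht⟩ := Finset.mem_image.1 this
        have hmem : w (Fin.last q).succ ∈ walkEdge (fun i : Fin (q + 1) => w i.castSucc) t := by
          rw [ht]; exact Sym2.mem_mk_right _ _
        rcases Sym2.mem_iff.1 hmem with h | h
        · exact hnew (Finset.mem_image.2 ⟨_, mem_univ _, h.symm⟩)
        · exact hnew (Finset.mem_image.2 ⟨_, mem_univ _, h.symm⟩)
      omega

end ClosedWalks

/-! ### Transferring walks to a small vertex set by their shape -/

section WalkShapes

open Finset

/-- Two maps with the same fibres. -/
def SameKernel {ι V R : Type*} (w : ι → V) (w' : ι → R) : Prop :=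
  ∀ i j, w i = w j ↔ w' i = w' j

theorem SameKernel.symm {ι V R : Type*} {w : ι → V} {w' : ι → R} (h : SameKernel w w') :
    SameKernel w' w := fun i j => (h i j).symm

theorem SameKernel.extend_apply {ι V R : Type*} {w : ι → V} {w' : ι → R} (h : SameKernel w w')
    (e : V → R) (i : ι) : Function.extend w w' e (w i) = w' i :=
  Function.FactorsThrough.extend_apply (fun a b hab => (h a b).1 hab) e i

theorem SameKernel.card_image {ι V R : Type*} [Fintype ι] [Nonempty ι] [DecidableEq V]
    [DecidableEq R] {w : ι → V} {w' : ι → R} (h : SameKernel w w') :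
    #(univ.image w) = #(univ.image w') := by
  obtain ⟨i₀⟩ := ‹Nonempty ι›
  have hφ := h.extend_apply (fun _ => w' i₀)
  have : univ.image w' = (univ.image w).image (Function.extend w w' (fun _ => w' i₀)) := by
    rw [Finset.image_image]
    exact Finset.image_congr fun i _ => (hφ i).symm
  rw [this]
  refine (Finset.card_image_of_injOn ?_).symm
  intro x hx y hy hxy
  simp only [coe_image, coe_univ, Set.image_univ, Set.mem_range] at hx hy
  obtain ⟨i, rfl⟩ := hx
  obtain ⟨j, rfl⟩ := hy
  rw [hφ, hφ] at hxy
  exact (h i j).2 hxy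

-- Each injection of the range of `w` into `R`, composed with `w`, is a map with the fibres of `w`,
-- and distinct injections give distinct maps.
open Classical in
theorem descFactorial_le_card_sameKernel {ι V R : Type*} [Fintype ι] [DecidableEq ι]
    [DecidableEq V] [Fintype R] (w : ι → V) :
    (Fintype.card R).descFactorial #(univ.image w) ≤ #{w' : ι → R | SameKernel w w'} := by
  have h := Fintype.card_embedding_eq (α := (univ.image w : Finset V)) (β := R)
  rw [Fintype.card_coe] at h
  rw [← h, ← Finset.card_univ]
  have hm : ∀ i, w i ∈ univ.image w := fun i => Finset.mem_image_of_mem w (mem_univ i)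
  refine Finset.card_le_card_of_injOn (fun φ i => φ ⟨w i, hm i⟩) ?_ ?_
  · intro φ _
    simp only [coe_filter, mem_univ, true_and, Set.mem_ofPred_eq]
    intro i j
    rw [φ.injective.eq_iff, Subtype.mk.injEq]
  · intro φ _ ψ _ hφψ
    ext ⟨x, hx⟩
    obtain ⟨i, _, rfl⟩ := Finset.mem_image.1 hx
    exact congrFun hφψ i

-- A map with the fibres of `w'` factors through the range of `w'`, so it is determined by a
-- function on that range.
open Classical in
theorem card_sameKernel_le {ι V R : Type*} [Fintype ι] [DecidableEq ι] [Nonempty ι] [Fintype V]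
    (w' : ι → R) :
    #{w : ι → V | SameKernel w w'} ≤ Fintype.card V ^ #(univ.image w') := by
  have h : Fintype.card (↥(univ.image w') → V) = Fintype.card V ^ #(univ.image w') := by
    rw [Fintype.card_fun, Fintype.card_coe]
  rw [← h, ← Finset.card_univ]
  obtain ⟨i₀⟩ := ‹Nonempty ι›
  refine Finset.card_le_card_of_injOn
    (fun w x => Function.extend w' w (fun _ => w i₀) x.1) (fun _ _ => by simp) ?_
  intro w₁ h₁ w₂ h₂ h12
  simp only [coe_filter, mem_univ, true_and, Set.mem_ofPred_eq] at h₁ h₂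
  ext i
  have := congrFun h12 ⟨w' i, Finset.mem_image_of_mem w' (mem_univ i)⟩
  simpa only [h₁.symm.extend_apply, h₂.symm.extend_apply] using this

theorem SameKernel.walkEdge_eq_iff {V R : Type*} {q : ℕ} {w : Fin (q + 1) → V}
    {w' : Fin (q + 1) → R} (h : SameKernel w w') (s t : Fin q) :
    walkEdge w s = walkEdge w t ↔ walkEdge w' s = walkEdge w' t := by
  unfold walkEdge
  rw [Sym2.eq_iff, Sym2.eq_iff, h, h, h, h]

theorem SameKernel.mem_evenClosedWalks {V R : Type*} [Fintype V] [Fintype R] {q : ℕ}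
    {w : Fin (q + 1) → V} {w' : Fin (q + 1) → R} (h : SameKernel w w')
    (hw : w ∈ evenClosedWalks V q) : w' ∈ evenClosedWalks R q := by
  simp only [evenClosedWalks, mem_filter, mem_univ, true_and] at hw ⊢
  refine ⟨(h _ _).1 hw.1, fun s => ?_⟩
  convert hw.2 s using 2
  ext t
  simp only [mem_filter, mem_univ, true_and, h.walkEdge_eq_iff]

/-- Even closed walks in a large vertex set, weighted by the number of visited vertices, are
dominated by those in a vertex set of logarithmic size. -/
theorem sum_pow_card_image_le {V R : Type*} [Fintype V] [DecidableEq V] [Nonempty V] [Fintype R]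
    {q : ℕ} {x : ℝ} (hx : 0 ≤ x) (hR : q + x * Fintype.card V ≤ Fintype.card R) :
    ∑ w ∈ evenClosedWalks V q, x ^ #(univ.image w) ≤ #(evenClosedWalks R q) := by
  classical
  have hV : (0 : ℝ) < Fintype.card V := by exact_mod_cast Fintype.card_pos
  -- Double counting over pairs of walks of the same shape. A walk on v vertices has at least
  -- (x|V|)^v copies in `R`, each of weight |V|^(-v); conversely a walk in `R` has at most |V|^v
  -- copies in `V`, so it receives total weight at most 1.
  have h1 : ∀ w ∈ evenClosedWalks V q, x ^ #(univ.image w) ≤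
      ∑ w' ∈ evenClosedWalks R q,
        if SameKernel w w' then ((Fintype.card V : ℝ)⁻¹) ^ #(univ.image w') else 0 := by
    intro w hw
    set v := #(univ.image w) with hv
    have hvq : v ≤ q + 1 := by
      simpa using (Finset.card_image_le (s := (univ : Finset (Fin (q + 1)))) (f := w))
    have hsub : ({w' : Fin (q + 1) → R | SameKernel w w'} : Finset _) ⊆ evenClosedWalks R q := by
      intro w' hw'
      exact (Finset.mem_filter.1 hw').2.mem_evenClosedWalks hw
    have hpow : (x * Fintype.card V) ^ v ≤ #{w' : Fin (q + 1) → R | SameKernel w w'} := by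
      have hq : q ≤ Fintype.card R := by
        have : (q : ℝ) ≤ Fintype.card R := le_trans (by linarith [mul_nonneg hx hV.le]) hR
        exact_mod_cast this
      -- A walk of length q visits at most q + 1 vertices, so every factor of the falling factorial
      -- is at least |R| - q, hence at least x|V|.
      calc (x * Fintype.card V) ^ v ≤ ((Fintype.card R + 1 - v : ℕ) : ℝ) ^ v := by
            refine pow_le_pow_left₀ (by positivity) ?_ v
            rw [Nat.cast_sub (by omega)]
            have : (v : ℝ) ≤ q + 1 := by exact_mod_cast hvq
            push_cast; linarith
        _ ≤ ((Fintype.card R).descFactorial v : ℕ) := by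
            exact_mod_cast Nat.pow_sub_le_descFactorial _ _
        _ ≤ _ := by
            rw [hv]
            exact_mod_cast descFactorial_le_card_sameKernel (R := R) w
    rw [← Finset.sum_filter]
    have hfil : (evenClosedWalks R q).filter (SameKernel w) =
        ({w' : Fin (q + 1) → R | SameKernel w w'} : Finset _) := by
      ext w'
      simp only [mem_filter, mem_univ, true_and]
      exact ⟨fun h => h.2, fun h => ⟨h.mem_evenClosedWalks hw, h⟩⟩
    rw [hfil, Finset.sum_congr rfl (g := fun _ => ((Fintype.card V : ℝ)⁻¹) ^ v)
      (fun w' hw' => by rw [hv, (Finset.mem_filter.1 hw').2.card_image]), Finset.sum_const,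
      nsmul_eq_mul]
    calc x ^ v = (x * Fintype.card V) ^ v * ((Fintype.card V : ℝ)⁻¹) ^ v := by
          rw [← mul_pow, mul_assoc, mul_inv_cancel₀ hV.ne', mul_one]
      _ ≤ _ := mul_le_mul_of_nonneg_right hpow (by positivity)
  refine (Finset.sum_le_sum h1).trans ?_
  rw [Finset.sum_comm, Finset.card_eq_sum_ones, Nat.cast_sum]
  refine Finset.sum_le_sum fun w' _ => ?_
  rw [← Finset.sum_filter, Finset.sum_const, nsmul_eq_mul, Nat.cast_one]
  have h2 : #((evenClosedWalks V q).filter (fun w => SameKernel w w')) ≤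
      Fintype.card V ^ #(univ.image w') :=
    (Finset.card_le_card (Finset.filter_subset_filter _ (Finset.subset_univ _))).trans
      (card_sameKernel_le w')
  calc _ ≤ (Fintype.card V : ℝ) ^ #(univ.image w') * ((Fintype.card V : ℝ)⁻¹) ^ #(univ.image w') :=
        mul_le_mul_of_nonneg_right (by exact_mod_cast h2) (by positivity)
    _ = 1 := by rw [← mul_pow, mul_inv_cancel₀ hV.ne', one_pow]

end WalkShapes

/-! ### Counting sequences of scopes that hit given positions or repeat -/

section RandomScopes

open Finset

theorem card_le_of_injOn_restrict {M : ℕ} {S : Type*} [Fintype S] (A : Finset (Fin M → S))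
    (T : Finset (Fin M))
    (h : ∀ s ∈ A, ∀ s' ∈ A, (∀ i, i ∉ T → s i = s' i) → s = s') :
    #A ≤ Fintype.card S ^ (M - #T) := by
  classical
  have hc : Fintype.card ({i // i ∉ T} → S) = Fintype.card S ^ (M - #T) := by
    rw [Fintype.card_fun, Fintype.card_subtype_compl, Fintype.card_fin, Fintype.card_coe]
  rw [← hc, ← Finset.card_univ]
  refine Finset.card_le_card_of_injOn (fun s i => s i.1) (fun _ _ => by simp) ?_
  intro s hs s' hs' hss
  exact h s hs s' hs' fun i hi => congrFun hss ⟨i, hi⟩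

/-- The number of sequences of scopes that hit all of the positions in `F`. -/
theorem card_hitting_le {M : ℕ} {S E : Type*} [Fintype S] [DecidableEq S] [DecidableEq E]
    (pos : S → E) (hpos : Function.Injective pos) (F : Finset E) {x : ℝ} (hx0 : 0 ≤ x)
    (hx : M ≤ x * Fintype.card S) :
    (#{s : Fin M → S | F ⊆ univ.image (fun i => pos (s i))} : ℝ) ≤
      Fintype.card S ^ M * x ^ #F := by
  classical
  by_cases hFM : #F ≤ M
  swap
  · rw [Finset.card_eq_zero.2, Nat.cast_zero]
    · positivity
    · refine Finset.filter_eq_empty_iff.2 fun s _ hs => hFM ?_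
      exact (Finset.card_le_card hs).trans (Finset.card_image_le.trans (by simp))
  -- Union bound over the injective choice of an index hitting each position; the chosen coordinates
  -- are then forced because `pos` is injective.
  have hsub : ({s : Fin M → S | F ⊆ univ.image (fun i => pos (s i))} : Finset _) ⊆
      (univ : Finset (F ↪ Fin M)).biUnion fun f => {s | ∀ e : F, pos (s (f e)) = e.1} := by
    intro s hs
    have hs' := (Finset.mem_filter.1 hs).2
    choose f hf using fun e : F => Finset.mem_image.1 (hs' e.2)
    simp only [mem_biUnion, mem_univ, true_and, mem_filter]
    refine ⟨⟨f, fun e e' h => Subtype.ext ?_⟩, fun e => (hf e).2⟩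
    rw [← (hf e).2, ← (hf e').2, h]
  have hone : ∀ f : F ↪ Fin M,
      #{s : Fin M → S | ∀ e : F, pos (s (f e)) = e.1} ≤ Fintype.card S ^ (M - #F) := by
    intro f
    have := card_le_of_injOn_restrict {s : Fin M → S | ∀ e : F, pos (s (f e)) = e.1}
      (univ.map f) (fun s hs s' hs' h => by
        simp only [mem_filter, mem_univ, true_and] at hs hs'
        ext i
        by_cases hi : i ∈ univ.map f
        · obtain ⟨e, _, rfl⟩ := Finset.mem_map.1 hi
          exact hpos ((hs e).trans (hs' e).symm)
        · exact h i hi)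
    simpa using this
  have hcard : #{s : Fin M → S | F ⊆ univ.image (fun i => pos (s i))} ≤
      M ^ #F * Fintype.card S ^ (M - #F) := by
    refine (Finset.card_le_card hsub).trans (Finset.card_biUnion_le.trans ?_)
    refine (Finset.sum_le_sum fun f _ => hone f).trans ?_
    rw [Finset.sum_const, smul_eq_mul]
    refine Nat.mul_le_mul_right _ ?_
    rw [Finset.card_univ, Fintype.card_embedding_eq, Fintype.card_coe, Fintype.card_fin]
    exact Nat.descFactorial_le_pow _ _
  calc (#{s : Fin M → S | F ⊆ univ.image (fun i => pos (s i))} : ℝ)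
      ≤ (M : ℝ) ^ #F * (Fintype.card S : ℝ) ^ (M - #F) := by exact_mod_cast hcard
    _ ≤ (x * Fintype.card S) ^ #F * (Fintype.card S : ℝ) ^ (M - #F) := by gcongr
    _ = (Fintype.card S : ℝ) ^ M * x ^ #F := by
      rw [mul_pow, mul_assoc, ← pow_add, Nat.add_sub_cancel' hFM, mul_comm]

/-- The number of sequences in which some scope appears more than `c` times. -/
theorem card_repeated_le {M : ℕ} {S : Type*} [Fintype S] [DecidableEq S] (c : ℕ) {x : ℝ}
    (hx0 : 0 ≤ x) (hx : M ≤ x * Fintype.card S) :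
    (#{s : Fin M → S | ∃ y, c < #{i | s i = y}} : ℝ) ≤ Fintype.card S ^ M * (M * x ^ c) := by
  classical
  by_cases hcM : c < M
  swap
  · rw [Finset.card_eq_zero.2, Nat.cast_zero]
    · positivity
    · refine Finset.filter_eq_empty_iff.2 fun s _ hs => hcM ?_
      obtain ⟨y, hy⟩ := hs
      exact hy.trans_le ((Finset.card_le_univ _).trans (by simp))
  have hsub : ({s : Fin M → S | ∃ y, c < #{i | s i = y}} : Finset _) ⊆
      (univ : Finset (Fin (c + 1) ↪ Fin M)).biUnion fun f => {s | ∀ j, s (f j) = s (f 0)} := by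
    intro s hs
    obtain ⟨y, hy⟩ := (Finset.mem_filter.1 hs).2
    obtain ⟨T, hT, hTc⟩ := Finset.exists_subset_card_eq (Nat.succ_le_of_lt hy)
    let f := (T.orderEmbOfFin hTc).toEmbedding
    have hf : ∀ j, s (f j) = y := fun j =>
      (Finset.mem_filter.1 (hT (T.orderEmbOfFin_mem hTc j))).2
    simp only [mem_biUnion, mem_univ, true_and, mem_filter]
    exact ⟨f, fun j => (hf j).trans (hf 0).symm⟩
  -- Among c + 1 equal coordinates the one at `f 0` is free and determines the other c; this is why
  -- the bound has c powers of x and one spare factor M.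
  have hone : ∀ f : Fin (c + 1) ↪ Fin M,
      #{s : Fin M → S | ∀ j, s (f j) = s (f 0)} ≤ Fintype.card S ^ (M - c) := by
    intro f
    have := card_le_of_injOn_restrict {s : Fin M → S | ∀ j, s (f j) = s (f 0)}
      ((univ.erase 0).map f) (fun s hs s' hs' h => by
        simp only [mem_filter, mem_univ, true_and] at hs hs'
        have h0 : s (f 0) = s' (f 0) := h _ (by simp)
        ext i
        by_cases hi : i ∈ (univ.erase 0).map f
        · obtain ⟨j, _, rfl⟩ := Finset.mem_map.1 hi
          rw [hs j, hs' j, h0]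
        · exact h i hi)
    simpa using this
  have hcard : #{s : Fin M → S | ∃ y, c < #{i | s i = y}} ≤
      M ^ (c + 1) * Fintype.card S ^ (M - c) := by
    refine (Finset.card_le_card hsub).trans (Finset.card_biUnion_le.trans ?_)
    refine (Finset.sum_le_sum fun f _ => hone f).trans ?_
    rw [Finset.sum_const, smul_eq_mul]
    refine Nat.mul_le_mul_right _ ?_
    rw [Finset.card_univ, Fintype.card_embedding_eq, Fintype.card_fin, Fintype.card_fin]
    exact Nat.descFactorial_le_pow _ _
  calc (#{s : Fin M → S | ∃ y, c < #{i | s i = y}} : ℝ)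
      ≤ (M : ℝ) ^ (c + 1) * (Fintype.card S : ℝ) ^ (M - c) := by exact_mod_cast hcard
    _ = M * ((M : ℝ) ^ c * (Fintype.card S : ℝ) ^ (M - c)) := by ring
    _ ≤ M * ((x * Fintype.card S) ^ c * (Fintype.card S : ℝ) ^ (M - c)) := by gcongr
    _ = (Fintype.card S : ℝ) ^ M * (M * x ^ c) := by
      rw [mul_pow, mul_assoc, ← pow_add, Nat.add_sub_cancel' hcM.le]; ring

end RandomScopes

/-! ### Dense random sign matrices: Khintchine, a lattice net, and the count of even closed walks -/

section SignMatrices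

open Finset Matrix

theorem sum_exp_signs {E : Type*} [Fintype E] [DecidableEq E] (c : E → ℝ) :
    ∑ b : E → ℤˣ, Real.exp (∑ e, (((b e : ℤˣ) : ℤ) : ℝ) * c e) = ∏ e, (2 * Real.cosh (c e)) := by
  have h : ∀ e, 2 * Real.cosh (c e) = ∑ s : ℤˣ, Real.exp (((s : ℤ) : ℝ) * c e) := by
    intro e
    rw [Real.cosh_eq, show (univ : Finset ℤˣ) = {1, -1} from rfl, Finset.sum_pair (by decide)]
    simp; ring
  simp_rw [h, Real.exp_sum]
  rw [Finset.prod_univ_sum, Fintype.piFinset_univ]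

theorem pow_le_factorial_mul_exp_add_exp_neg (z : ℝ) (p : ℕ) :
    z ^ (2 * p) ≤ (2 * p).factorial * (Real.exp z + Real.exp (-z)) := by
  have h := Real.pow_div_factorial_le_exp |z| (abs_nonneg z) (2 * p)
  rw [(even_two_mul p).pow_abs, div_le_iff₀ (by positivity), mul_comm (Real.exp _)] at h
  refine h.trans (mul_le_mul_of_nonneg_left ?_ (by positivity))
  rcases abs_cases z with ⟨h, _⟩ | ⟨h, _⟩ <;> rw [h] <;>
    linarith [Real.exp_pos z, Real.exp_pos (-z)]

/-- Khintchine's inequality for even moments. -/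
theorem sum_signs_pow_le {E : Type*} [Fintype E] [DecidableEq E] (c : E → ℝ) {v : ℝ} (hv : 0 < v)
    (hc : ∑ e, c e ^ 2 ≤ v) {p : ℕ} (hp : 0 < p) :
    ∑ b : E → ℤˣ, (∑ e, (((b e : ℤˣ) : ℤ) : ℝ) * c e) ^ (2 * p)
      ≤ 2 ^ Fintype.card E * (2 * (6 * p * v) ^ p) := by
  have hp' : (0 : ℝ) < p := by exact_mod_cast hp
  -- This choice makes exp(θ²v/2) = e^p. With (2p)! ≤ (2p)^(2p) the moment is at most 2(2epv)^p, and
  -- e ≤ 3 gives the constant 6.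
  set θ := Real.sqrt (2 * p / v) with hθ
  have hθ2 : θ ^ 2 = 2 * p / v := Real.sq_sqrt (by positivity)
  have hθ0 : 0 < θ := Real.sqrt_pos.2 (by positivity)
  have hexp : ∀ t : ℝ, t ^ 2 = θ ^ 2 →
      ∑ b : E → ℤˣ, Real.exp (t * ∑ e, (((b e : ℤˣ) : ℤ) : ℝ) * c e)
        ≤ 2 ^ Fintype.card E * Real.exp p := by
    intro t ht
    have h1 : ∀ b : E → ℤˣ, t * ∑ e, (((b e : ℤˣ) : ℤ) : ℝ) * c e
        = ∑ e, (((b e : ℤˣ) : ℤ) : ℝ) * (t * c e) := fun b => by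
      rw [Finset.mul_sum]; exact Finset.sum_congr rfl fun e _ => by ring
    simp_rw [h1]
    rw [sum_exp_signs, Finset.prod_mul_distrib, Finset.prod_const, Finset.card_univ]
    refine mul_le_mul_of_nonneg_left ?_ (by positivity)
    refine (Finset.prod_le_prod (fun e _ => (Real.cosh_pos _).le)
      (fun e _ => Real.cosh_le_exp_half_sq _)).trans ?_
    rw [← Real.exp_sum, Real.exp_le_exp, ← Finset.sum_div]
    simp_rw [mul_pow, ← Finset.mul_sum]
    rw [ht, hθ2]
    calc 2 * p / v * (∑ e, c e ^ 2) / 2 ≤ 2 * p / v * v / 2 := by gcongr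
      _ = p := by field_simp
  have hfac : ((2 * p).factorial : ℝ) ≤ (2 * p : ℝ) ^ (2 * p) := by
    exact_mod_cast Nat.factorial_le_pow (2 * p)
  have hpow : θ ^ (2 * p) = (2 * p / v) ^ p := by rw [pow_mul, hθ2]
  have hmain : θ ^ (2 * p) * ∑ b : E → ℤˣ, (∑ e, (((b e : ℤˣ) : ℤ) : ℝ) * c e) ^ (2 * p)
      ≤ (2 * p : ℝ) ^ (2 * p) * (2 * (2 ^ Fintype.card E * Real.exp p)) := by
    rw [Finset.mul_sum]
    calc _ ≤ ∑ b : E → ℤˣ, ((2 * p).factorial : ℝ) *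
          (Real.exp (θ * ∑ e, (((b e : ℤˣ) : ℤ) : ℝ) * c e) +
            Real.exp (-θ * ∑ e, (((b e : ℤˣ) : ℤ) : ℝ) * c e)) := by
          refine Finset.sum_le_sum fun b _ => ?_
          rw [← mul_pow, neg_mul]
          exact pow_le_factorial_mul_exp_add_exp_neg _ _
      _ ≤ _ := by
          rw [← Finset.mul_sum, Finset.sum_add_distrib]
          have h1 := hexp θ rfl
          have h2 := hexp (-θ) (neg_sq θ)
          refine mul_le_mul hfac (by linarith) ?_ (by positivity)
          exact add_nonneg (Finset.sum_nonneg fun _ _ => (Real.exp_pos _).le)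
            (Finset.sum_nonneg fun _ _ => (Real.exp_pos _).le)
  rw [hpow] at hmain
  have hE : Real.exp p ≤ 3 ^ p := by
    rw [← Real.exp_one_pow]
    exact pow_le_pow_left₀ (Real.exp_pos _).le (by linarith [Real.exp_one_lt_d9]) p
  have hD : (0 : ℝ) < (2 * p / v) ^ p := by positivity
  rw [← mul_le_mul_iff_right₀ hD]
  refine hmain.trans ?_
  calc (2 * p : ℝ) ^ (2 * p) * (2 * (2 ^ Fintype.card E * Real.exp p))
      ≤ (2 * p : ℝ) ^ (2 * p) * (2 * (2 ^ Fintype.card E * 3 ^ p)) := by gcongr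
    _ = (2 ^ Fintype.card E * 2) * (((2 * p : ℝ) ^ 2) ^ p * 3 ^ p) := by rw [← pow_mul]; ring
    _ = (2 ^ Fintype.card E * 2) * ((2 * p / v) ^ p * (6 * p * v) ^ p) := by
        rw [← mul_pow, ← mul_pow]
        congr 2
        field_simp; ring
    _ = _ := by ring

/-- Integer vectors of squared norm at most `7 r`. -/
noncomputable def latticeBall (r : ℕ) : Finset (Fin r → ℤ) :=
  {g ∈ Fintype.piFinset fun _ => Finset.Icc (-(7 * r) : ℤ) (7 * r) | ∑ i, g i ^ 2 ≤ 7 * r}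

theorem mem_latticeBall {r : ℕ} {g : Fin r → ℤ} (hg : ∑ i, g i ^ 2 ≤ 7 * (r : ℤ)) :
    g ∈ latticeBall r := by
  refine Finset.mem_filter.2 ⟨Fintype.mem_piFinset.2 fun i => Finset.mem_Icc.2 ?_, hg⟩
  have h1 : g i ^ 2 ≤ 7 * r :=
    (Finset.single_le_sum (f := fun i => g i ^ 2) (fun i _ => sq_nonneg _) (mem_univ i)).trans hg
  constructor <;> nlinarith [sq_nonneg (g i - 1), sq_nonneg (g i + 1), sq_nonneg (g i)]

theorem sum_half_pow_natAbs_le (N : ℕ) :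
    ∑ z ∈ Finset.Icc (-(N : ℤ)) N, (1 / 2 : ℝ) ^ z.natAbs ≤ 4 := by
  rw [← Finset.sum_fiberwise_of_maps_to (g := Int.natAbs) (t := range (N + 1))
    (fun z hz => by rw [Finset.mem_Icc] at hz; rw [Finset.mem_range]; omega)]
  calc _ ≤ ∑ j ∈ range (N + 1), 2 * (1 / 2 : ℝ) ^ j := by
        refine Finset.sum_le_sum fun j _ => ?_
        rw [Finset.sum_congr rfl (g := fun _ => (1 / 2 : ℝ) ^ j)
          (fun z hz => by rw [(Finset.mem_filter.1 hz).2]), Finset.sum_const, nsmul_eq_mul]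
        refine mul_le_mul_of_nonneg_right ?_ (by positivity)
        have : #{z ∈ Finset.Icc (-(N : ℤ)) N | z.natAbs = j} ≤ #({(j : ℤ), -(j : ℤ)} : Finset ℤ) := by
          refine Finset.card_le_card fun z hz => ?_
          have := (Finset.mem_filter.1 hz).2
          simp only [mem_insert, mem_singleton]; omega
        exact_mod_cast this.trans Finset.card_le_two
    _ ≤ 4 := by
        rw [← Finset.mul_sum]
        linarith [sum_geometric_two_le (N + 1)]

/-- For integers |g_i| ≤ g_i², so the ℓ¹ norm is at most 7r and 2^(7r) ∏ 2^(-|g_i|) ≥ 1 on the ball.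
Summing this weight over a box, each coordinate contributes at most 4, and 2⁷ · 4 = 512. -/
theorem card_latticeBall_le (r : ℕ) : (#(latticeBall r) : ℝ) ≤ 512 ^ r := by
  have h1 : ∀ g ∈ latticeBall r, (1 : ℝ) ≤ 2 ^ (7 * r) * ∏ i, (1 / 2 : ℝ) ^ (g i).natAbs := by
    intro g hg
    have hs := (Finset.mem_filter.1 hg).2
    have hle : ∑ i, (g i).natAbs ≤ 7 * r := by
      have : ((∑ i, (g i).natAbs : ℕ) : ℤ) ≤ 7 * r := by
        push_cast
        refine le_trans (Finset.sum_le_sum fun i _ => ?_) hs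
        rw [← sq_abs]
        rcases (abs_nonneg (g i)).eq_or_lt with h | h <;> nlinarith
      exact_mod_cast this
    rw [Finset.prod_pow_eq_pow_sum, one_div, inv_pow, ← div_eq_mul_inv, one_le_div (by positivity)]
    exact pow_le_pow_right₀ (by norm_num) hle
  calc (#(latticeBall r) : ℝ) = ∑ g ∈ latticeBall r, (1 : ℝ) := by simp
    _ ≤ ∑ g ∈ latticeBall r, 2 ^ (7 * r) * ∏ i, (1 / 2 : ℝ) ^ (g i).natAbs := Finset.sum_le_sum h1
    _ ≤ ∑ g ∈ Fintype.piFinset fun _ : Fin r => Finset.Icc (-(7 * r) : ℤ) (7 * r),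
          2 ^ (7 * r) * ∏ i, (1 / 2 : ℝ) ^ (g i).natAbs :=
        Finset.sum_le_sum_of_subset_of_nonneg (Finset.filter_subset _ _)
          (fun _ _ _ => by positivity)
    _ = 2 ^ (7 * r) * (∑ z ∈ Finset.Icc (-(7 * r) : ℤ) (7 * r), (1 / 2 : ℝ) ^ z.natAbs) ^ r := by
        have h2 := Finset.prod_univ_sum (fun _ : Fin r => Finset.Icc (-(7 * r) : ℤ) (7 * r))
          (fun _ z => (1 / 2 : ℝ) ^ z.natAbs)
        rw [← Finset.mul_sum, ← h2, Finset.prod_const, Finset.card_univ, Fintype.card_fin]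
    _ ≤ 2 ^ (7 * r) * 4 ^ r := by
        refine mul_le_mul_of_nonneg_left (pow_le_pow_left₀ (Finset.sum_nonneg fun _ _ => by
          positivity) ?_ r) (by positivity)
        exact_mod_cast sum_half_pow_natAbs_le (7 * r)
    _ = 512 ^ r := by rw [pow_mul, ← mul_pow]; norm_num

/-- The eigenvalues of a symmetric matrix are detected by a lattice vector. -/
theorem exists_latticeBall_eigenvalue_le {r : ℕ} (hr : 0 < r) {Y : Matrix (Fin r) (Fin r) ℝ}
    (hY : Y.IsHermitian) :
    ∃ g ∈ latticeBall r, ∀ j, r * |hY.eigenvalues j| ≤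
      |(fun i => (g i : ℝ)) ⬝ᵥ Y *ᵥ (fun i => (g i : ℝ))| := by
  have : Nonempty (Fin r) := ⟨⟨0, hr⟩⟩
  obtain ⟨j₀, hj₀⟩ := Finite.exists_max fun j => |hY.eigenvalues j|
  obtain ⟨v, hv, hYv⟩ := exists_eigenvector hY j₀
  set lam := hY.eigenvalues j₀
  have hr' : (0 : ℝ) < r := by exact_mod_cast hr
  -- The top unit eigenvector is scaled to length 2√r and rounded coordinatewise, with error e of
  -- squared norm at most r/4. At the rounded vector the form is at least |λ|(4r - 2r - r/4) ≥ r|λ|,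
  -- the losses being the cross term and the form at e.
  set s := 2 * Real.sqrt r with hs
  have hs2 : s ^ 2 = 4 * r := by rw [hs, mul_pow, Real.sq_sqrt hr'.le]; norm_num
  have hs0 : 0 < s := by positivity
  set g : Fin r → ℤ := fun i => round (s * v i)
  set e : Fin r → ℝ := fun i => g i - s * v i
  have hge : (fun i => (g i : ℝ)) = s • v + e := by
    ext i; simp [e]
  have hee : e ⬝ᵥ e ≤ r / 4 := by
    calc e ⬝ᵥ e ≤ ∑ _i : Fin r, (1 / 4 : ℝ) := by
          refine Finset.sum_le_sum fun i _ => ?_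
          have := abs_sub_round (s * v i)
          have h2 : |e i| ≤ 1 / 2 := by rw [← abs_neg]; simpa [e, g] using this
          rw [← sq, ← sq_abs]
          nlinarith [abs_nonneg (e i)]
      _ = r / 4 := by simp; ring
  have hve : (v ⬝ᵥ e) ^ 2 ≤ r / 4 := by
    have := Finset.sum_mul_sq_le_sq_mul_sq univ v e
    have h1 : ∑ i, v i ^ 2 = 1 := by rw [← hv]; exact Finset.sum_congr rfl fun i _ => sq _
    have h2 : ∑ i, e i ^ 2 = e ⬝ᵥ e := Finset.sum_congr rfl fun i _ => sq _
    rw [h1, h2, one_mul] at this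
    exact this.trans hee
  have hve' : |v ⬝ᵥ e| ≤ s / 4 := by
    exact abs_le_of_sq_le_sq (by nlinarith) (by positivity)
  refine ⟨g, mem_latticeBall ?_, fun j => ?_⟩
  · have h1 : ∑ i, (g i : ℝ) ^ 2 ≤ 7 * r := by
      have : ∑ i, (g i : ℝ) ^ 2 = (s • v + e) ⬝ᵥ (s • v + e) := by
        rw [← hge]; exact Finset.sum_congr rfl fun i _ => sq _
      rw [this, add_dotProduct, dotProduct_add, dotProduct_add, smul_dotProduct, dotProduct_smul,
        smul_dotProduct, dotProduct_smul, hv, dotProduct_comm e v]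
      simp only [smul_eq_mul]
      nlinarith [le_abs_self (v ⬝ᵥ e)]
    exact_mod_cast h1
  · refine (mul_le_mul_of_nonneg_left (hj₀ j) hr'.le).trans ?_
    have hquad := quadratic_form_le hY hj₀ e
    have hYT : e ⬝ᵥ Y *ᵥ v = v ⬝ᵥ Y *ᵥ e := by
      rw [dotProduct_comm, dotProduct_mulVec, ← mulVec_transpose,
        show Yᵀ = Y from hY]
    have hexpand : (s • v + e) ⬝ᵥ Y *ᵥ (s • v + e)
        = lam * (s ^ 2) + 2 * s * lam * (v ⬝ᵥ e) + e ⬝ᵥ Y *ᵥ e := by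
      have h1 : v ⬝ᵥ Y *ᵥ e = lam * (v ⬝ᵥ e) := by
        rw [← hYT, hYv, dotProduct_smul, smul_eq_mul, dotProduct_comm]
      rw [mulVec_add, mulVec_smul, add_dotProduct, dotProduct_add, dotProduct_add, smul_dotProduct,
        dotProduct_smul, smul_dotProduct, dotProduct_smul, hYT, h1, hYv, dotProduct_smul, hv]
      simp only [smul_eq_mul]; ring
    rw [hge, hexpand]
    have h3 : |lam * s ^ 2| - |2 * s * lam * (v ⬝ᵥ e)| - |e ⬝ᵥ Y *ᵥ e| ≤
        |lam * s ^ 2 + 2 * s * lam * (v ⬝ᵥ e) + e ⬝ᵥ Y *ᵥ e| := by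
      have a := abs_sub_abs_le_abs_sub (lam * s ^ 2) (-(2 * s * lam * (v ⬝ᵥ e) + e ⬝ᵥ Y *ᵥ e))
      rw [abs_neg, sub_neg_eq_add, ← add_assoc] at a
      linarith [abs_add_le (2 * s * lam * (v ⬝ᵥ e)) (e ⬝ᵥ Y *ᵥ e)]
    refine le_trans ?_ h3
    have h4 : |2 * s * lam * (v ⬝ᵥ e)| ≤ |lam| * (2 * r) := by
      rw [abs_mul, abs_mul, abs_of_pos (by positivity : 0 < 2 * s)]
      have := mul_le_mul_of_nonneg_left hve' (by positivity : 0 ≤ 2 * s * |lam|)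
      nlinarith [abs_nonneg lam]
    have h5 : |e ⬝ᵥ Y *ᵥ e| ≤ |lam| * (r / 4) :=
      hquad.trans (mul_le_mul_of_nonneg_left hee (abs_nonneg _))
    rw [abs_mul, abs_of_pos (by positivity : 0 < s ^ 2), hs2]
    nlinarith [abs_nonneg lam, mul_nonneg (abs_nonneg lam) hr'.le]

/-- This writes the form as a linear combination of independent signs, the shape required by
Khintchine's inequality. -/
theorem quadratic_form_signedAdjacency {V : Type*} [Fintype V] [DecidableEq V] (g : V → ℝ)
    (b : Sym2 V → ℤˣ) :
    g ⬝ᵥ signedAdjacency id b *ᵥ g = ∑ e, (((b e : ℤˣ) : ℤ) : ℝ) *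
      ∑ x : V × V with s(x.1, x.2) = e, g x.1 * g x.2 := by
  have h1 : g ⬝ᵥ signedAdjacency id b *ᵥ g
      = ∑ x : V × V, (((b s(x.1, x.2) : ℤˣ) : ℤ) : ℝ) * (g x.1 * g x.2) := by
    simp only [dotProduct, mulVec, Finset.mul_sum, Fintype.sum_prod_type]
    refine Finset.sum_congr rfl fun x _ => Finset.sum_congr rfl fun y _ => ?_
    simp only [signedAdjacency, signedWeight, Matrix.of_apply, id, Finset.sum_ite_eq',
      Finset.mem_univ, if_true]
    ring
  rw [h1, ← Finset.sum_fiberwise_of_maps_to (g := fun x : V × V => s(x.1, x.2))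
    (t := (univ : Finset (Sym2 V))) (fun _ _ => Finset.mem_univ _)]
  refine Finset.sum_congr rfl fun e _ => ?_
  rw [Finset.mul_sum]
  exact Finset.sum_congr rfl fun x hx => by rw [(Finset.mem_filter.1 hx).2]

theorem sum_sq_quadratic_coefficients_le {V : Type*} [Fintype V] [DecidableEq V] (g : V → ℝ) :
    ∑ e : Sym2 V, (∑ x : V × V with s(x.1, x.2) = e, g x.1 * g x.2) ^ 2
      ≤ 2 * (∑ x, g x ^ 2) ^ 2 := by
  have hcard : ∀ e : Sym2 V, #{x : V × V | s(x.1, x.2) = e} ≤ 2 := by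
    intro e
    induction e using Sym2.ind with
    | _ a b =>
      refine (Finset.card_le_card (t := {(a, b), (b, a)}) fun x hx => ?_).trans Finset.card_le_two
      have := (Finset.mem_filter.1 hx).2
      rw [Sym2.eq_iff] at this
      simp only [mem_insert, mem_singleton, Prod.ext_iff]
      exact this
  calc _ ≤ ∑ e : Sym2 V, 2 * ∑ x : V × V with s(x.1, x.2) = e, (g x.1 * g x.2) ^ 2 := by
        refine Finset.sum_le_sum fun e _ => sq_sum_le_card_mul_sum_sq.trans ?_
        exact mul_le_mul_of_nonneg_right (by exact_mod_cast hcard e)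
          (Finset.sum_nonneg fun _ _ => sq_nonneg _)
    _ = 2 * ∑ x : V × V, (g x.1 * g x.2) ^ 2 := by
        rw [← Finset.mul_sum, Finset.sum_fiberwise_of_maps_to (fun _ _ => Finset.mem_univ _)]
    _ = _ := by
        rw [Fintype.sum_prod_type, sq (∑ x, g x ^ 2), Finset.sum_mul_sum]
        simp only [mul_pow]

/-- The quadratic form of a random sign matrix at an integer vector. -/
noncomputable def signForm {r : ℕ} (b : Sym2 (Fin r) → ℤˣ) (g : Fin r → ℤ) : ℝ :=
  (fun i => (g i : ℝ)) ⬝ᵥ signedAdjacency id b *ᵥ (fun i => (g i : ℝ))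

/-- One lattice vector controls all r eigenvalues, but it depends on the signs. Replacing it by the
sum over the whole ball makes the bound averageable over `b`. -/
theorem trace_signedAdjacency_pow_le {r : ℕ} (hr : 0 < r) (p : ℕ) (b : Sym2 (Fin r) → ℤˣ) :
    (signedAdjacency id b ^ (2 * p)).trace ≤
      r * ∑ g ∈ latticeBall r, signForm b g ^ (2 * p) / (r : ℝ) ^ (2 * p) := by
  have hr' : (0 : ℝ) < r := by exact_mod_cast hr
  have hY := isHermitian_signedAdjacency id b
  obtain ⟨g, hg, hgj⟩ := exists_latticeBall_eigenvalue_le hr hY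
  rw [trace_pow_eq_sum_eigenvalues hY]
  have h1 : ∀ j, hY.eigenvalues j ^ (2 * p) ≤ signForm b g ^ (2 * p) / (r : ℝ) ^ (2 * p) := by
    intro j
    rw [le_div_iff₀ (by positivity), ← mul_pow, ← (even_two_mul p).pow_abs,
      ← (even_two_mul p).pow_abs (signForm b g)]
    refine pow_le_pow_left₀ (abs_nonneg _) ?_ _
    rw [abs_mul, abs_of_pos hr', mul_comm]
    exact hgj j
  refine (Finset.sum_le_sum fun j _ => h1 j).trans ?_
  rw [Finset.sum_const, Finset.card_univ, Fintype.card_fin, nsmul_eq_mul]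
  refine mul_le_mul_of_nonneg_left ?_ hr'.le
  exact Finset.single_le_sum (f := fun g => signForm b g ^ (2 * p) / (r : ℝ) ^ (2 * p))
    (fun g _ => div_nonneg ((even_two_mul p).pow_nonneg _) (by positivity)) hg

/-- The squared coefficients of the form sum to at most 2(7r)² = 98r², and 6 · 98 = 588. The factor
r^(2p) is what the normalisation in `trace_signedAdjacency_pow_le` cancels. -/
theorem sum_signForm_pow_le {r p : ℕ} (hr : 0 < r) (hp : 0 < p) {g : Fin r → ℤ}
    (hg : g ∈ latticeBall r) :
    ∑ b : Sym2 (Fin r) → ℤˣ, signForm b g ^ (2 * p)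
      ≤ 2 ^ Fintype.card (Sym2 (Fin r)) * (2 * (588 * p) ^ p) * (r : ℝ) ^ (2 * p) := by
  have hr' : (0 : ℝ) < r := by exact_mod_cast hr
  simp only [signForm, quadratic_form_signedAdjacency]
  have hc : ∑ e : Sym2 (Fin r), (∑ x : Fin r × Fin r with s(x.1, x.2) = e,
      (g x.1 : ℝ) * (g x.2 : ℝ)) ^ 2 ≤ 98 * (r : ℝ) ^ 2 := by
    refine (sum_sq_quadratic_coefficients_le (fun i => (g i : ℝ))).trans ?_
    have hs : ∑ i, (g i : ℝ) ^ 2 ≤ 7 * r := by exact_mod_cast (Finset.mem_filter.1 hg).2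
    have := pow_le_pow_left₀ (Finset.sum_nonneg fun i _ => sq_nonneg (g i : ℝ)) hs 2
    linarith [mul_pow (7 : ℝ) r 2]
  refine (sum_signs_pow_le _ (by positivity) hc hp).trans (le_of_eq ?_)
  have h : (6 * (p : ℝ) * (98 * (r : ℝ) ^ 2)) = (588 * p) * (r : ℝ) ^ 2 := by ring
  rw [h, mul_pow (588 * (p : ℝ)), ← pow_mul (r : ℝ) 2 p]
  generalize (588 * (p : ℝ)) ^ p = X
  ring

/-- There are few even closed walks. -/
theorem card_evenClosedWalks_le {r p : ℕ} (hr : 0 < r) (hp : 0 < p) :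
    (#(evenClosedWalks (Fin r) (2 * p)) : ℝ) ≤ 2 * r * 512 ^ r * (588 * p) ^ p := by
  have hr' : (0 : ℝ) < r := by exact_mod_cast hr
  have h2 : (0 : ℝ) < 2 ^ Fintype.card (Sym2 (Fin r)) := by positivity
  rw [← mul_le_mul_iff_right₀ h2, card_evenClosedWalks_mul]
  refine (Finset.sum_le_sum fun b _ => trace_signedAdjacency_pow_le hr p b).trans ?_
  rw [← Finset.mul_sum, Finset.sum_comm]
  have h3 : ∀ g ∈ latticeBall r, ∑ b : Sym2 (Fin r) → ℤˣ, signForm b g ^ (2 * p) /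
      (r : ℝ) ^ (2 * p) ≤ 2 ^ Fintype.card (Sym2 (Fin r)) * (2 * (588 * p) ^ p) := by
    intro g hg
    rw [← Finset.sum_div, div_le_iff₀ (by positivity)]
    exact sum_signForm_pow_le hr hp hg
  refine (mul_le_mul_of_nonneg_left (Finset.sum_le_sum h3) hr'.le).trans ?_
  rw [Finset.sum_const, nsmul_eq_mul]
  calc (r : ℝ) * (#(latticeBall r) * (2 ^ Fintype.card (Sym2 (Fin r)) * (2 * (588 * p) ^ p)))
      ≤ r * (512 ^ r * (2 ^ Fintype.card (Sym2 (Fin r)) * (2 * (588 * p) ^ p))) := by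
        have := card_latticeBall_le r
        gcongr
    _ = _ := by ring

end SignMatrices

/-! ### Sparse random signed graphs: the norm is o(log n) -/

section SparseSignedGraphs

open Finset

/-- The trace moment of a sparse random signed graph without edges of high multiplicity. -/
theorem sum_trace_pow_le {V S : Type*} [Fintype V] [DecidableEq V] [Nonempty V] [Fintype S]
    [DecidableEq S] {pos : S → Sym2 V} (hpos : Function.Injective pos) {M c p r : ℕ} {x : ℝ}
    (hx0 : 0 < x) (hx1 : x ≤ 1) (hx : M ≤ x * Fintype.card S)
    (hr : (2 * p : ℕ) + x * Fintype.card V ≤ r) :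
    ∑ s : Fin M → S with ∀ y, #{i | s i = y} ≤ c,
      ∑ b : Fin M → ℤˣ, (signedAdjacency (fun i => pos (s i)) b ^ (2 * p)).trace
      ≤ (2 * Fintype.card S) ^ M * ((c : ℝ) ^ (2 * p) * x⁻¹ * #(evenClosedWalks (Fin r) (2 * p))) := by
  classical
  simp_rw [sum_trace_signedAdjacency_pow]
  have h1 : ∀ s : Fin M → S, (∀ y, #{i | s i = y} ≤ c) → ∀ w ∈ evenClosedWalks V (2 * p),
      ∑ b : Fin M → ℤˣ, ∏ t, signedWeight (fun i => pos (s i)) b (walkEdge w t)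
      ≤ 2 ^ M * (c : ℝ) ^ (2 * p) *
        (if univ.image (walkEdge w) ⊆ univ.image (fun i => pos (s i)) then 1 else 0) := by
    intro s hs w _
    have := sum_prod_signedWeight_le (fun i => pos (s i)) c (fun e => ?_) w
    · simpa using this
    · by_cases he : ∃ y, pos y = e
      · obtain ⟨y, rfl⟩ := he
        simpa only [hpos.eq_iff] using hs y
      · rw [Finset.card_eq_zero.2 (Finset.filter_eq_empty_iff.2 fun i _ hi => he ⟨_, hi⟩)]
        exact Nat.zero_le _
  calc _ ≤ ∑ s : Fin M → S with ∀ y, #{i | s i = y} ≤ c, ∑ w ∈ evenClosedWalks V (2 * p),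
        2 ^ M * (c : ℝ) ^ (2 * p) *
        (if univ.image (walkEdge w) ⊆ univ.image (fun i => pos (s i)) then 1 else 0) :=
        Finset.sum_le_sum fun s hs => Finset.sum_le_sum fun w hw =>
          h1 s (Finset.mem_filter.1 hs).2 w hw
    _ ≤ ∑ s : Fin M → S, ∑ w ∈ evenClosedWalks V (2 * p), 2 ^ M * (c : ℝ) ^ (2 * p) *
        (if univ.image (walkEdge w) ⊆ univ.image (fun i => pos (s i)) then 1 else 0) :=
        Finset.sum_le_sum_of_subset_of_nonneg (Finset.filter_subset _ _) fun s _ _ =>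
          Finset.sum_nonneg fun w _ => by positivity
    _ = 2 ^ M * (c : ℝ) ^ (2 * p) * ∑ w ∈ evenClosedWalks V (2 * p),
        (#{s : Fin M → S | univ.image (walkEdge w) ⊆ univ.image (fun i => pos (s i))} : ℝ) := by
        rw [Finset.sum_comm, Finset.mul_sum]
        refine Finset.sum_congr rfl fun w _ => ?_
        rw [← Finset.mul_sum, Finset.sum_boole]
    _ ≤ 2 ^ M * (c : ℝ) ^ (2 * p) * ∑ w ∈ evenClosedWalks V (2 * p),
        (Fintype.card S : ℝ) ^ M * (x⁻¹ * x ^ #(univ.image w)) := by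
        refine mul_le_mul_of_nonneg_left (Finset.sum_le_sum fun w _ => ?_) (by positivity)
        refine (card_hitting_le pos hpos _ hx0.le hx).trans ?_
        refine mul_le_mul_of_nonneg_left ?_ (by positivity)
        -- The distinct edges number at least the visited vertices minus one; that one is the source
        -- of the factor x⁻¹.
        rw [le_inv_mul_iff₀ hx0, ← pow_succ']
        exact pow_le_pow_of_le_one hx0.le hx1 (card_image_walk_le w)
    _ = (2 * Fintype.card S) ^ M * ((c : ℝ) ^ (2 * p) * x⁻¹ *
        ∑ w ∈ evenClosedWalks V (2 * p), x ^ #(univ.image w)) := by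
        rw [← Finset.mul_sum, ← Finset.mul_sum, mul_pow]; ring
    _ ≤ _ := by
        refine mul_le_mul_of_nonneg_left (mul_le_mul_of_nonneg_left ?_ (by positivity))
          (by positivity)
        exact sum_pow_card_image_le hx0.le (by simpa using hr)

/-- A tail bound for the trace moment of a sparse random signed graph. -/
theorem card_large_trace_le {V S : Type*} [Fintype V] [DecidableEq V] [Nonempty V] [Fintype S]
    [DecidableEq S] {pos : S → Sym2 V} (hpos : Function.Injective pos) {M p r : ℕ} (c : ℕ)
    (hr0 : 0 < r) (hp : 0 < p) {x : ℝ}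
    (hx0 : 0 < x) (hx1 : x ≤ 1) (hx : M ≤ x * Fintype.card S)
    (hr : (2 * p : ℕ) + x * Fintype.card V ≤ r) {τ : ℝ} (hτ : 0 < τ) :
    (#{ω : Fin M → S × ℤˣ | τ ^ (2 * p) <
      (signedAdjacency (fun i => pos (ω i).1) (fun i => (ω i).2) ^ (2 * p)).trace} : ℝ)
      ≤ (2 * Fintype.card S) ^ M * (M * x ^ c +
        (c : ℝ) ^ (2 * p) * x⁻¹ * (2 * r * 512 ^ r * (588 * p) ^ p) / τ ^ (2 * p)) := by
  classical
  set T : (Fin M → S) → (Fin M → ℤˣ) → ℝ := fun s b =>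
    (signedAdjacency (fun i => pos (s i)) b ^ (2 * p)).trace with hT
  have hT0 : ∀ s b, 0 ≤ T s b := fun s b => by
    rw [hT]
    simp only
    rw [trace_pow_eq_sum_eigenvalues (isHermitian_signedAdjacency _ _)]
    exact Finset.sum_nonneg fun _ _ => (even_two_mul p).pow_nonneg _
  have hτp : 0 < τ ^ (2 * p) := by positivity
  have h1 : (#{ω : Fin M → S × ℤˣ | τ ^ (2 * p) <
      (signedAdjacency (fun i => pos (ω i).1) (fun i => (ω i).2) ^ (2 * p)).trace} : ℝ)
      = ∑ s : Fin M → S, ∑ b : Fin M → ℤˣ, if τ ^ (2 * p) < T s b then (1 : ℝ) else 0 := by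
    rw [← Finset.sum_boole, ← Fintype.sum_prod_type']
    exact Fintype.sum_equiv (Equiv.arrowProdEquivProdArrow (Fin M) (fun _ => S) (fun _ => ℤˣ)) _ _
      fun ω => rfl
  have hbad := card_repeated_le (M := M) (S := S) c hx0.le hx
  have hgood := (sum_trace_pow_le (c := c) (p := p) hpos hx0 hx1 hx hr).trans
    (mul_le_mul_of_nonneg_left (mul_le_mul_of_nonneg_left (card_evenClosedWalks_le hr0 hp)
      (by positivity)) (by positivity))
  -- Sequences with a position repeated more than c times are discarded by counting; Markov's
  -- inequality for the trace is applied to the others.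
  rw [h1, ← Finset.sum_filter_add_sum_filter_not univ (fun s : Fin M → S => ∃ y, c < #{i | s i = y}),
    mul_add]
  refine add_le_add ?_ ?_
  · calc _ ≤ ∑ s : Fin M → S with ∃ y, c < #{i | s i = y}, ∑ b : Fin M → ℤˣ, (1 : ℝ) :=
          Finset.sum_le_sum fun s _ => Finset.sum_le_sum fun b _ => by split_ifs <;> norm_num
      _ = (#{s : Fin M → S | ∃ y, c < #{i | s i = y}} : ℝ) * 2 ^ M := by simp
      _ ≤ Fintype.card S ^ M * (M * x ^ c) * 2 ^ M :=
          mul_le_mul_of_nonneg_right hbad (by positivity)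
      _ = _ := by rw [mul_pow]; ring
  · rw [← mul_div_assoc, le_div_iff₀ hτp]
    refine le_trans ?_ hgood
    have hfil : (univ.filter fun s : Fin M → S => ¬ ∃ y, c < #{i | s i = y})
        = univ.filter fun s : Fin M → S => ∀ y, #{i | s i = y} ≤ c := by
      ext s; simp
    rw [hfil, Finset.sum_mul]
    refine Finset.sum_le_sum fun s _ => ?_
    rw [Finset.sum_mul]
    refine Finset.sum_le_sum fun b _ => ?_
    split_ifs with h
    · rw [one_mul]; exact h.le
    · rw [zero_mul]; exact hT0 s b

/-- Sparse random signed graphs of logarithmic average degree have spectral norm `o(log n)`, up to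
polynomially small probability. -/
theorem exists_card_large_trace_le (a L D : ℕ) {η : ℝ} (hη : 0 < η) :
    ∃ G : ℝ, ∀ n : ℕ, G ≤ Real.log n → ∀ (V S : Type) [Fintype V] [DecidableEq V] [Nonempty V]
      [Fintype S] [DecidableEq S] (pos : S → Sym2 V), Function.Injective pos → ∀ (M : ℕ) (x : ℝ),
      0 < x → x ^ 2 * n ≤ 1 → M ≤ x * Fintype.card S → (M : ℝ) ≤ (n : ℝ) ^ a →
      x⁻¹ ≤ (n : ℝ) ^ a → x * Fintype.card V ≤ D * Real.log n →
      ∃ p, 0 < p ∧ (#{ω : Fin M → S × ℤˣ | (η * Real.log n) ^ (2 * p) <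
      (signedAdjacency (fun i => pos (ω i).1) (fun i => (ω i).2) ^ (2 * p)).trace} : ℝ)
      ≤ (2 * Fintype.card S) ^ M * (2 * ((n : ℝ) ^ L)⁻¹) := by
  -- Then M x^c ≤ n^a (x²)^(a+L) ≤ n^(-L), since x² n ≤ 1.
  set c := 2 * (a + L) with hc
  -- All factors of the moment bound, including n^(a+L) ≤ e^((a+L)p), are absorbed into p-th powers.
  -- The resulting comparison is (B η² p/4)^p ≤ (η² p²/4)^p, which holds once B ≤ log n ≤ p.
  set B : ℝ := Real.exp 1 ^ (a + L) * (2 * (2 * (2 + D))) * c ^ 2 * 512 ^ (2 + D) * 588 * 4 / η ^ 2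
    with hB
  refine ⟨max 1 B, fun n hn V S _ _ _ _ _ pos hpos M x hx0 hxn hxS hM hxinv hxV => ?_⟩
  have hl1 : 1 ≤ Real.log n := (le_max_left _ _).trans hn
  have hlB : B ≤ Real.log n := (le_max_right _ _).trans hn
  have hn1 : (1 : ℝ) ≤ n := by
    by_contra h
    have : Real.log n ≤ 0 := Real.log_nonpos (Nat.cast_nonneg n) (not_le.1 h).le
    linarith
  have hn0 : (0 : ℝ) < n := by linarith
  set p := ⌈Real.log n⌉₊ with hp
  have hpl : Real.log n ≤ p := Nat.le_ceil _
  have hpu : (p : ℝ) ≤ 2 * Real.log n := by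
    have := Nat.ceil_lt_add_one (by linarith : 0 ≤ Real.log n)
    linarith
  have hp0' : (0 : ℝ) < p := by linarith
  have hp0 : 0 < p := by exact_mod_cast hp0'
  have hx1 : x ≤ 1 := by
    by_contra h
    have : 1 < x ^ 2 := by nlinarith
    nlinarith
  refine ⟨p, hp0, ?_⟩
  have hr : (2 * p : ℕ) + x * Fintype.card V ≤ ((2 + D) * p : ℕ) := by
    push_cast
    have : (D : ℝ) * Real.log n ≤ D * p := mul_le_mul_of_nonneg_left hpl (Nat.cast_nonneg D)
    linarith
  have hτ : 0 < η * Real.log n := by positivity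
  refine (card_large_trace_le hpos c (by positivity) hp0 hx0 hx1 hxS hr hτ).trans ?_
  refine mul_le_mul_of_nonneg_left ?_ (by positivity)
  rw [two_mul ((n : ℝ) ^ L)⁻¹]
  refine add_le_add ?_ ?_
  · rw [← one_div, le_div_iff₀ (by positivity)]
    calc (M : ℝ) * x ^ c * (n : ℝ) ^ L ≤ (n : ℝ) ^ a * x ^ c * (n : ℝ) ^ L := by gcongr
      _ = (x ^ 2 * n) ^ (a + L) := by rw [mul_pow, ← pow_mul, ← hc, pow_add (n : ℝ)]; ring
      _ ≤ 1 := pow_le_one₀ (by positivity) hxn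
  · have hnexp : (n : ℝ) ^ (a + L) ≤ (Real.exp 1 ^ (a + L)) ^ p := by
      rw [← pow_mul, mul_comm, pow_mul]
      refine pow_le_pow_left₀ hn0.le ?_ _
      rw [Real.exp_one_pow, ← Real.log_le_iff_le_exp hn0]
      exact hpl
    have hlin : 2 * (((2 + D) * p : ℕ) : ℝ) ≤ (2 * (2 * (2 + D))) ^ p := by
      rw [mul_pow]
      have h1 : (p : ℝ) ≤ 2 ^ p := by exact_mod_cast (Nat.lt_two_pow_self).le
      have h2 : (2 * (2 + D) : ℝ) ≤ (2 * (2 + D)) ^ p :=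
        le_self_pow₀ (by linarith [(Nat.cast_nonneg D : (0 : ℝ) ≤ D)]) hp0.ne'
      push_cast
      calc 2 * ((2 + D : ℝ) * p) = p * (2 * (2 + D)) := by ring
        _ ≤ _ := mul_le_mul h1 h2 (by positivity) (by positivity)
    have hden : (η ^ 2 * p ^ 2 / 4) ^ p ≤ (η * Real.log n) ^ (2 * p) := by
      rw [pow_mul]
      refine pow_le_pow_left₀ (by positivity) ?_ p
      rw [mul_pow]
      have : (p : ℝ) ^ 2 ≤ (2 * Real.log n) ^ 2 := pow_le_pow_left₀ hp0'.le hpu 2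
      nlinarith [sq_nonneg η]
    rw [div_le_iff₀ (by positivity), inv_mul_eq_div, le_div_iff₀ (by positivity)]
    calc (c : ℝ) ^ (2 * p) * x⁻¹ * (2 * (((2 + D) * p : ℕ) : ℝ) * 512 ^ ((2 + D) * p) *
          (588 * p) ^ p) * (n : ℝ) ^ L
        ≤ (c : ℝ) ^ (2 * p) * (n : ℝ) ^ a * ((2 * (2 * (2 + D))) ^ p * 512 ^ ((2 + D) * p) *
          (588 * p) ^ p) * (n : ℝ) ^ L := by gcongr
      _ = (n : ℝ) ^ (a + L) * ((c ^ 2 * (2 * (2 * (2 + D))) * 512 ^ (2 + D) * (588 * p)) ^ p) := by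
          rw [mul_pow _ (588 * (p : ℝ)), mul_pow _ ((512 : ℝ) ^ (2 + D)), mul_pow ((c : ℝ) ^ 2),
            pow_mul (c : ℝ), pow_mul (512 : ℝ), pow_add (n : ℝ)]
          ring
      _ ≤ (Real.exp 1 ^ (a + L)) ^ p *
          ((c ^ 2 * (2 * (2 * (2 + D))) * 512 ^ (2 + D) * (588 * p)) ^ p) := by gcongr
      _ = (B * (η ^ 2 * p / 4)) ^ p := by
          rw [← mul_pow]
          congr 1
          rw [hB]; field_simp
      _ ≤ (η ^ 2 * p ^ 2 / 4) ^ p := by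
          refine pow_le_pow_left₀ (by positivity) ?_ p
          have : B ≤ p := hlB.trans hpl
          have h2 : 0 ≤ η ^ 2 * p / 4 := by positivity
          calc B * (η ^ 2 * p / 4) ≤ p * (η ^ 2 * p / 4) := by gcongr
            _ = _ := by ring
      _ ≤ _ := hden

end SparseSignedGraphs

/-! ### Matrix Chernoff bound for random matchings by comparison with a scalar sum -/

section RandomMatchings

open Finset

/-- The product `f 0 * f 1 * ⋯ * f (q - 1)` in this order. -/
def orderedProd {R : Type*} [Monoid R] : (q : ℕ) → (Fin q → R) → R
  | 0, _ => 1
  | q + 1, f => orderedProd q (fun t => f t.castSucc) * f (Fin.last q)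

theorem sum_pow_eq_sum_orderedProd {R J : Type*} [Semiring R] [Fintype J] (B : J → R) (q : ℕ) :
    (∑ j, B j) ^ q = ∑ i : Fin q → J, orderedProd q (fun t => B (i t)) := by
  classical
  induction q with
  | zero => simp [orderedProd]
  | succ q ih =>
    rw [pow_succ, ih, ← (Fin.snocEquiv (fun _ : Fin (q + 1) => J)).sum_comp,
      Fintype.sum_prod_type, Finset.sum_comm, Finset.sum_mul]
    refine Finset.sum_congr rfl fun i _ => ?_
    rw [Finset.mul_sum]
    refine Finset.sum_congr rfl fun j _ => ?_
    simp [orderedProd, Fin.snocEquiv]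

theorem orderedProd_smul {R : Type*} [Semiring R] [Algebra ℝ R] (q : ℕ) (a : Fin q → ℝ)
    (f : Fin q → R) :
    orderedProd q (fun t => a t • f t) = (∏ t, a t) • orderedProd q f := by
  induction q with
  | zero => simp [orderedProd]
  | succ q ih => simp only [orderedProd, ih, Fin.prod_univ_castSucc, smul_mul_smul_comm]

/-- Independence of coordinate j from a function that ignores it: exchanging s_j with an independent
sample y is an involution of the pairs (s, y). -/
theorem card_mul_sum_mul_eq_of_update {M : ℕ} {S : Type*} [Fintype S] (j : Fin M)
    (f : (Fin M → S) → ℝ) (hf : ∀ s y, f (Function.update s j y) = f s) (g : S → ℝ) :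
    Fintype.card S * ∑ s, f s * g (s j) = (∑ s, f s) * ∑ y, g y := by
  have h1 : Fintype.card S * ∑ s, f s * g (s j)
      = ∑ x : (Fin M → S) × S, f x.1 * g (x.1 j) := by
    rw [Fintype.sum_prod_type]
    simp only [Finset.sum_const, Finset.card_univ, nsmul_eq_mul]
    rw [Finset.mul_sum]
  rw [h1, Finset.sum_mul_sum, ← Fintype.sum_prod_type']
  refine Fintype.sum_equiv ⟨fun x => (Function.update x.1 j x.2, x.1 j),
    fun x => (Function.update x.1 j x.2, x.1 j), fun x => by simp, fun x => by simp⟩ _ _ ?_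
  intro x
  simp [hf]

theorem orderedProd_update {M : ℕ} {S R : Type*} [Monoid R] (K : S → R) (q : ℕ)
    (i : Fin q → Fin M) (j : Fin M) (hj : ∀ t, i t ≠ j) (s : Fin M → S) (y : S) :
    orderedProd q (fun t => K (Function.update s j y (i t))) =
      orderedProd q (fun t => K (s (i t))) := by
  simp only [Function.update_of_ne (hj _)]

/-- A family of (partial) matchings in which every vertex is matched equally often. -/
structure IsRegularMatchingFamily {V S : Type*} [Fintype V] [Fintype S]
    (K : S → Matrix V V ℝ) (D : ℝ) : Prop where
  nonneg : ∀ y T U, 0 ≤ K y T U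
  sq_rowSum : ∀ y T, (∑ U, K y T U) ^ 2 = ∑ U, K y T U
  sum_rowSum : ∀ T, ∑ y, ∑ U, K y T U = D
  isHermitian : ∀ y, (K y).IsHermitian

theorem IsRegularMatchingFamily.rowSum_le_one
    {V S : Type*} [Fintype V] [Fintype S] {K : S → Matrix V V ℝ} {D : ℝ}
    (hK : IsRegularMatchingFamily K D) (y : S) (T : V) :
    ∑ U, K y T U ≤ 1 := by
  nlinarith [hK.sq_rowSum y T, sq_nonneg ((∑ U, K y T U) - 1)]

theorem IsRegularMatchingFamily.rowSum_nonneg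
    {V S : Type*} [Fintype V] [Fintype S] {K : S → Matrix V V ℝ} {D : ℝ}
    (hK : IsRegularMatchingFamily K D) (y : S) (T : V) :
    0 ≤ ∑ U, K y T U := Finset.sum_nonneg fun U _ => hK.nonneg y T U

theorem IsRegularMatchingFamily.orderedProd_nonneg
    {V S : Type*} [Fintype V] [DecidableEq V] [Fintype S] {K : S → Matrix V V ℝ} {D : ℝ}
    (hK : IsRegularMatchingFamily K D) (q : ℕ)
    (y : Fin q → S) (T U : V) : 0 ≤ orderedProd q (fun t => K (y t)) T U := by
  induction q generalizing U with
  | zero => simp only [orderedProd, Matrix.one_apply]; positivity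
  | succ q ih =>
    simp only [orderedProd, Matrix.mul_apply]
    exact Finset.sum_nonneg fun W _ => mul_nonneg (ih _ _) (hK.nonneg _ _ _)

theorem sum_orderedProd_succ
    {V S : Type*} [Fintype V] [DecidableEq V]
    (K : S → Matrix V V ℝ) (q : ℕ) (y : Fin (q + 1) → S) (T : V) :
    ∑ U, orderedProd (q + 1) (fun t => K (y t)) T U =
      ∑ W, orderedProd q (fun t => K (y t.castSucc)) T W * ∑ U, K (y (Fin.last q)) W U := by
  simp only [orderedProd, Matrix.mul_apply]
  rw [Finset.sum_comm]
  simp only [Finset.mul_sum]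

/-- A walk along random matchings survives at most as often as independent choices would. -/
theorem IsRegularMatchingFamily.sum_orderedProd_le
    {V S : Type*} [Fintype V] [DecidableEq V] [Fintype S] {K : S → Matrix V V ℝ} {D : ℝ}
    (hK : IsRegularMatchingFamily K D) {M : ℕ}
    (q : ℕ) (i : Fin q → Fin M) (T : V) :
    ∑ s : Fin M → S, ∑ U, orderedProd q (fun t => K (s (i t))) T U ≤
      ∑ s : Fin M → S, ∏ t, ∑ U, K (s (i t)) T U := by
  induction q with
  | zero => simp [orderedProd, Matrix.one_apply]
  | succ q ih =>
    have ih' := ih fun t => i t.castSucc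
    simp only [Fin.prod_univ_castSucc]
    -- If the last scope occurred before, its row sum, being idempotent, changes nothing on the
    -- right, while on the left it is a factor at most 1. If it is fresh, averaging over it gives
    -- D/|S| on both sides, whatever vertex the walk has reached.
    by_cases hj : ∃ t : Fin q, i t.castSucc = i (Fin.last q)
    · obtain ⟨t₀, ht₀⟩ := hj
      have h1 : ∀ s : Fin M → S, (∏ t : Fin q, ∑ U, K (s (i t.castSucc)) T U) *
          ∑ U, K (s (i (Fin.last q))) T U = ∏ t : Fin q, ∑ U, K (s (i t.castSucc)) T U := by
        intro s
        rw [← Finset.mul_prod_erase _ _ (mem_univ t₀), ht₀, mul_right_comm, ← sq, hK.sq_rowSum]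
      simp_rw [h1]
      refine le_trans (Finset.sum_le_sum fun s _ => ?_) ih'
      rw [sum_orderedProd_succ K q (fun t => s (i t)) T]
      exact Finset.sum_le_sum fun W _ => mul_le_of_le_one_right
        (hK.orderedProd_nonneg q (fun t => s (i t.castSucc)) T W) (hK.rowSum_le_one _ _)
    · push Not at hj
      rcases isEmpty_or_nonempty S with hS | hS
      · have : IsEmpty (Fin M → S) := ⟨fun s => hS.elim (s (i (Fin.last q)))⟩
        simp
      have hc : (0 : ℝ) < Fintype.card S := by exact_mod_cast Fintype.card_pos
      rw [← mul_le_mul_iff_right₀ hc]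
      have hD : 0 ≤ D := by
        rw [← hK.sum_rowSum T]
        exact Finset.sum_nonneg fun y _ => hK.rowSum_nonneg y T
      have hL : Fintype.card S * ∑ s : Fin M → S, ∑ U, orderedProd (q + 1) (fun t => K (s (i t))) T U
          = (∑ s : Fin M → S, ∑ U, orderedProd q (fun t => K (s (i t.castSucc))) T U) * D := by
        simp_rw [fun s : Fin M → S => sum_orderedProd_succ K q (fun t => s (i t)) T]
        rw [Finset.sum_comm, Finset.mul_sum, Finset.sum_comm (s := univ (α := Fin M → S)),
          Finset.sum_mul]
        refine Finset.sum_congr rfl fun W _ => ?_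
        rw [card_mul_sum_mul_eq_of_update (i (Fin.last q))
          (fun s => orderedProd q (fun t => K (s (i t.castSucc))) T W)
          (fun s y => by rw [orderedProd_update K q _ _ hj]) (fun y => ∑ U, K y W U),
          hK.sum_rowSum]
      have hR : Fintype.card S * ∑ s : Fin M → S, (∏ t : Fin q, ∑ U, K (s (i t.castSucc)) T U) *
          ∑ U, K (s (i (Fin.last q))) T U
          = (∑ s : Fin M → S, ∏ t : Fin q, ∑ U, K (s (i t.castSucc)) T U) * D := by
        rw [card_mul_sum_mul_eq_of_update (i (Fin.last q))
          (fun s => ∏ t : Fin q, ∑ U, K (s (i t.castSucc)) T U)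
          (fun s y => by simp only [Function.update_of_ne (hj _)]) (fun y => ∑ U, K y T U),
          hK.sum_rowSum]
      rw [hL, hR]
      exact mul_le_mul_of_nonneg_right ih' hD

/-- The product is a character of the group of sign vectors. It is identically 1, or it takes the
value -1 and sums to zero. -/
theorem sum_prod_signs_nonneg {M q : ℕ} (i : Fin q → Fin M) :
    0 ≤ ∑ b : Fin M → ℤˣ, ∏ t, (((b (i t) : ℤˣ) : ℤ) : ℝ) := by
  have hcast : ∀ b : Fin M → ℤˣ, ∏ t, (((b (i t) : ℤˣ) : ℤ) : ℝ)
      = (((∏ t, b (i t) : ℤˣ) : ℤ) : ℝ) := fun b => by push_cast; rfl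
  by_cases h : ∃ c : Fin M → ℤˣ, ∏ t, c (i t) = -1
  · obtain ⟨c, hc⟩ := h
    have h1 : ∑ b : Fin M → ℤˣ, ∏ t, (((b (i t) : ℤˣ) : ℤ) : ℝ)
        = - ∑ b : Fin M → ℤˣ, ∏ t, (((b (i t) : ℤˣ) : ℤ) : ℝ) := by
      refine (Fintype.sum_equiv (Equiv.mulLeft c)
        (fun b : Fin M → ℤˣ => ∏ t, ((((c * b) (i t) : ℤˣ) : ℤ) : ℝ)) _ (fun b => rfl)).symm.trans ?_
      rw [← Finset.sum_neg_distrib]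
      refine Finset.sum_congr rfl fun b _ => ?_
      rw [hcast, hcast]
      simp only [Pi.mul_apply, Finset.prod_mul_distrib, hc]
      simp
    linarith
  · push Not at h
    refine Finset.sum_nonneg fun b _ => ?_
    rw [hcast, (Int.units_eq_one_or _).resolve_right (h b)]
    simp

/-- The signed sum of the matchings selected by `ω`. -/
noncomputable def signedSum
    {V S : Type*}
    {M : ℕ} (K : S → Matrix V V ℝ) (ω : Fin M → S × ℤˣ) : Matrix V V ℝ :=
  ∑ j, ((((ω j).2 : ℤˣ) : ℤ) : ℝ) • K (ω j).1

theorem IsRegularMatchingFamily.isHermitian_signedSum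
    {V S : Type*} [Fintype V] [Fintype S] {K : S → Matrix V V ℝ} {D : ℝ}
    (hK : IsRegularMatchingFamily K D) {M : ℕ}
    (ω : Fin M → S × ℤˣ) : (signedSum K ω).IsHermitian := by
  have : ∀ j, (K (ω j).1).transpose = K (ω j).1 := fun j => hK.isHermitian _
  rw [signedSum, Matrix.IsHermitian, Matrix.conjTranspose_eq_transpose_of_trivial,
    Matrix.transpose_sum]
  simp [Matrix.transpose_smul, this]

/-- The trace moments of a signed sum of random matchings are dominated by the moments of a scalar
random walk. -/
theorem IsRegularMatchingFamily.sum_trace_pow_le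
    {V S : Type*} [Fintype V] [DecidableEq V] [Fintype S] {K : S → Matrix V V ℝ} {D : ℝ}
    (hK : IsRegularMatchingFamily K D) (M q : ℕ) :
    ∑ ω : Fin M → S × ℤˣ, (signedSum K ω ^ q).trace ≤
      ∑ T, ∑ ω : Fin M → S × ℤˣ, (∑ j, ((((ω j).2 : ℤˣ) : ℤ) : ℝ) * ∑ U, K (ω j).1 T U) ^ q := by
  have hsplit : ∀ F : (Fin M → S) → (Fin M → ℤˣ) → ℝ,
      ∑ ω : Fin M → S × ℤˣ, F (fun j => (ω j).1) (fun j => (ω j).2) = ∑ s, ∑ b, F s b := by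
    intro F
    rw [← Fintype.sum_prod_type']
    exact Fintype.sum_equiv (Equiv.arrowProdEquivProdArrow (Fin M) (fun _ => S) (fun _ => ℤˣ)) _ _
      fun ω => rfl
  have hL : ∀ ω : Fin M → S × ℤˣ, (signedSum K ω ^ q).trace = ∑ i : Fin q → Fin M,
      (∏ t, ((((ω (i t)).2 : ℤˣ) : ℤ) : ℝ)) *
        (orderedProd q (fun t => K (ω (i t)).1)).trace := by
    intro ω
    rw [signedSum, sum_pow_eq_sum_orderedProd, Matrix.trace_sum]
    refine Finset.sum_congr rfl fun i _ => ?_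
    rw [orderedProd_smul q (fun t => ((((ω (i t)).2 : ℤˣ) : ℤ) : ℝ)) (fun t => K (ω (i t)).1),
      Matrix.trace_smul, smul_eq_mul]
  have hR : ∀ (T : V) (ω : Fin M → S × ℤˣ),
      (∑ j, ((((ω j).2 : ℤˣ) : ℤ) : ℝ) * ∑ U, K (ω j).1 T U) ^ q = ∑ i : Fin q → Fin M,
      (∏ t, ((((ω (i t)).2 : ℤˣ) : ℤ) : ℝ)) * ∏ t, ∑ U, K (ω (i t)).1 T U := by
    intro T ω
    rw [Finset.sum_pow', Fintype.piFinset_univ]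
    exact Finset.sum_congr rfl fun i _ => Finset.prod_mul_distrib
  simp_rw [hL, hR]
  rw [Finset.sum_comm]
  simp_rw [fun T : V => Finset.sum_comm (s := univ (α := Fin M → S × ℤˣ))
    (t := univ (α := Fin q → Fin M)) (f := fun ω i => (∏ t, ((((ω (i t)).2 : ℤˣ) : ℤ) : ℝ)) *
      ∏ t, ∑ U, K (ω (i t)).1 T U)]
  rw [Finset.sum_comm (s := univ (α := V))]
  refine Finset.sum_le_sum fun i _ => ?_
  rw [hsplit fun s b => (∏ t, (((b (i t) : ℤˣ) : ℤ) : ℝ)) *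
    (orderedProd q (fun t => K (s (i t)))).trace]
  simp_rw [fun T : V => hsplit fun s b => (∏ t, (((b (i t) : ℤˣ) : ℤ) : ℝ)) *
    ∏ t, ∑ U, K (s (i t)) T U]
  simp_rw [← Finset.sum_mul, ← Finset.mul_sum]
  -- Signs and scopes have separated and the sign average is nonnegative, so only products of
  -- matchings remain to be compared. A diagonal entry is then bounded by its row sum.
  refine mul_le_mul_of_nonneg_left ?_ (sum_prod_signs_nonneg i)
  simp only [Matrix.trace, Matrix.diag_apply]
  rw [Finset.sum_comm]
  refine Finset.sum_le_sum fun T _ => le_trans (Finset.sum_le_sum fun s _ => ?_)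
    (hK.sum_orderedProd_le q i T)
  exact Finset.single_le_sum
    (f := fun U => orderedProd q (fun t => K (s (i t))) T U)
    (fun U _ => hK.orderedProd_nonneg q (fun t => s (i t)) T U) (mem_univ T)

/-- The row sums are 0 or 1, so a single signed constraint contributes 1 or cosh θ on average over
its sign; the constraints are independent. -/
theorem IsRegularMatchingFamily.sum_exp_rowSum
    {V S : Type*} [Fintype V] [DecidableEq V] [Fintype S] {K : S → Matrix V V ℝ} {D : ℝ}
    (hK : IsRegularMatchingFamily K D) (M : ℕ) (θ : ℝ)
    (T : V) :
    ∑ ω : Fin M → S × ℤˣ, Real.exp (θ * ∑ j, ((((ω j).2 : ℤˣ) : ℤ) : ℝ) * ∑ U, K (ω j).1 T U)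
      = (2 * (Fintype.card S + D * (Real.cosh θ - 1))) ^ M := by
  have h1 : ∀ ω : Fin M → S × ℤˣ,
      Real.exp (θ * ∑ j, ((((ω j).2 : ℤˣ) : ℤ) : ℝ) * ∑ U, K (ω j).1 T U)
      = ∏ j, Real.exp (θ * (((((ω j).2 : ℤˣ) : ℤ) : ℝ) * ∑ U, K (ω j).1 T U)) := by
    intro ω
    rw [Finset.mul_sum, Real.exp_sum]
  have h2 : ∑ y : S × ℤˣ, Real.exp (θ * ((((y.2 : ℤˣ) : ℤ) : ℝ) * ∑ U, K y.1 T U))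
      = 2 * (Fintype.card S + D * (Real.cosh θ - 1)) := by
    rw [Fintype.sum_prod_type]
    have h3 : ∀ y : S, ∑ b : ℤˣ, Real.exp (θ * (((b : ℤ) : ℝ) * ∑ U, K y T U))
        = 2 * (1 + (∑ U, K y T U) * (Real.cosh θ - 1)) := by
      intro y
      rw [show (univ : Finset ℤˣ) = {1, -1} from rfl, Finset.sum_pair (by decide)]
      have h01 : ∑ U, K y T U = 0 ∨ ∑ U, K y T U = 1 := by
        have h : (∑ U, K y T U) * (∑ U, K y T U - 1) = 0 := by
          linear_combination hK.sq_rowSum y T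
        exact (mul_eq_zero.1 h).imp_right sub_eq_zero.1
      rcases h01 with h | h <;> rw [h]
      · simp; norm_num
      · rw [Real.cosh_eq]; simp; ring
    simp_rw [h3]
    rw [← Finset.mul_sum, Finset.sum_add_distrib, ← Finset.sum_mul, hK.sum_rowSum]
    simp
  simp_rw [h1]
  have h4 := Finset.prod_univ_sum (fun _ : Fin M => (univ : Finset (S × ℤˣ)))
    (fun _ y => Real.exp (θ * ((((y.2 : ℤˣ) : ℤ) : ℝ) * ∑ U, K y.1 T U)))
  rw [Fintype.piFinset_univ, h2, Finset.prod_const, Finset.card_univ, Fintype.card_fin] at h4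
  exact h4.symm

/-- Matrix Chernoff bound for signed sums of random matchings. -/
theorem IsRegularMatchingFamily.sum_exp_lambdaMax_le
    {V S : Type*} [Fintype V] [DecidableEq V] [Fintype S] {K : S → Matrix V V ℝ} {D : ℝ}
    [Nonempty V]
    (hK : IsRegularMatchingFamily K D) (M : ℕ) (θ : ℝ) (hθ : 0 ≤ θ) :
    ∑ ω : Fin M → S × ℤˣ, Real.exp (θ * lambdaMax (signedSum K ω)) ≤
      Fintype.card V * (2 * (Fintype.card S + D * (Real.cosh θ - 1))) ^ M := by
  refine (Finset.sum_le_sum fun ω _ => exp_mul_lambdaMax_le (hK.isHermitian_signedSum ω) θ).trans ?_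
  -- Both exponential moments are expanded in powers of θ ≥ 0 and compared term by term.
  have hL := hasSum_sum fun (ω : Fin M → S × ℤˣ) (_ : ω ∈ univ) =>
    hasSum_trace_exp (hK.isHermitian_signedSum ω) θ
  have hR := hasSum_sum fun (T : V) (_ : T ∈ univ) =>
    hasSum_sum fun (ω : Fin M → S × ℤˣ) (_ : ω ∈ univ) =>
    NormedSpace.expSeries_div_hasSum_exp
      (θ * ∑ j, ((((ω j).2 : ℤˣ) : ℤ) : ℝ) * ∑ U, K (ω j).1 T U)
  have hle := hasSum_le (fun q => ?_) hL hR
  · refine hle.trans (le_of_eq ?_)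
    rw [← Real.exp_eq_exp_ℝ]
    simp_rw [hK.sum_exp_rowSum]
    simp
  · rw [← Finset.mul_sum]
    have h := mul_le_mul_of_nonneg_left (hK.sum_trace_pow_le M q)
      (by positivity : 0 ≤ θ ^ q / q.factorial)
    refine h.trans (le_of_eq ?_)
    rw [Finset.mul_sum]
    refine Finset.sum_congr rfl fun T _ => ?_
    rw [Finset.mul_sum]
    exact Finset.sum_congr rfl fun ω _ => by rw [mul_pow]; ring

end RandomMatchings

/-! ### The Kikuchi matchings form a regular family -/

section KikuchiFamily

open Finset

theorem rowSum_kikuchiMatching {n k ℓ : ℕ} (S : KSubset n k) (T : KSubset n ℓ) :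
    ∑ U, kikuchiMatching ℓ S T U = if #(T.1 ∆ S.1) = ℓ then 1 else 0 := by
  have h : ∀ U : KSubset n ℓ, T.1 ∆ U.1 = S.1 ↔ U.1 = T.1 ∆ S.1 := fun U => by
    constructor
    · intro h; rw [← h, symmDiff_symmDiff_cancel_left]
    · intro h; rw [h, symmDiff_symmDiff_cancel_left]
  simp only [kikuchiMatching, Matrix.of_apply, h]
  split_ifs with hc
  · rw [Finset.sum_eq_single (⟨T.1 ∆ S.1, hc⟩ : KSubset n ℓ)]
    · simp
    · intro U _ hU
      exact if_neg fun h => hU (Subtype.ext h)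
    · simp
  · exact Finset.sum_eq_zero fun U _ => if_neg fun h => hc (by rw [← h]; exact U.2)

theorem card_symmDiff_eq_iff {α : Type*} [DecidableEq α] {T S : Finset α} {ℓ h : ℕ}
    (hT : #T = ℓ) (hS : #S = 2 * h) : #(T ∆ S) = ℓ ↔ #(S ∩ T) = h := by
  have h1 : #(T ∆ S) = #(T \ S) + #(S \ T) := by
    rw [symmDiff_def]
    exact Finset.card_union_of_disjoint disjoint_sdiff_sdiff
  have h2 := Finset.card_sdiff_add_card_inter T S
  have h3 := Finset.card_sdiff_add_card_inter S T
  rw [Finset.inter_comm] at h2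
  omega

/-- A scope S matches T exactly when half of it lies inside T, so it is an h-subset of T together
with an h-subset of the complement. -/
theorem card_balanced_scopes {n ℓ h : ℕ} (T : KSubset n ℓ) :
    #{S : KSubset n (2 * h) | #(T.1 ∆ S.1) = ℓ} = ℓ.choose h * (n - ℓ).choose h := by
  have hT := T.2
  have hTc : #(T.1ᶜ) = n - ℓ := by rw [Finset.card_compl, Fintype.card_fin, hT]
  have hprod : ℓ.choose h * (n - ℓ).choose h = #(T.1.powersetCard h ×ˢ T.1ᶜ.powersetCard h) := by
    rw [Finset.card_product, Finset.card_powersetCard, Finset.card_powersetCard, hT, hTc]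
  rw [hprod]
  refine Finset.card_bij (fun S _ => (S.1 ∩ T.1, S.1 \ T.1)) ?_ ?_ ?_
  · intro S hS
    have h1 := (card_symmDiff_eq_iff T.2 S.2).1 (Finset.mem_filter.1 hS).2
    have h2 := Finset.card_sdiff_add_card_inter S.1 T.1
    have h3 := S.2
    simp only [mem_product, mem_powersetCard]
    refine ⟨⟨Finset.inter_subset_right, h1⟩, fun x hx => ?_, by omega⟩
    exact Finset.mem_compl.2 (Finset.mem_sdiff.1 hx).2
  · intro S _ S' _ hSS
    rw [Prod.mk.injEq] at hSS
    refine Subtype.ext ?_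
    rw [← Finset.sdiff_union_inter S.1 T.1, ← Finset.sdiff_union_inter S'.1 T.1, hSS.1, hSS.2]
  · rintro ⟨P, Q⟩ hPQ
    simp only [mem_product, mem_powersetCard] at hPQ
    obtain ⟨⟨hP, hPc⟩, hQ, hQc⟩ := hPQ
    have hd : Disjoint Q T.1 := Finset.disjoint_left.2 fun x hx => Finset.mem_compl.1 (hQ hx)
    have hdPQ : Disjoint P Q := Finset.disjoint_left.2 fun x hx hxQ =>
      Finset.mem_compl.1 (hQ hxQ) (hP hx)
    have hi : (P ∪ Q) ∩ T.1 = P := by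
      rw [Finset.union_inter_distrib_right, Finset.inter_eq_left.2 hP,
        Finset.disjoint_iff_inter_eq_empty.1 hd, Finset.union_empty]
    have hs : (P ∪ Q) \ T.1 = Q := by
      rw [Finset.union_sdiff_distrib, Finset.sdiff_eq_empty_iff_subset.2 hP, Finset.empty_union,
        Finset.sdiff_eq_self_of_disjoint hd]
    have hc : #(P ∪ Q) = 2 * h := by rw [Finset.card_union_of_disjoint hdPQ, hPc, hQc]; ring
    refine ⟨⟨P ∪ Q, hc⟩, ?_, by simp only [hi, hs]⟩
    refine Finset.mem_filter.2 ⟨mem_univ _, (card_symmDiff_eq_iff T.2 hc).2 ?_⟩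
    simp only [hi, hPc]

theorem isRegularMatchingFamily_kikuchi (n ℓ h : ℕ) :
    IsRegularMatchingFamily (fun S : KSubset n (2 * h) => kikuchiMatching ℓ S)
      (ℓ.choose h * (n - ℓ).choose h : ℝ) where
  nonneg S T U := by
    simp only [kikuchiMatching, Matrix.of_apply]; positivity
  sq_rowSum S T := by
    rw [rowSum_kikuchiMatching]; split_ifs <;> norm_num
  sum_rowSum T := by
    simp_rw [rowSum_kikuchiMatching]
    rw [Finset.sum_boole, card_balanced_scopes]; push_cast; rfl
  isHermitian S := by
    ext T U
    simp [kikuchiMatching, symmDiff_comm]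

/-- Both sides count pairs of a 2h-set and an ℓ-set meeting in h elements. -/
theorem choose_mul_choose_balanced {n ℓ h : ℕ} (hℓ : h ≤ ℓ) (hn : ℓ + h ≤ n) :
    (2 * h).choose h * (n - 2 * h).choose (ℓ - h) * n.choose (2 * h)
      = ℓ.choose h * (n - ℓ).choose h * n.choose ℓ := by
  obtain ⟨c, rfl⟩ := Nat.exists_eq_add_of_le hℓ
  obtain ⟨d, rfl⟩ := Nat.exists_eq_add_of_le hn
  have e1 : h + c + h + d - 2 * h = c + d := by omega
  have e2 : h + c - h = c := by omega
  have e3 : h + c + h + d - (h + c) = h + d := by omega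
  rw [e1, e2, e3]
  have f : ∀ a b : ℕ, (a + b).choose a * a.factorial * b.factorial = (a + b).factorial :=
    fun a b => by
      have := Nat.choose_mul_factorial_mul_factorial (Nat.le_add_right a b)
      rwa [Nat.add_sub_cancel_left] at this
  have f1 := f h h
  have f2 := f c d
  have f3 := f (2 * h) (c + d)
  have f4 := f h c
  have f5 := f h d
  have f6 := f (h + c) (h + d)
  rw [show 2 * h + (c + d) = h + c + h + d by ring] at f3
  rw [show h + c + (h + d) = h + c + h + d by ring] at f6
  rw [← two_mul] at f1
  have hpos : 0 < h.factorial * h.factorial * c.factorial * d.factorial := by positivity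
  refine Nat.eq_of_mul_eq_mul_right hpos ?_
  calc (2 * h).choose h * (c + d).choose c * (h + c + h + d).choose (2 * h) *
        (h.factorial * h.factorial * c.factorial * d.factorial)
      = (h + c + h + d).choose (2 * h) * ((2 * h).choose h * h.factorial * h.factorial) *
        ((c + d).choose c * c.factorial * d.factorial) := by ring
    _ = (h + c + h + d).choose (h + c) * ((h + c).choose h * h.factorial * c.factorial) *
        ((h + d).choose h * h.factorial * d.factorial) := by rw [f1, f2, f3, f4, f5, f6]
    _ = _ := by ring

/-- The density of the Kikuchi matchings in terms of the number of scopes meeting an `ℓ`-set in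
exactly half of their elements. -/
theorem kikuchiDelta_mul_choose {n ℓ h : ℕ} (hℓ : h ≤ ℓ) (hn : ℓ + h ≤ n) :
    kikuchiDelta ℓ n (2 * h) * n.choose (2 * h) = ℓ.choose h * (n - ℓ).choose h := by
  have hc : (n.choose ℓ : ℝ) ≠ 0 := by
    exact_mod_cast (Nat.choose_pos (by omega : ℓ ≤ n)).ne'
  rw [kikuchiDelta, show 2 * h / 2 = h by omega, div_mul_eq_mul_div, div_eq_iff hc]
  exact_mod_cast choose_mul_choose_balanced hℓ hn

theorem kikuchiMatrix_eq_signedSum {n k : ℕ} (ℓ M : ℕ) (ω : Fin M → XORConstraint n k) :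
    kikuchiMatrix ℓ ⟨M, ω⟩ = signedSum (fun S : KSubset n k => kikuchiMatching ℓ S) ω := rfl

end KikuchiFamily

/-! ### The fixed-size and Poissonized laws as counting measures and mixtures -/

section Laws

open Finset

theorem card_KSubset (n k : ℕ) : Fintype.card (KSubset n k) = n.choose k := by
  rw [Fintype.card_finset_len, Fintype.card_fin]

theorem measurableSet_XORInstance {n k : ℕ} (A : Set (XORInstance n k)) : MeasurableSet A := by
  refine MeasurableSpace.measurableSet_iInf.2 fun M => ?_
  exact (Set.toFinite ((fun ω : Fin M → XORConstraint n k => (⟨M, ω⟩ : XORInstance n k)) ⁻¹' A)).measurableSet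

theorem constraintLaw_singleton {n k : ℕ} (hkn : k ≤ n) (y : XORConstraint n k) :
    constraintLaw n k {y} = ENNReal.ofReal ((2 * n.choose k : ℝ)⁻¹) := by
  have hne : Nonempty (KSubset n k) := by
    rw [← Fintype.card_pos_iff, card_KSubset]; exact Nat.choose_pos hkn
  have h1 := isProbabilityMeasure_uniformOn (Set.finite_univ (α := KSubset n k)) Set.univ_nonempty
  have h2 := isProbabilityMeasure_uniformOn (Set.finite_univ (α := ℤˣ)) Set.univ_nonempty
  have hpos : (0 : ℝ) < n.choose k := by exact_mod_cast Nat.choose_pos hkn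
  rw [constraintLaw, ← Set.singleton_prod_singleton, Measure.prod_prod, uniformOn_univ,
    uniformOn_univ, Measure.count_singleton, Measure.count_singleton, card_KSubset, Fintype.card_units_int,
    mul_inv, ENNReal.ofReal_mul (by positivity), ENNReal.ofReal_inv_of_pos (by positivity),
    ENNReal.ofReal_inv_of_pos hpos, mul_comm]
  simp

theorem isProbabilityMeasure_constraintLaw {n k : ℕ} (hkn : k ≤ n) :
    IsProbabilityMeasure (constraintLaw n k) := by
  have hne : Nonempty (KSubset n k) := by
    rw [← Fintype.card_pos_iff, card_KSubset]; exact Nat.choose_pos hkn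
  have h1 := isProbabilityMeasure_uniformOn (Set.finite_univ (α := KSubset n k)) Set.univ_nonempty
  have h2 := isProbabilityMeasure_uniformOn (Set.finite_univ (α := ℤˣ)) Set.univ_nonempty
  rw [constraintLaw]
  infer_instance

open Classical in
/-- Events of `R_{n,k}(M)` are measured by counting. -/
theorem randomXOR_apply {n k : ℕ} (hkn : k ≤ n) (M : ℕ) (A : Set (XORInstance n k)) :
    randomXOR n k M A = ENNReal.ofReal
      (#{ω : Fin M → XORConstraint n k | (⟨M, ω⟩ : XORInstance n k) ∈ A} / (2 * n.choose k) ^ M) := by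
  have hP := isProbabilityMeasure_constraintLaw hkn
  rw [randomXOR, Measure.map_apply ?_ (measurableSet_XORInstance A)]
  · change Measure.pi (fun _ : Fin M => constraintLaw n k)
      ((fun ω : Fin M → XORConstraint n k => (⟨M, ω⟩ : XORInstance n k)) ⁻¹' A) = _
    have hset : ((fun ω : Fin M → XORConstraint n k => (⟨M, ω⟩ : XORInstance n k)) ⁻¹' A) =
        ((univ.filter fun ω : Fin M → XORConstraint n k => (⟨M, ω⟩ : XORInstance n k) ∈ A :
          Finset (Fin M → XORConstraint n k)) : Set (Fin M → XORConstraint n k)) := by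
      ext ω; simp
    rw [hset, ← sum_measure_singleton]
    simp_rw [Measure.pi_singleton, constraintLaw_singleton hkn]
    rw [Finset.sum_const, Finset.prod_const, Finset.card_univ, Fintype.card_fin,
      ← ENNReal.ofReal_pow (by positivity), nsmul_eq_mul, ← ENNReal.ofReal_natCast,
      ← ENNReal.ofReal_mul (by positivity), inv_pow, div_eq_mul_inv]
  · intro B _
    exact (Set.toFinite _).measurableSet

theorem poissonXOR_apply {n k : ℕ} (m : ℝ≥0) (A : Set (XORInstance n k)) :
    poissonXOR n k m A = ∑' M : ℕ,
      ENNReal.ofReal (Real.exp (-m) * m ^ M / M.factorial) * randomXOR n k M A := by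
  rw [poissonXOR, Measure.bind_apply (measurableSet_XORInstance A)
    (Measurable.of_discrete.aemeasurable), poissonMeasure, lintegral_sum_measure]
  simp

/-- A geometric bound on the fixed-size laws gives an exponential bound on the Poissonized law. -/
theorem poissonXOR_le_of_forall_le {n k : ℕ} (m : ℝ≥0) (A : Set (XORInstance n k)) {B C φ : ℝ}
    (hB : 0 ≤ B) (hC : 0 ≤ C) (hφ : 0 ≤ φ)
    (h : ∀ M, randomXOR n k M A ≤ ENNReal.ofReal (B + C * φ ^ M)) :
    poissonXOR n k m A ≤ ENNReal.ofReal (B + C * Real.exp (m * (φ - 1))) := by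
  rw [poissonXOR_apply]
  have hs : HasSum (fun M : ℕ => Real.exp (-m) * m ^ M / M.factorial * (B + C * φ ^ M))
      (B + C * Real.exp (m * (φ - 1))) := by
    have h1 := (NormedSpace.expSeries_div_hasSum_exp ((m : ℝ) * φ)).mul_left (C * Real.exp (-m))
    rw [← Real.exp_eq_exp_ℝ, mul_assoc, ← Real.exp_add,
      show -(m : ℝ) + m * φ = m * (φ - 1) by ring] at h1
    have h2 := (hasSum_one_poissonMeasure m).mul_left B
    rw [mul_one] at h2
    refine (h2.add h1).congr_fun fun M => ?_
    rw [mul_pow]; ring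
  rw [← hs.tsum_eq, ENNReal.ofReal_tsum_of_nonneg (fun M => by positivity) hs.summable]
  refine ENNReal.tsum_le_tsum fun M => ?_
  rw [ENNReal.ofReal_mul (by positivity)]
  gcongr
  exact h M

end Laws

/-! ### The dense regime: Chernoff bound at θ = κ -/

section MatrixChernoff

open Finset

theorem nonempty_KSubset {n k : ℕ} (hkn : k ≤ n) : Nonempty (KSubset n k) := by
  rw [← Fintype.card_pos_iff, card_KSubset]; exact Nat.choose_pos hkn

theorem kikuchiDelta_nonneg (ℓ n k : ℕ) : 0 ≤ kikuchiDelta ℓ n k := by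
  unfold kikuchiDelta; positivity

/-- Markov's inequality for exp(θ λ_max). The bound is geometric in M, so that it can be summed
against the Poisson weights. -/
theorem randomXOR_lambdaMax_le {n ℓ h : ℕ} (hℓ : h ≤ ℓ) (hn : ℓ + h ≤ n) (M : ℕ) {θ : ℝ}
    (hθ : 0 ≤ θ) (t : ℝ) :
    randomXOR n (2 * h) M {I | ¬ lambdaMax (kikuchiMatrix ℓ I) ≤ t} ≤
      ENNReal.ofReal ((n.choose ℓ * Real.exp (-(θ * t))) *
        (1 + kikuchiDelta ℓ n (2 * h) * (Real.cosh θ - 1)) ^ M) := by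
  classical
  have hne : Nonempty (KSubset n ℓ) := nonempty_KSubset (by omega)
  have hC : (0 : ℝ) < n.choose (2 * h) := by
    exact_mod_cast Nat.choose_pos (by omega : 2 * h ≤ n)
  rw [randomXOR_apply (by omega)]
  refine ENNReal.ofReal_le_ofReal ?_
  rw [div_le_iff₀ (by positivity)]
  have h1 := (isRegularMatchingFamily_kikuchi n ℓ h).sum_exp_lambdaMax_le M θ hθ
  rw [card_KSubset, card_KSubset, ← kikuchiDelta_mul_choose hℓ hn] at h1
  have h2 : (#{ω : Fin M → XORConstraint n (2 * h) | (⟨M, ω⟩ : XORInstance n (2 * h)) ∈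
      {I : XORInstance n (2 * h) | ¬ lambdaMax (kikuchiMatrix ℓ I) ≤ t}} : ℝ) * Real.exp (θ * t) ≤
      ∑ ω : Fin M → XORConstraint n (2 * h), Real.exp (θ * lambdaMax
        (signedSum (fun S : KSubset n (2 * h) => kikuchiMatching ℓ S) ω)) := by
    rw [← nsmul_eq_mul, ← Finset.sum_const]
    refine (Finset.sum_le_sum fun ω hω => ?_).trans
      (Finset.sum_le_sum_of_subset_of_nonneg (Finset.filter_subset _ _)
        fun ω _ _ => (Real.exp_pos _).le)
    have h3 := (Finset.mem_filter.1 hω).2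
    rw [Set.mem_ofPred_eq, kikuchiMatrix_eq_signedSum, not_le] at h3
    exact Real.exp_le_exp.2 (mul_le_mul_of_nonneg_left h3.le hθ)
  have h3 := h2.trans h1
  rw [Real.exp_neg]
  rw [← le_div_iff₀ (Real.exp_pos _)] at h3
  refine le_trans (le_of_eq (by congr)) (h3.trans (le_of_eq ?_))
  rw [show 2 * ((n.choose (2 * h) : ℝ) + kikuchiDelta ℓ n (2 * h) * n.choose (2 * h) *
    (Real.cosh θ - 1)) = (1 + kikuchiDelta ℓ n (2 * h) * (Real.cosh θ - 1)) *
      (2 * n.choose (2 * h)) by ring, mul_pow]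
  field_simp

/-- To leading order the left side is -κ²/2 · (2 + κ) = -κ² - κ³/2, and for κ ≤ 1 the spare κ³/2
absorbs the higher terms of cosh. -/
theorem cosh_sub_one_sub_sq_le {κ : ℝ} (h0 : 0 ≤ κ) (h1 : κ ≤ 1) :
    (Real.cosh κ - 1 - κ ^ 2) * (2 + κ) ≤ -κ ^ 2 := by
  have hκ : κ ^ 2 ≤ 1 := by nlinarith
  have hb := Real.exp_bound' (x := κ ^ 2 / 2) (by positivity) (by linarith) (n := 3) (by norm_num)
  have hc := (Real.cosh_le_exp_half_sq κ).trans hb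
  norm_num [Finset.sum_range_succ, Nat.factorial] at hc
  have hd : Real.cosh κ ≤ 1 + κ ^ 2 / 2 + κ ^ 4 * (31 / 200) := by
    nlinarith [mul_le_mul_of_nonneg_right hκ (by positivity : 0 ≤ κ ^ 4)]
  have h5 : Real.cosh κ - 1 - κ ^ 2 ≤ -κ ^ 2 / 2 + κ ^ 4 * (31 / 200) := by linarith
  have h6 : (-κ ^ 2 / 2 + κ ^ 4 * (31 / 200)) * (2 + κ)
      = -κ ^ 2 - κ ^ 3 * (1 / 2 - κ * (31 / 100) - κ ^ 2 * (31 / 200)) := by ring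
  have h7 : 0 ≤ κ ^ 3 * (1 / 2 - κ * (31 / 100) - κ ^ 2 * (31 / 200)) :=
    mul_nonneg (by positivity) (by linarith)
  nlinarith

/-- With C(n,ℓ) ≤ n^ℓ the exponent is ℓ log n minus at least κ²Δ/(2+κ), and the hypothesis says
exactly that the latter is at least (1+ε) ℓ log n. -/
theorem chernoff_exponent_le {n ℓ : ℕ} (hn : 0 < n) {κ ε Δ : ℝ} (hκ0 : 0 < κ) (hκ1 : κ ≤ 1)
    (hΔ0 : 0 ≤ Δ) (hΔ : (1 + κ / 2) * (2 * (1 + ε) * ℓ * Real.log n) ≤ κ ^ 2 * Δ) :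
    n.choose ℓ * Real.exp (-(κ * (κ * Δ))) * Real.exp (Δ * (Real.cosh κ - 1)) ≤
      (n : ℝ) ^ (-(ε * ℓ)) := by
  have hn' : (0 : ℝ) < n := by exact_mod_cast hn
  have hN : (n.choose ℓ : ℝ) ≤ Real.exp (ℓ * Real.log n) := by
    rw [mul_comm, Real.exp_mul, Real.exp_log hn', Real.rpow_natCast]
    exact_mod_cast Nat.choose_le_pow n ℓ
  rw [Real.rpow_def_of_pos hn', mul_assoc, ← Real.exp_add]
  refine (mul_le_mul_of_nonneg_right hN (Real.exp_pos _).le).trans ?_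
  rw [← Real.exp_add, Real.exp_le_exp]
  have h1 := cosh_sub_one_sub_sq_le hκ0.le hκ1
  have h2 : (2 + κ) * ((1 + ε) * ℓ * Real.log n) ≤ κ ^ 2 * Δ := by
    refine le_trans (le_of_eq ?_) hΔ; ring
  have h3 := mul_le_mul_of_nonneg_right h1 hΔ0
  have h4 : (2 + κ) * ((1 + ε) * ℓ * Real.log n + Δ * (Real.cosh κ - 1 - κ ^ 2)) ≤ 0 := by
    linarith
  have h5 : (1 + ε) * ℓ * Real.log n + Δ * (Real.cosh κ - 1 - κ ^ 2) ≤ 0 := by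
    by_contra hc
    have := mul_pos (by linarith : 0 < 2 + κ) (not_le.1 hc)
    linarith
  linarith

/-- The dense regime. -/
theorem dense_regime {n ℓ h : ℕ} (hℓ : h ≤ ℓ) (hn : ℓ + h ≤ n) (hn0 : 0 < n) {κ ε : ℝ}
    (hκ0 : 0 < κ) (hκ1 : κ ≤ 1) :
    (∀ m : ℕ, (1 + κ / 2) * (2 * (1 + ε) * ℓ * Real.log n) ≤
        κ ^ 2 * (kikuchiDelta ℓ n (2 * h) * m) →
      randomXOR n (2 * h) m
        {I | ¬ lambdaMax (kikuchiMatrix ℓ I) ≤ κ * (kikuchiDelta ℓ n (2 * h) * m)} ≤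
      ENNReal.ofReal ((n : ℝ) ^ (-(ε * ℓ)))) ∧
    (∀ m : ℝ≥0, (1 + κ / 2) * (2 * (1 + ε) * ℓ * Real.log n) ≤
        κ ^ 2 * (kikuchiDelta ℓ n (2 * h) * m) →
      poissonXOR n (2 * h) m
        {I | ¬ lambdaMax (kikuchiMatrix ℓ I) ≤ κ * (kikuchiDelta ℓ n (2 * h) * m)} ≤
      ENNReal.ofReal ((n : ℝ) ^ (-(ε * ℓ)))) := by
  have hδ := kikuchiDelta_nonneg ℓ n (2 * h)
  have hcosh : 0 ≤ Real.cosh κ - 1 := by linarith [Real.one_le_cosh κ]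
  have hφ : 0 ≤ 1 + kikuchiDelta ℓ n (2 * h) * (Real.cosh κ - 1) := by positivity
  refine ⟨fun m hm => ?_, fun m hm => ?_⟩
  · refine (randomXOR_lambdaMax_le hℓ hn m hκ0.le _).trans (ENNReal.ofReal_le_ofReal ?_)
    refine le_trans (mul_le_mul_of_nonneg_left ?_ (by positivity))
      (chernoff_exponent_le hn0 hκ0 hκ1 (by positivity) hm)
    calc (1 + kikuchiDelta ℓ n (2 * h) * (Real.cosh κ - 1)) ^ m
        ≤ Real.exp (kikuchiDelta ℓ n (2 * h) * (Real.cosh κ - 1)) ^ m := by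
          refine pow_le_pow_left₀ hφ ?_ m
          linarith [Real.add_one_le_exp (kikuchiDelta ℓ n (2 * h) * (Real.cosh κ - 1))]
      _ = _ := by rw [← Real.exp_nat_mul]; congr 1; ring
  · refine (poissonXOR_le_of_forall_le m _
      (C := n.choose ℓ * Real.exp (-(κ * (κ * (kikuchiDelta ℓ n (2 * h) * m)))))
      le_rfl (by positivity) hφ fun M =>
      (randomXOR_lambdaMax_le hℓ hn M hκ0.le _).trans_eq (by rw [zero_add])).trans
      (ENNReal.ofReal_le_ofReal ?_)
    refine le_trans (le_of_eq ?_) (chernoff_exponent_le hn0 hκ0 hκ1 (by positivity) hm)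
    rw [zero_add]
    congr 2; ring

end MatrixChernoff

/-! ### Halving scopes: from the Kikuchi matrix to signed graphs on h-subsets -/

section HalvingScopes

open Finset Matrix

/-- The elements of `S` in the positions `σ`. -/
noncomputable def scopePart {n k h : ℕ} (σ : KSubset k h) (S : KSubset n k) : KSubset n h :=
  ⟨σ.1.map (S.1.orderEmbOfFin S.2).toEmbedding, by rw [Finset.card_map]; exact σ.2⟩

/-- The complementary half. -/
def halfCompl {h : ℕ} (σ : KSubset (2 * h) h) : KSubset (2 * h) h :=
  ⟨σ.1ᶜ, by rw [Finset.card_compl, Fintype.card_fin, σ.2]; omega⟩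

theorem scopePart_union {n h : ℕ} (σ : KSubset (2 * h) h) (S : KSubset n (2 * h)) :
    (scopePart σ S).1 ∪ (scopePart (halfCompl σ) S).1 = S.1 := by
  simp only [scopePart, halfCompl]
  rw [← Finset.map_union, Finset.union_compl, Finset.map_orderEmbOfFin_univ]

theorem scopePart_disjoint {n h : ℕ} (σ : KSubset (2 * h) h) (S : KSubset n (2 * h)) :
    Disjoint (scopePart σ S).1 (scopePart (halfCompl σ) S).1 := by
  simp only [scopePart, halfCompl, Finset.disjoint_map]
  exact disjoint_compl_right

theorem scopePart_ne {n h : ℕ} (hh : 0 < h) (σ : KSubset (2 * h) h) (S : KSubset n (2 * h)) :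
    scopePart σ S ≠ scopePart (halfCompl σ) S := by
  intro he
  have hd := scopePart_disjoint σ S
  rw [← he, disjoint_self, Finset.bot_eq_empty] at hd
  have := (scopePart σ S).2
  rw [hd, Finset.card_empty] at this
  omega

/-- The edge of the complete graph on the `h`-subsets determined by halving the scope. -/
noncomputable def halvingEdge {n h : ℕ} (σ : KSubset (2 * h) h) (S : KSubset n (2 * h)) :
    Sym2 (KSubset n h) :=
  s(scopePart σ S, scopePart (halfCompl σ) S)

/-- The scope is the union of the endpoints of its edge. Hence distinct scopes occupy distinct
edges, as the trace bound for sparse graphs requires. -/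
theorem halvingEdge_injective {n h : ℕ} (σ : KSubset (2 * h) h) :
    Function.Injective (halvingEdge (n := n) σ) := by
  intro S S' hSS
  refine Subtype.ext ?_
  rw [← scopePart_union σ S, ← scopePart_union σ S']
  rcases Sym2.eq_iff.1 hSS with ⟨h1, h2⟩ | ⟨h1, h2⟩
  · rw [h1, h2]
  · rw [h1, h2, Finset.union_comm]

/-- Extension by zero of a function on the `ℓ`-subsets to all subsets. -/
noncomputable def extendZero {n ℓ : ℕ} (f : KSubset n ℓ → ℝ) (X : Finset (Fin n)) : ℝ :=
  if hX : #X = ℓ then f ⟨X, hX⟩ else 0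

theorem extendZero_coe {n ℓ : ℕ} (f : KSubset n ℓ → ℝ) (T : KSubset n ℓ) :
    extendZero f T.1 = f T := dif_pos T.2

theorem quadratic_form_kikuchiMatching {n k ℓ : ℕ} (f : KSubset n ℓ → ℝ) (S : KSubset n k) :
    f ⬝ᵥ kikuchiMatching ℓ S *ᵥ f = ∑ T : KSubset n ℓ, f T * extendZero f (T.1 ∆ S.1) := by
  have h : ∀ T U : KSubset n ℓ, T.1 ∆ U.1 = S.1 ↔ U.1 = T.1 ∆ S.1 := fun T U => by
    constructor
    · intro h; rw [← h, symmDiff_symmDiff_cancel_left]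
    · intro h; rw [h, symmDiff_symmDiff_cancel_left]
  simp only [dotProduct, mulVec, kikuchiMatching, Matrix.of_apply, h]
  refine Finset.sum_congr rfl fun T _ => ?_
  congr 1
  unfold extendZero
  split_ifs with hc
  · rw [Finset.sum_eq_single (⟨T.1 ∆ S.1, hc⟩ : KSubset n ℓ)]
    · simp
    · intro U _ hU
      rw [if_neg fun h => hU (Subtype.ext h), zero_mul]
    · simp
  · refine Finset.sum_eq_zero fun U _ => ?_
    rw [if_neg fun h => hc (by rw [← h]; exact U.2), zero_mul]

theorem extendZero_union_eq_zero {n ℓ h : ℕ} (hℓ : h ≤ ℓ) (f : KSubset n ℓ → ℝ)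
    (R : KSubset n (ℓ - h)) (Q : KSubset n h) (hd : ¬ Disjoint R.1 Q.1) :
    extendZero f (R.1 ∪ Q.1) = 0 := by
  refine dif_neg fun hc => hd ?_
  rw [← Finset.card_union_eq_card_add_card, hc, R.2, Q.2]; omega

/-- Every scope moves an `ℓ`-subset by exchanging one half of the scope for the other. -/
theorem quadratic_form_kikuchiMatching_eq_sum_halves {n ℓ h : ℕ} (hℓ : h ≤ ℓ)
    (f : KSubset n ℓ → ℝ) (S : KSubset n (2 * h)) :
    f ⬝ᵥ kikuchiMatching ℓ S *ᵥ f = ∑ σ : KSubset (2 * h) h, ∑ R : KSubset n (ℓ - h),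
      extendZero f (R.1 ∪ (scopePart σ S).1) *
        extendZero f (R.1 ∪ (scopePart (halfCompl σ) S).1) := by
  classical
  rw [quadratic_form_kikuchiMatching, ← Fintype.sum_prod_type']
  have hsymm : ∀ (σ : KSubset (2 * h) h) (R : KSubset n (ℓ - h)), Disjoint R.1 S.1 →
      (R.1 ∪ (scopePart σ S).1) ∆ S.1 = R.1 ∪ (scopePart (halfCompl σ) S).1 := by
    intro σ R hR
    have hu := scopePart_union σ S
    have hd := scopePart_disjoint σ S
    rw [← hu] at hR ⊢
    rw [Finset.disjoint_union_right] at hR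
    have a := Finset.disjoint_left.1 hR.1
    have b := Finset.disjoint_left.1 hR.2
    have c := Finset.disjoint_left.1 hd
    ext x
    simp only [Finset.mem_symmDiff, Finset.mem_union]
    have := @a x; have := @b x; have := @c x
    tauto
  have hinter : ∀ (σ : KSubset (2 * h) h) (R : KSubset n (ℓ - h)), Disjoint R.1 S.1 →
      (R.1 ∪ (scopePart σ S).1) ∩ S.1 = (scopePart σ S).1 := by
    intro σ R hR
    have hu := scopePart_union σ S
    rw [Finset.union_inter_distrib_right, Finset.disjoint_iff_inter_eq_empty.1 hR,
      Finset.empty_union, Finset.inter_eq_left, ← hu]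
    exact Finset.subset_union_left
  symm
  -- The pair (σ, R) corresponds to T = R ∪ S_σ, with inverse R = T \ S and σ the positions of S ∩ T
  -- in S. Pairs with R meeting S have a vanishing term, because one of the two unions then has
  -- fewer than ℓ elements.
  refine Finset.sum_bij_ne_zero (fun x _ hx => ⟨x.2.1 ∪ (scopePart x.1 S).1, ?_⟩) ?_ ?_ ?_ ?_
  · by_contra hc
    exact hx (by rw [extendZero, dif_neg hc, zero_mul])
  · intros; exact mem_univ _
  · rintro ⟨σ, R⟩ _ hx ⟨σ', R'⟩ _ hx' he
    have hdisj : ∀ (σ : KSubset (2 * h) h) (R : KSubset n (ℓ - h)),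
        extendZero f (R.1 ∪ (scopePart σ S).1) *
        extendZero f (R.1 ∪ (scopePart (halfCompl σ) S).1) ≠ 0 → Disjoint R.1 S.1 := by
      intro σ R hx
      rw [← scopePart_union σ S, Finset.disjoint_union_right]
      constructor
      · by_contra hd; exact hx (by rw [extendZero_union_eq_zero hℓ f _ _ hd, zero_mul])
      · by_contra hd; exact hx (by rw [extendZero_union_eq_zero hℓ f _ _ hd, mul_zero])
    have hR := hdisj σ R hx
    have hR' := hdisj σ' R' hx'
    rw [Subtype.mk.injEq] at he
    simp only at he
    have h1 : (scopePart σ S).1 = (scopePart σ' S).1 := by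
      rw [← hinter σ R hR, ← hinter σ' R' hR', he]
    have h2 : R.1 = R'.1 := by
      have e1 : R.1 = (R.1 ∪ (scopePart σ S).1) \ S.1 := by
        rw [Finset.union_sdiff_distrib, Finset.sdiff_eq_self_of_disjoint hR,
          Finset.sdiff_eq_empty_iff_subset.2 (by
            rw [← scopePart_union σ S]; exact Finset.subset_union_left), Finset.union_empty]
      have e2 : R'.1 = (R'.1 ∪ (scopePart σ' S).1) \ S.1 := by
        rw [Finset.union_sdiff_distrib, Finset.sdiff_eq_self_of_disjoint hR',
          Finset.sdiff_eq_empty_iff_subset.2 (by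
            rw [← scopePart_union σ' S]; exact Finset.subset_union_left), Finset.union_empty]
      rw [e1, e2, he]
    rw [Prod.mk.injEq]
    exact ⟨Subtype.ext (Finset.map_injective _ h1), Subtype.ext h2⟩
  · intro T _ hT
    have hc : #(T.1 ∆ S.1) = ℓ := by
      by_contra hc
      exact hT (by rw [extendZero, dif_neg hc, mul_zero])
    have hi := (card_symmDiff_eq_iff T.2 S.2).1 hc
    set e := S.1.orderEmbOfFin S.2
    have hmap : (univ.filter fun j => e j ∈ T.1).map e.toEmbedding = S.1 ∩ T.1 := by
      ext x
      simp only [mem_map, mem_filter, mem_univ, true_and, mem_inter]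
      constructor
      · rintro ⟨j, hj, rfl⟩
        exact ⟨S.1.orderEmbOfFin_mem S.2 j, hj⟩
      · rintro ⟨hxS, hxT⟩
        have : x ∈ (univ : Finset (Fin (2 * h))).map e.toEmbedding := by
          rw [Finset.map_orderEmbOfFin_univ]; exact hxS
        obtain ⟨j, _, hj⟩ := Finset.mem_map.1 this
        exact ⟨j, by rw [show e j = x from hj]; exact hxT, hj⟩
    have hσ : #(univ.filter fun j => e j ∈ T.1) = h := by
      rw [← Finset.card_map e.toEmbedding, hmap, hi]
    have hR : #(T.1 \ S.1) = ℓ - h := by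
      have := Finset.card_sdiff_add_card_inter T.1 S.1
      rw [Finset.inter_comm, hi, T.2] at this
      omega
    have hTe : (T.1 \ S.1) ∪ (S.1 ∩ T.1) = T.1 := by
      rw [Finset.inter_comm, Finset.sdiff_union_inter]
    have hpart : (scopePart (⟨_, hσ⟩ : KSubset (2 * h) h) S).1 = S.1 ∩ T.1 := hmap
    refine ⟨(⟨_, hσ⟩, ⟨_, hR⟩), mem_univ _, ?_, Subtype.ext ?_⟩
    · have h2 := hsymm ⟨_, hσ⟩ ⟨_, hR⟩ Finset.sdiff_disjoint
      simp only at h2 ⊢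
      rw [← h2, hpart, hTe, extendZero_coe]
      exact hT
    · simp only
      rw [hpart, hTe]
  · rintro ⟨σ, R⟩ _ hx
    have hR : Disjoint R.1 S.1 := by
      rw [← scopePart_union σ S, Finset.disjoint_union_right]
      constructor
      · by_contra hd; exact hx (by rw [extendZero_union_eq_zero hℓ f _ _ hd, zero_mul])
      · by_contra hd; exact hx (by rw [extendZero_union_eq_zero hℓ f _ _ hd, mul_zero])
    simp only
    rw [hsymm σ R hR]
    congr 1
    exact dif_pos _

/-- The two halves are distinct since h > 0, so there are no loops and each edge occurs twice in the
symmetric form. -/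
theorem quadratic_form_halving {n h M : ℕ} (hh : 0 < h) (σ : KSubset (2 * h) h)
    (ω : Fin M → XORConstraint n (2 * h)) (g : KSubset n h → ℝ) :
    g ⬝ᵥ signedAdjacency (fun i => halvingEdge σ (ω i).1) (fun i => (ω i).2) *ᵥ g =
      2 * ∑ i, ((((ω i).2 : ℤˣ) : ℤ) : ℝ) *
        (g (scopePart σ (ω i).1) * g (scopePart (halfCompl σ) (ω i).1)) := by
  have h1 : ∀ S : KSubset n (2 * h), ∑ x : KSubset n h × KSubset n h,
      (if halvingEdge σ S = s(x.1, x.2) then g x.1 * g x.2 else 0)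
      = 2 * (g (scopePart σ S) * g (scopePart (halfCompl σ) S)) := by
    intro S
    have hne := scopePart_ne hh σ S
    have hfil : (univ.filter fun x : KSubset n h × KSubset n h => halvingEdge σ S = s(x.1, x.2))
        = {(scopePart σ S, scopePart (halfCompl σ) S),
          (scopePart (halfCompl σ) S, scopePart σ S)} := by
      ext ⟨x, y⟩
      simp only [halvingEdge, Sym2.eq_iff, mem_filter, mem_univ, true_and, mem_insert,
        mem_singleton, Prod.mk.injEq]
      constructor <;> rintro (⟨h1, h2⟩ | ⟨h1, h2⟩) <;> simp [h1, h2]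
    rw [← Finset.sum_filter, hfil, Finset.sum_pair]
    · ring
    · intro h; exact hne (Prod.mk.inj h).1
  simp only [dotProduct, mulVec, signedAdjacency, signedWeight, Matrix.of_apply, Finset.mul_sum,
    Finset.sum_mul]
  rw [← Fintype.sum_prod_type', Finset.sum_comm]
  refine Finset.sum_congr rfl fun i _ => ?_
  have h2 := h1 (ω i).1
  calc _ = ((((ω i).2 : ℤˣ) : ℤ) : ℝ) * ∑ x : KSubset n h × KSubset n h,
      (if halvingEdge σ (ω i).1 = s(x.1, x.2) then g x.1 * g x.2 else 0) := by
        rw [Finset.mul_sum]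
        refine Finset.sum_congr rfl fun x _ => ?_
        split_ifs <;> ring
    _ = _ := by rw [h2]; ring

/-- A term is nonzero only if R ∪ Q is an ℓ-set T; then R = T \ Q, so each T is reached from at most
C(ℓ,h) pairs. -/
theorem sum_sq_extendZero_le {n ℓ h : ℕ} (hℓ : h ≤ ℓ) (f : KSubset n ℓ → ℝ) :
    ∑ R : KSubset n (ℓ - h), ∑ Q : KSubset n h, extendZero f (R.1 ∪ Q.1) ^ 2
      ≤ ℓ.choose h * (f ⬝ᵥ f) := by
  classical
  have h1 : ∀ x : KSubset n (ℓ - h) × KSubset n h, extendZero f (x.1.1 ∪ x.2.1) ^ 2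
      = ∑ T : KSubset n ℓ, if x.1.1 ∪ x.2.1 = T.1 then f T ^ 2 else 0 := by
    intro x
    unfold extendZero
    split_ifs with hc
    · rw [Finset.sum_eq_single (⟨_, hc⟩ : KSubset n ℓ)]
      · simp
      · intro T _ hT
        exact if_neg fun h => hT (Subtype.ext h.symm)
      · simp
    · rw [Finset.sum_eq_zero fun T _ => if_neg fun h => hc (by rw [h]; exact T.2)]
      norm_num
  rw [← Fintype.sum_prod_type']
  simp_rw [h1]
  rw [Finset.sum_comm, dotProduct, Finset.mul_sum]
  refine Finset.sum_le_sum fun T _ => ?_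
  rw [← Finset.sum_filter, Finset.sum_const, nsmul_eq_mul, ← sq]
  refine mul_le_mul_of_nonneg_right ?_ (sq_nonneg _)
  have hcard : #{x : KSubset n (ℓ - h) × KSubset n h | x.1.1 ∪ x.2.1 = T.1} ≤
      #(T.1.powersetCard h) := by
    refine Finset.card_le_card_of_injOn (fun x => x.2.1) ?_ ?_
    · intro x hx
      have := (Finset.mem_filter.1 hx).2
      refine Finset.mem_coe.2 (Finset.mem_powersetCard.2 ⟨?_, x.2.2⟩)
      rw [← this]; exact Finset.subset_union_right
    · intro x hx y hy hxy
      have hx' := (Finset.mem_filter.1 hx).2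
      have hy' := (Finset.mem_filter.1 hy).2
      have key : ∀ z : KSubset n (ℓ - h) × KSubset n h, z.1.1 ∪ z.2.1 = T.1 →
          z.1.1 = T.1 \ z.2.1 := by
        intro z hz
        have hd : Disjoint z.1.1 z.2.1 := by
          rw [← Finset.card_union_eq_card_add_card, hz, T.2, z.1.2, z.2.2]; omega
        rw [← hz, Finset.union_sdiff_right, Finset.sdiff_eq_self_of_disjoint hd]
      simp only at hxy
      refine Prod.ext (Subtype.ext ?_) (Subtype.ext hxy)
      rw [key x hx', key y hy', hxy]
  rw [Finset.card_powersetCard, T.2] at hcard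
  exact_mod_cast hcard

/-- The Kikuchi matrix is controlled by the sparse signed graphs obtained by halving scopes. -/
theorem lambdaMax_kikuchiMatrix_le {n ℓ h M : ℕ} (hh : 0 < h) (hℓ : h ≤ ℓ) (hn : ℓ ≤ n)
    (ω : Fin M → XORConstraint n (2 * h)) {τ : ℝ} (hτ : 0 ≤ τ)
    (hσ : ∀ σ : KSubset (2 * h) h, ∃ p : ℕ, 0 < p ∧
      (signedAdjacency (fun i => halvingEdge σ (ω i).1) (fun i => (ω i).2) ^ (2 * p)).trace
        ≤ τ ^ (2 * p)) :
    lambdaMax (kikuchiMatrix ℓ (⟨M, ω⟩ : XORInstance n (2 * h))) ≤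
      (2 * h).choose h * (ℓ.choose h * τ) := by
  have hne : Nonempty (KSubset n ℓ) := nonempty_KSubset hn
  obtain ⟨f, hf, hlam⟩ := exists_eigenvector_lambdaMax
    (isHermitian_kikuchiMatrix ℓ (⟨M, ω⟩ : XORInstance n (2 * h)))
  have h1 : f ⬝ᵥ kikuchiMatrix ℓ (⟨M, ω⟩ : XORInstance n (2 * h)) *ᵥ f
      = ∑ i, ((((ω i).2 : ℤˣ) : ℤ) : ℝ) * (f ⬝ᵥ kikuchiMatching ℓ (ω i).1 *ᵥ f) := by
    rw [kikuchiMatrix, Matrix.sum_mulVec, dotProduct_sum]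
    refine Finset.sum_congr rfl fun i _ => ?_
    rw [smul_mulVec, dotProduct_smul, smul_eq_mul]
  -- Fixing R slices f into functions on h-subsets, to which the halving graphs apply. The factor 2
  -- counts both orientations of each edge and is given away at the end.
  have h2 : 2 * (f ⬝ᵥ kikuchiMatrix ℓ (⟨M, ω⟩ : XORInstance n (2 * h)) *ᵥ f)
      = ∑ σ : KSubset (2 * h) h, ∑ R : KSubset n (ℓ - h),
        (fun Q : KSubset n h => extendZero f (R.1 ∪ Q.1)) ⬝ᵥ
          signedAdjacency (fun i => halvingEdge σ (ω i).1) (fun i => (ω i).2) *ᵥ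
          (fun Q : KSubset n h => extendZero f (R.1 ∪ Q.1)) := by
    simp_rw [quadratic_form_halving hh, h1, quadratic_form_kikuchiMatching_eq_sum_halves hℓ,
      ← Finset.mul_sum]
    congr 1
    simp_rw [Finset.mul_sum]
    rw [Finset.sum_comm]
    exact Finset.sum_congr rfl fun σ _ => Finset.sum_comm
  have h3 : ∀ (σ : KSubset (2 * h) h) (R : KSubset n (ℓ - h)),
      (fun Q : KSubset n h => extendZero f (R.1 ∪ Q.1)) ⬝ᵥ
          signedAdjacency (fun i => halvingEdge σ (ω i).1) (fun i => (ω i).2) *ᵥ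
          (fun Q : KSubset n h => extendZero f (R.1 ∪ Q.1)) ≤
      τ * ∑ Q : KSubset n h, extendZero f (R.1 ∪ Q.1) ^ 2 := by
    intro σ R
    obtain ⟨p, hp, htr⟩ := hσ σ
    refine (quadratic_form_le_of_trace_pow_le (isHermitian_signedAdjacency _ _) hτ hp.ne' htr
      _).trans (le_of_eq ?_)
    simp only [dotProduct, sq]
  have h4 : 2 * (f ⬝ᵥ kikuchiMatrix ℓ (⟨M, ω⟩ : XORInstance n (2 * h)) *ᵥ f) ≤
      (2 * h).choose h * (ℓ.choose h * τ) := by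
    rw [h2]
    calc _ ≤ ∑ σ : KSubset (2 * h) h, ∑ R : KSubset n (ℓ - h),
          τ * ∑ Q : KSubset n h, extendZero f (R.1 ∪ Q.1) ^ 2 :=
          Finset.sum_le_sum fun σ _ => Finset.sum_le_sum fun R _ => h3 σ R
      _ ≤ ∑ σ : KSubset (2 * h) h, τ * (ℓ.choose h * (f ⬝ᵥ f)) := by
          refine Finset.sum_le_sum fun σ _ => ?_
          rw [← Finset.mul_sum]
          exact mul_le_mul_of_nonneg_left (sum_sq_extendZero_le hℓ f) hτ
      _ = _ := by
          rw [Finset.sum_const, Finset.card_univ, card_KSubset, hf, nsmul_eq_mul]; ring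
  rw [hlam] at h4
  have : (0 : ℝ) ≤ (2 * h).choose h * (ℓ.choose h * τ) := by positivity
  by_cases h0 : 0 ≤ lambdaMax (kikuchiMatrix ℓ (⟨M, ω⟩ : XORInstance n (2 * h)))
  · linarith
  · linarith

end HalvingScopes

/-! ### The sparse regime: bounded ℓ and logarithmic degree -/

section SparseRegime

open Finset

theorem choose_le_two_pow_mul_choose_sub {n ℓ h : ℕ} (hn : 2 * (ℓ + h) ≤ n) :
    n.choose h ≤ 2 ^ h * (n - ℓ).choose h := by
  have hf : 0 < h.factorial := Nat.factorial_pos h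
  refine Nat.le_of_mul_le_mul_left ?_ hf
  calc h.factorial * n.choose h = n.descFactorial h := (Nat.descFactorial_eq_factorial_mul_choose n h).symm
    _ ≤ n ^ h := Nat.descFactorial_le_pow n h
    _ ≤ (2 * (n - ℓ + 1 - h)) ^ h := Nat.pow_le_pow_left (by omega) h
    _ = 2 ^ h * (n - ℓ + 1 - h) ^ h := mul_pow _ _ _
    _ ≤ 2 ^ h * (n - ℓ).descFactorial h := Nat.mul_le_mul_left _ (Nat.pow_sub_le_descFactorial _ _)
    _ = h.factorial * (2 ^ h * (n - ℓ).choose h) := by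
        rw [Nat.descFactorial_eq_factorial_mul_choose]; ring

theorem le_two_mul_factorial_mul_choose {n ℓ h : ℕ} (hh : 0 < h) (hn : 2 * (ℓ + h) ≤ n) :
    n ≤ 2 * h.factorial * (n - ℓ).choose h := by
  calc n ≤ 2 * (n - ℓ + 1 - h) := by omega
    _ ≤ 2 * (n - ℓ + 1 - h) ^ h := Nat.mul_le_mul_left _ (Nat.le_self_pow hh.ne' _)
    _ ≤ 2 * (n - ℓ).descFactorial h := Nat.mul_le_mul_left _ (Nat.pow_sub_le_descFactorial _ _)
    _ = _ := by rw [Nat.descFactorial_eq_factorial_mul_choose]; ring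

/-- In the sparse regime, deviations on the logarithmic scale have polynomially small probability
of any prescribed degree. -/
theorem exists_randomXOR_sparse_le {h : ℕ} (hh : 0 < h) (L C : ℕ) {c κ : ℝ} (hc : 0 < c)
    (hκ : 0 < κ) :
    ∃ G : ℝ, ∀ n : ℕ, G ≤ Real.log n → ∀ ℓ : ℕ, h ≤ ℓ → ℓ ≤ L → 2 * (ℓ + h) ≤ n →
      ∀ μ : ℝ, 1 ≤ μ → c * Real.log n ≤ kikuchiDelta ℓ n (2 * h) * μ →
      kikuchiDelta ℓ n (2 * h) * μ ≤ C * Real.log n → ∀ M : ℕ, M ≤ 2 * μ →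
      randomXOR n (2 * h) M
        {I | ¬ lambdaMax (kikuchiMatrix ℓ I) ≤ κ * (kikuchiDelta ℓ n (2 * h) * μ)} ≤
        ENNReal.ofReal (((n : ℝ) ^ L)⁻¹) := by
  classical
  set B := (2 * h).choose h with hB
  have hB0 : 0 < B := Nat.choose_pos (by omega)
  -- Halving costs a factor B · C(ℓ,h) ≤ B · 2^L, so norms at most η log n give λ_max ≤ κ c log n,
  -- which is at most κδμ.
  set η : ℝ := κ * c / (B * 2 ^ L) with hη
  have hη0 : 0 < η := by positivity
  set D := 2 * C * 2 ^ h with hD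
  -- The exponent 2h + 2 bounds both M and x⁻¹. The exponent L + 1 leaves a factor n to pay for the
  -- union bound over the B halvings.
  obtain ⟨G₀, hG₀⟩ := exists_card_large_trace_le (2 * h + 2) (L + 1) D hη0
  set E : ℝ := 4 * C * h.factorial with hE
  refine ⟨max (max G₀ 1) (max (5 * E) (max (2 * B) (2 * C))),
    fun n hn ℓ hℓ hℓL hnℓ μ hμ hlow hup M hM => ?_⟩
  simp only [max_le_iff] at hn
  obtain ⟨⟨hnG, hn1⟩, hnE, hnB, hnC⟩ := hn
  have hn0 : (0 : ℝ) < n := by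
    have : 0 < n := by omega
    exact_mod_cast this
  have hnlog : Real.log n ≤ n := (Real.log_le_sub_one_of_pos hn0).trans (by linarith)
  have hS : (0 : ℝ) < n.choose (2 * h) := by
    exact_mod_cast Nat.choose_pos (by omega : 2 * h ≤ n)
  have hδ := kikuchiDelta_mul_choose hℓ (by omega : ℓ + h ≤ n)
  set δ := kikuchiDelta ℓ n (2 * h)
  have hSn : (n.choose (2 * h) : ℝ) ≤ (n : ℝ) ^ (2 * h) := by
    exact_mod_cast Nat.choose_le_pow n (2 * h)
  have hμ0 : 0 < μ := by linarith
  have hcl : (1 : ℝ) ≤ ℓ.choose h := by exact_mod_cast Nat.choose_pos hℓ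
  have hcn : (1 : ℝ) ≤ (n - ℓ).choose h := by
    exact_mod_cast Nat.choose_pos (by omega : h ≤ n - ℓ)
  -- The edge density of the halving graphs.
  set x := 2 * μ / n.choose (2 * h) with hx
  have hx0 : 0 < x := by positivity
  have hxc : x * (n - ℓ).choose h ≤ 2 * C * Real.log n := by
    have h1 : x * ((ℓ.choose h : ℝ) * (n - ℓ).choose h) = 2 * (δ * μ) := by
      rw [← hδ, hx]; field_simp
    calc x * (n - ℓ).choose h ≤ x * ((ℓ.choose h : ℝ) * (n - ℓ).choose h) := by
          refine mul_le_mul_of_nonneg_left ?_ hx0.le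
          exact le_mul_of_one_le_left (by linarith) hcl
      _ = 2 * (δ * μ) := h1
      _ ≤ _ := by linarith
  have hxS : (M : ℝ) ≤ x * Fintype.card (KSubset n (2 * h)) := by
    rw [card_KSubset, hx, div_mul_cancel₀ _ hS.ne']; exact hM
  have hxV : x * Fintype.card (KSubset n h) ≤ D * Real.log n := by
    rw [card_KSubset]
    have h1 : (n.choose h : ℝ) ≤ 2 ^ h * (n - ℓ).choose h := by
      exact_mod_cast choose_le_two_pow_mul_choose_sub hnℓ
    calc x * n.choose h ≤ x * (2 ^ h * (n - ℓ).choose h) := mul_le_mul_of_nonneg_left h1 hx0.le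
      _ = (x * (n - ℓ).choose h) * 2 ^ h := by ring
      _ ≤ (2 * C * Real.log n) * 2 ^ h := mul_le_mul_of_nonneg_right hxc (by positivity)
      _ = _ := by rw [hD]; push_cast; ring
  have hxn : x ^ 2 * n ≤ 1 := by
    have h1 : (n : ℝ) ≤ 2 * h.factorial * (n - ℓ).choose h := by
      exact_mod_cast le_two_mul_factorial_mul_choose hh hnℓ
    have h2 : x * n ≤ E * Real.log n := by
      calc x * n ≤ x * (2 * h.factorial * (n - ℓ).choose h) := mul_le_mul_of_nonneg_left h1 hx0.le
        _ = (x * (n - ℓ).choose h) * (2 * h.factorial) := by ring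
        _ ≤ (2 * C * Real.log n) * (2 * h.factorial) :=
            mul_le_mul_of_nonneg_right hxc (by positivity)
        _ = _ := by rw [hE]; ring
    -- The fourth term of the exponential series at log n; with 5E ≤ log n it dominates (E log n)².
    have h3 : Real.log n ^ 4 / 24 ≤ n := by
      have := Real.pow_div_factorial_le_exp (Real.log n) (by linarith) 4
      rw [Real.exp_log hn0] at this
      norm_num [Nat.factorial] at this
      exact this
    have h4 : (E * Real.log n) ^ 2 ≤ n := by
      refine le_trans ?_ h3
      have hE0 : 0 ≤ E := by positivity
      have : (5 * E) ^ 2 ≤ Real.log n ^ 2 := pow_le_pow_left₀ (by positivity) hnE 2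
      nlinarith [sq_nonneg (Real.log n), mul_le_mul_of_nonneg_right this (sq_nonneg (Real.log n))]
    have h5 : (x * n) ^ 2 ≤ n := (pow_le_pow_left₀ (by positivity) h2 2).trans h4
    have h6 : (x ^ 2 * n) * n ≤ 1 * n := by linarith [h5, (by ring : (x * n) ^ 2 = x ^ 2 * n * n)]
    exact le_of_mul_le_mul_right h6 hn0
  have hMn : (M : ℝ) ≤ (n : ℝ) ^ (2 * h + 2) := by
    have h1 : x ≤ 2 * C * Real.log n :=
      (le_mul_of_one_le_right hx0.le hcn).trans hxc
    have hC0 : (0 : ℝ) ≤ C := Nat.cast_nonneg C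
    have h2 : x ≤ n * n := h1.trans (mul_le_mul (hnC.trans hnlog) hnlog (by linarith) hn0.le)
    rw [card_KSubset] at hxS
    calc (M : ℝ) ≤ x * n.choose (2 * h) := hxS
      _ ≤ (n * n) * (n : ℝ) ^ (2 * h) := by gcongr
      _ = _ := by ring
  have hn1' : (1 : ℝ) ≤ n := by linarith
  have hxi : x⁻¹ ≤ (n : ℝ) ^ (2 * h + 2) := by
    rw [hx, inv_div, div_le_iff₀ (by positivity)]
    calc (n.choose (2 * h) : ℝ) ≤ (n : ℝ) ^ (2 * h) := hSn
      _ ≤ (n : ℝ) ^ (2 * h + 2) := pow_le_pow_right₀ hn1' (by omega)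
      _ ≤ (n : ℝ) ^ (2 * h + 2) * (2 * μ) := le_mul_of_one_le_right (by positivity) (by linarith)
  have hne : Nonempty (KSubset n h) := nonempty_KSubset (by omega)
  choose p hp0 hp using fun σ : KSubset (2 * h) h =>
    hG₀ n hnG (KSubset n h) (KSubset n (2 * h)) (halvingEdge σ) (halvingEdge_injective σ) M x hx0
      hxn hxS hMn hxi hxV
  rw [randomXOR_apply (by omega)]
  refine ENNReal.ofReal_le_ofReal ?_
  rw [div_le_iff₀ (by positivity)]
  have hsub : (univ.filter fun ω : Fin M → XORConstraint n (2 * h) =>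
      (⟨M, ω⟩ : XORInstance n (2 * h)) ∈
        {I : XORInstance n (2 * h) | ¬ lambdaMax (kikuchiMatrix ℓ I) ≤ κ * (δ * μ)}) ⊆
      univ.biUnion fun σ : KSubset (2 * h) h =>
        univ.filter fun ω : Fin M → KSubset n (2 * h) × ℤˣ => (η * Real.log n) ^ (2 * p σ) <
          (signedAdjacency (fun i => halvingEdge σ (ω i).1) (fun i => (ω i).2) ^ (2 * p σ)).trace := by
    intro ω hω
    have h1 := (Finset.mem_filter.1 hω).2
    rw [Set.mem_ofPred_eq] at h1
    by_contra hcon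
    simp only [mem_biUnion, mem_univ, true_and, mem_filter, not_exists, not_lt] at hcon
    refine h1 ((lambdaMax_kikuchiMatrix_le hh hℓ (by omega) ω (τ := η * Real.log n)
      (by positivity) fun σ => ⟨p σ, hp0 σ, hcon σ⟩).trans ?_)
    have h2 : (ℓ.choose h : ℝ) ≤ 2 ^ L := by
      exact_mod_cast (Nat.choose_le_two_pow ℓ h).trans (Nat.pow_le_pow_right (by norm_num) hℓL)
    calc (B : ℝ) * (ℓ.choose h * (η * Real.log n)) ≤ B * (2 ^ L * (η * Real.log n)) := by gcongr
      _ = κ * (c * Real.log n) := by rw [hη]; field_simp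
      _ ≤ _ := mul_le_mul_of_nonneg_left hlow hκ.le
  have hcount := (Finset.card_le_card hsub).trans Finset.card_biUnion_le
  have hcount' := (Nat.cast_le (α := ℝ)).2 hcount
  refine le_trans (le_of_eq (by congr)) (hcount'.trans ?_)
  rw [Nat.cast_sum]
  refine (Finset.sum_le_sum fun σ _ => hp σ).trans ?_
  rw [Finset.sum_const, Finset.card_univ, card_KSubset, card_KSubset, nsmul_eq_mul, ← hB]
  have h3 : (B : ℝ) * (2 * ((n : ℝ) ^ (L + 1))⁻¹) ≤ ((n : ℝ) ^ L)⁻¹ := by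
    rw [pow_succ, mul_inv, ← mul_assoc, mul_comm (B : ℝ) 2, mul_comm ((n : ℝ) ^ L)⁻¹, ← mul_assoc,
      ← div_eq_mul_inv (2 * (B : ℝ))]
    refine mul_le_of_le_one_left (by positivity) ?_
    rw [div_le_one hn0]
    linarith
  calc (B : ℝ) * ((2 * (n.choose (2 * h) : ℝ)) ^ M * (2 * ((n : ℝ) ^ (L + 1))⁻¹))
      = ((B : ℝ) * (2 * ((n : ℝ) ^ (L + 1))⁻¹)) * (2 * n.choose (2 * h)) ^ M := by ring
    _ ≤ _ := mul_le_mul_of_nonneg_right h3 (by positivity)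

theorem randomXOR_le_one {n k : ℕ} (hkn : k ≤ n) (M : ℕ) (A : Set (XORInstance n k)) :
    randomXOR n k M A ≤ 1 := by
  classical
  have hC : (0 : ℝ) < n.choose k := by exact_mod_cast Nat.choose_pos hkn
  rw [randomXOR_apply hkn, ← ENNReal.ofReal_one]
  refine ENNReal.ofReal_le_ofReal (div_le_one_of_le₀ ?_ (by positivity))
  have := Finset.card_le_univ
    (univ.filter fun ω : Fin M → XORConstraint n k => (⟨M, ω⟩ : XORInstance n k) ∈ A)
  have hcard : Fintype.card (Fin M → XORConstraint n k) = (2 * n.choose k) ^ M := by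
    rw [Fintype.card_fun, Fintype.card_prod, card_KSubset, Fintype.card_units_int,
      Fintype.card_fin, mul_comm]
  rw [hcard] at this
  refine le_trans (le_of_eq (by congr)) (by exact_mod_cast this : _ ≤ _)

/-- A bound valid for at most `2 m` constraints carries over to the Poissonized law. -/
theorem poissonXOR_le_of_forall_le_two_mul {n k : ℕ} (hkn : k ≤ n) (m : ℝ≥0)
    (A : Set (XORInstance n k)) {b : ℝ} (hb : 0 ≤ b) (hm : Real.exp (-(m / 3)) ≤ b)
    (h : ∀ M : ℕ, (M : ℝ) ≤ 2 * m → randomXOR n k M A ≤ ENNReal.ofReal b) :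
    poissonXOR n k m A ≤ ENNReal.ofReal (2 * b) := by
  -- For M > 2m the trivial bound 1 is replaced by 2^(M - 2m), which is geometric in M. Its Poisson
  -- mean is exp(-(2 log 2 - 1)m), and 2 log 2 - 1 > 1/3.
  have h1 : ∀ M, randomXOR n k M A ≤ ENNReal.ofReal
      (b + Real.exp (-(2 * Real.log 2 * m)) * 2 ^ M) := by
    intro M
    by_cases hM : (M : ℝ) ≤ 2 * m
    · refine (h M hM).trans (ENNReal.ofReal_le_ofReal ?_)
      have : 0 < Real.exp (-(2 * Real.log 2 * m)) * (2 : ℝ) ^ M := by positivity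
      linarith
    · refine (randomXOR_le_one hkn M A).trans ?_
      rw [← ENNReal.ofReal_one]
      refine ENNReal.ofReal_le_ofReal ?_
      have h2 : (2 : ℝ) ^ M = Real.exp (Real.log 2 * M) := by
        rw [Real.exp_mul, Real.exp_log (by norm_num), Real.rpow_natCast]
      rw [h2, ← Real.exp_add]
      have h3 : 0 ≤ -(2 * Real.log 2 * m) + Real.log 2 * M := by
        nlinarith [Real.log_pos (by norm_num : (1 : ℝ) < 2), not_le.1 hM]
      linarith [Real.one_le_exp h3]
  refine (poissonXOR_le_of_forall_le m A hb (Real.exp_pos _).le (by norm_num) h1).trans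
    (ENNReal.ofReal_le_ofReal ?_)
  rw [← Real.exp_add, two_mul b]
  have h4 : -(2 * Real.log 2 * m) + (m : ℝ) * (2 - 1) ≤ -(m / 3) := by
    have := Real.log_two_gt_d9
    have hm0 : (0 : ℝ) ≤ m := m.2
    nlinarith
  exact add_le_add le_rfl ((Real.exp_le_exp.2 h4).trans hm)

end SparseRegime

/-! ### Choice between the regimes and assembly -/

section MainTheorem

theorem one_sub_div_le_pow_div_pow {a N t : ℝ} {h : ℕ} (hN : 0 < N) (ht : t ≤ N)
    (hta : N - t ≤ a) :
    1 - h * t / N ≤ a ^ h / N ^ h := by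
  have h1 := one_add_mul_le_pow (a := -(t / N)) (by
    have : t / N ≤ 1 := (div_le_one hN).2 ht
    linarith) h
  rw [← div_pow]
  refine le_trans (le_of_eq (by ring)) (h1.trans (pow_le_pow_left₀ ?_ ?_ h))
  · have : t / N ≤ 1 := (div_le_one hN).2 ht
    linarith
  · rw [le_div_iff₀ hN]; field_simp; linarith

/-- The assumed number of constraints in terms of the average Kikuchi degree. -/
theorem le_kikuchiDelta_mul {n ℓ h : ℕ} (hh : 0 < h) (hℓ : h ≤ ℓ) (hn : ℓ + h ≤ n) {κ ε μ : ℝ}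
    (hκ : 0 < κ) (hμ0 : 0 ≤ μ)
    (hμ : aliceConst κ ε n (2 * h) * ((n : ℝ) / ℓ) ^ ((2 * h - 2) / 2) ≤ μ / n) :
    2 * (1 + ε) * (1 + κ) * ℓ * Real.log n *
      ((ℓ.descFactorial h / (ℓ : ℝ) ^ h) * ((n - ℓ).descFactorial h / (n : ℝ) ^ h)) ≤
      κ ^ 2 * (kikuchiDelta ℓ n (2 * h) * μ) := by
  obtain ⟨g, rfl⟩ : ∃ g, h = g + 1 := ⟨h - 1, by omega⟩
  have hn0 : (0 : ℝ) < n := by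
    have : 0 < n := by omega
    exact_mod_cast this
  have hℓ0 : (0 : ℝ) < ℓ := by
    have : 0 < ℓ := by omega
    exact_mod_cast this
  rw [show (2 * (g + 1) - 2) / 2 = g by omega, aliceConst, show 2 * (g + 1) / 2 = g + 1 by omega,
    le_div_iff₀ hn0] at hμ
  set B : ℝ := ((2 * (g + 1)).choose (g + 1) : ℝ) with hB
  have hB0 : 0 < B := by
    rw [hB]; exact_mod_cast Nat.choose_pos (by omega)
  set a : ℝ := ((ℓ.descFactorial (g + 1) : ℕ) : ℝ)
  set b : ℝ := (((n - ℓ).descFactorial (g + 1) : ℕ) : ℝ)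
  -- Here B cancels the inverse binomial in C_κ, and n · (n/ℓ)^(h-1) · ab/n^(2h) is ℓ times the two
  -- ratios a/ℓ^h and b/n^h.
  have hδ : B * (a * b) / (n : ℝ) ^ (2 * (g + 1)) ≤ kikuchiDelta ℓ n (2 * (g + 1)) := by
    rw [div_le_iff₀ (by positivity)]
    have h1 := kikuchiDelta_mul_choose hℓ hn
    have h2 : ((2 * (g + 1)).factorial : ℝ) * n.choose (2 * (g + 1)) ≤ (n : ℝ) ^ (2 * (g + 1)) := by
      rw [← Nat.cast_mul, ← Nat.descFactorial_eq_factorial_mul_choose]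
      exact_mod_cast Nat.descFactorial_le_pow _ _
    have h3 : B * (g + 1).factorial * (g + 1).factorial = (2 * (g + 1)).factorial := by
      have := Nat.choose_mul_factorial_mul_factorial (by omega : g + 1 ≤ 2 * (g + 1))
      rw [show 2 * (g + 1) - (g + 1) = g + 1 by omega] at this
      rw [hB]; exact_mod_cast this
    have ha : a = (g + 1).factorial * ℓ.choose (g + 1) := by
      simp only [a]; rw [Nat.descFactorial_eq_factorial_mul_choose]; push_cast; ring
    have hb : b = (g + 1).factorial * (n - ℓ).choose (g + 1) := by
      simp only [b]; rw [Nat.descFactorial_eq_factorial_mul_choose]; push_cast; ring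
    calc B * (a * b) = (B * (g + 1).factorial * (g + 1).factorial) *
          (ℓ.choose (g + 1) * (n - ℓ).choose (g + 1)) := by rw [ha, hb]; ring
      _ = kikuchiDelta ℓ n (2 * (g + 1)) *
          ((2 * (g + 1)).factorial * n.choose (2 * (g + 1))) := by rw [h3, ← h1]; ring
      _ ≤ _ := mul_le_mul_of_nonneg_left h2 (kikuchiDelta_nonneg _ _ _)
  have ha0 : 0 ≤ a := Nat.cast_nonneg _
  have hb0 : 0 ≤ b := Nat.cast_nonneg _
  have h4 := mul_le_mul_of_nonneg_right hδ hμ0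
  have h5 := mul_le_mul_of_nonneg_left hμ
    (by positivity : 0 ≤ κ ^ 2 * (B * (a * b) / (n : ℝ) ^ (2 * (g + 1))))
  refine le_trans (le_of_eq ?_) (h5.trans (le_trans (le_of_eq ?_)
    (mul_le_mul_of_nonneg_left h4 (sq_nonneg κ))))
  · rw [div_pow]
    field_simp
    ring
  · ring

set_option maxHeartbeats 1000000 in
/-- The parameters outside of the dense regime: `ℓ` is bounded and the average degree is of
logarithmic order. -/
theorem dense_or_sparse {n ℓ h : ℕ} (hh : 0 < h) (hℓ : h ≤ ℓ) {κ ε μ : ℝ} (hκ0 : 0 < κ)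
    (hκ1 : κ ≤ 1) (hε0 : 0 < ε) (hε1 : ε ≤ κ / (2 + κ)) (hn : 8 / κ * (2 * h * ℓ) ≤ n)
    {L : ℕ} (hL : 8 * h ^ 2 / κ ≤ L) (hμ0 : 0 ≤ μ)
    (hμ : aliceConst κ ε n (2 * h) * ((n : ℝ) / ℓ) ^ ((2 * h - 2) / 2) ≤ μ / n) :
    (1 + κ / 2) * (2 * (1 + ε) * ℓ * Real.log n) ≤ κ ^ 2 * (kikuchiDelta ℓ n (2 * h) * μ) ∨
    (ℓ ≤ L ∧ (L ^ h : ℝ)⁻¹ * Real.log n ≤ kikuchiDelta ℓ n (2 * h) * μ ∧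
      kikuchiDelta ℓ n (2 * h) * μ ≤ 4 * L / κ ^ 2 * Real.log n) := by
  have hh' : (1 : ℝ) ≤ h := by exact_mod_cast hh
  have hℓ' : (h : ℝ) ≤ ℓ := by exact_mod_cast hℓ
  have hℓ0 : (0 : ℝ) < ℓ := by linarith
  have hn8 : 8 * (2 * h * ℓ) ≤ κ * n := by
    have := mul_le_mul_of_nonneg_left hn hκ0.le
    refine le_trans (le_of_eq ?_) this
    field_simp
  have hn0 : (0 : ℝ) < n := by
    by_contra hc
    nlinarith [mul_pos (by linarith : (0 : ℝ) < h) hℓ0]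
  have hnbig : 8 * (2 * h * ℓ : ℝ) ≤ n := hn8.trans (by nlinarith)
  have hnℓ : 2 * (ℓ + h : ℝ) ≤ n := by nlinarith
  have hnℓ' : ℓ + h ≤ n := by
    have : ((ℓ + h : ℕ) : ℝ) ≤ n := by push_cast; linarith
    exact_mod_cast this
  have hlog : 0 ≤ Real.log n := Real.log_nonneg (by linarith)
  have hmain := le_kikuchiDelta_mul hh hℓ hnℓ' hκ0 hμ0 hμ
  set P : ℝ := ℓ.descFactorial h / (ℓ : ℝ) ^ h with hP
  set Q : ℝ := (n - ℓ).descFactorial h / (n : ℝ) ^ h with hQ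
  set Δ := kikuchiDelta ℓ n (2 * h) * μ
  have hQ1 : 1 - κ / 8 ≤ Q := by
    have h1 : ((n : ℝ) - (ℓ + h)) ^ h ≤ (n - ℓ).descFactorial h := by
      have h2 : (((n - ℓ + 1 - h : ℕ)) : ℝ) ^ h ≤ (n - ℓ).descFactorial h := by
        exact_mod_cast Nat.pow_sub_le_descFactorial (n - ℓ) h
      refine le_trans (pow_le_pow_left₀ (by linarith) ?_ h) h2
      rw [Nat.cast_sub (by omega), Nat.cast_add, Nat.cast_sub (by omega)]
      push_cast; linarith
    have h3 := one_sub_div_le_pow_div_pow (a := (n : ℝ) - (ℓ + h)) (N := n) (t := ℓ + h) (h := h)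
      hn0 (by linarith) le_rfl
    have h4 : (h : ℝ) * (ℓ + h) / n ≤ κ / 8 := by
      rw [div_le_div_iff₀ hn0 (by norm_num)]
      nlinarith
    calc 1 - κ / 8 ≤ 1 - h * (ℓ + h) / n := by linarith
      _ ≤ _ := h3.trans (div_le_div_of_nonneg_right h1 (by positivity))
  have hP0 : 0 ≤ P := by positivity
  have hQ0 : 0 ≤ Q := by positivity
  have hX : 0 ≤ (1 + ε) * ℓ * Real.log n := by positivity
  by_cases hℓL : ℓ ≤ L
  -- For ℓ ≤ L the ratio P is only bounded below by L^(-h), which gives the lower bound on the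
  -- degree. The upper bound is the failure of the dense inequality, where (1 + κ/2) · 2(1 + ε) ≤ 4
  -- because ε ≤ 1/3.
  · by_cases hd : (1 + κ / 2) * (2 * (1 + ε) * ℓ * Real.log n) ≤ κ ^ 2 * Δ
    · exact Or.inl hd
    refine Or.inr ⟨hℓL, ?_, ?_⟩
    · have hP1 : (L ^ h : ℝ)⁻¹ ≤ P := by
        rw [hP, ← one_div]
        have h1 : (1 : ℝ) ≤ ℓ.descFactorial h := by
          exact_mod_cast Nat.descFactorial_pos.2 hℓ
        have h2 : (ℓ : ℝ) ^ h ≤ (L : ℝ) ^ h :=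
          pow_le_pow_left₀ hℓ0.le (by exact_mod_cast hℓL) h
        exact div_le_div₀ (by linarith) h1 (by positivity) h2
      have hΔ0 : 0 ≤ Δ := mul_nonneg (kikuchiDelta_nonneg _ _ _) hμ0
      have hPQ : (L ^ h : ℝ)⁻¹ * (1 / 2) ≤ P * Q :=
        mul_le_mul hP1 (by linarith) (by norm_num) hP0
      have h3 : Real.log n ≤ (1 + ε) * (1 + κ) * ℓ * Real.log n := by
        refine le_mul_of_one_le_left hlog ?_
        have : (1 : ℝ) ≤ (1 + ε) * (1 + κ) := by nlinarith
        nlinarith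
      have h4 : κ ^ 2 * Δ ≤ Δ := mul_le_of_le_one_left hΔ0 (by nlinarith)
      calc (L ^ h : ℝ)⁻¹ * Real.log n = (2 * Real.log n) * ((L ^ h : ℝ)⁻¹ * (1 / 2)) := by ring
        _ ≤ (2 * ((1 + ε) * (1 + κ) * ℓ * Real.log n)) * (P * Q) :=
            mul_le_mul (by linarith) hPQ (by positivity) (by positivity)
        _ = 2 * (1 + ε) * (1 + κ) * ℓ * Real.log n * (P * Q) := by ring
        _ ≤ Δ := hmain.trans h4
    · have hℓL' : (ℓ : ℝ) ≤ L := by exact_mod_cast hℓL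
      have hε3 : ε ≤ 1 / 3 := by
        refine hε1.trans ?_
        rw [div_le_div_iff₀ (by linarith) (by norm_num)]; linarith
      have h1 : κ ^ 2 * Δ ≤ 4 * L * Real.log n := by
        refine (not_le.1 hd).le.trans ?_
        have h2 : (1 + κ / 2) * (2 * (1 + ε)) ≤ 4 := by nlinarith
        calc (1 + κ / 2) * (2 * (1 + ε) * ℓ * Real.log n)
            = ((1 + κ / 2) * (2 * (1 + ε))) * (ℓ * Real.log n) := by ring
          _ ≤ 4 * (L * Real.log n) := by gcongr
          _ = _ := by ring
      rw [div_mul_eq_mul_div, le_div_iff₀ (by positivity)]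
      linarith
  · left
    have hℓL' : (L : ℝ) ≤ ℓ := by exact_mod_cast (not_le.1 hℓL).le
    have hP1 : 1 - κ / 8 ≤ P := by
      have h1 : ((ℓ : ℝ) - h) ^ h ≤ ℓ.descFactorial h := by
        have h2 : (((ℓ + 1 - h : ℕ)) : ℝ) ^ h ≤ ℓ.descFactorial h := by
          exact_mod_cast Nat.pow_sub_le_descFactorial ℓ h
        refine le_trans (pow_le_pow_left₀ (by linarith) ?_ h) h2
        rw [Nat.cast_sub (by omega)]
        push_cast; linarith
      have h3 := one_sub_div_le_pow_div_pow (a := (ℓ : ℝ) - h) (N := ℓ) (t := h) (h := h)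
        hℓ0 hℓ' le_rfl
      have h4 : (h : ℝ) * h / ℓ ≤ κ / 8 := by
        rw [div_le_iff₀ hκ0] at hL
        rw [div_le_div_iff₀ hℓ0 (by norm_num)]
        nlinarith
      calc 1 - κ / 8 ≤ 1 - h * h / ℓ := by linarith
        _ ≤ _ := h3.trans (div_le_div_of_nonneg_right h1 (by positivity))
    have hPQ : (1 - κ / 8) * (1 - κ / 8) ≤ P * Q :=
      mul_le_mul hP1 hQ1 (by linarith) hP0
    -- The losses (1 - κ/8)² fit between 1 + κ and 1 + κ/2 since κ ≤ 1.
    have h5 : 1 + κ / 2 ≤ (1 + κ) * (P * Q) := by nlinarith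
    calc (1 + κ / 2) * (2 * (1 + ε) * ℓ * Real.log n)
        = 2 * ((1 + ε) * ℓ * Real.log n) * (1 + κ / 2) := by ring
      _ ≤ 2 * ((1 + ε) * ℓ * Real.log n) * ((1 + κ) * (P * Q)) := by gcongr
      _ = 2 * (1 + ε) * (1 + κ) * ℓ * Real.log n * (P * Q) := by ring
      _ ≤ _ := hmain

/-- The number of constraints exceeds any multiple of `log n`. -/
theorem mul_log_le_of_aliceConst_le {n ℓ h : ℕ} (hℓ : 0 < ℓ) (hℓn : ℓ ≤ n) {κ ε μ : ℝ}
    (hκ0 : 0 < κ) (hκ1 : κ ≤ 1) (hε0 : 0 < ε) {A : ℝ}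
    (hA : A * (2 * h).choose h ≤ n)
    (hμ : aliceConst κ ε n (2 * h) * ((n : ℝ) / ℓ) ^ ((2 * h - 2) / 2) ≤ μ / n) :
    A * Real.log n ≤ μ := by
  have hn0 : (0 : ℝ) < n := by
    have : 0 < n := by omega
    exact_mod_cast this
  have hlog : 0 ≤ Real.log n := Real.log_natCast_nonneg n
  have hℓ0 : (0 : ℝ) < ℓ := by exact_mod_cast hℓ
  have hB : (0 : ℝ) < (2 * h).choose h := by exact_mod_cast Nat.choose_pos (by omega)
  have h1 : (1 : ℝ) ≤ ((n : ℝ) / ℓ) ^ ((2 * h - 2) / 2) := by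
    refine one_le_pow₀ ?_
    rw [one_le_div hℓ0]; exact_mod_cast hℓn
  have h2 : ((2 * h).choose h : ℝ)⁻¹ * Real.log n ≤ aliceConst κ ε n (2 * h) := by
    rw [aliceConst, show 2 * h / 2 = h by omega, mul_assoc]
    refine le_mul_of_one_le_left (by positivity) ?_
    rw [one_le_div (by positivity)]
    nlinarith
  have h3 : 0 ≤ aliceConst κ ε n (2 * h) := le_trans (by positivity) h2
  have h4 := h2.trans ((le_mul_of_one_le_right h3 h1).trans hμ)
  rw [le_div_iff₀ hn0] at h4
  refine le_trans ?_ h4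
  calc A * Real.log n = (A * (2 * h).choose h) * (((2 * h).choose h : ℝ)⁻¹ * Real.log n) := by
        field_simp
    _ ≤ n * (((2 * h).choose h : ℝ)⁻¹ * Real.log n) := by gcongr
    _ = _ := by ring

/-- The sparse bound has degree L and εℓ ≤ L. The factor 2 comes from Poissonization. -/
theorem two_mul_inv_pow_le {n ℓ L : ℕ} (hn : 1 ≤ n) (hℓL : ℓ ≤ L) {ε : ℝ} (hε1 : ε ≤ 1) :
    2 * ((n : ℝ) ^ L)⁻¹ ≤ 3 * (n : ℝ) ^ (-(ε * ℓ)) := by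
  have hn' : (1 : ℝ) ≤ n := by exact_mod_cast hn
  have hℓL' : (ℓ : ℝ) ≤ L := by exact_mod_cast hℓL
  have h1 : ((n : ℝ) ^ L)⁻¹ ≤ (n : ℝ) ^ (-(ε * ℓ)) := by
    rw [← Real.rpow_natCast, ← Real.rpow_neg (by linarith)]
    refine Real.rpow_le_rpow_of_exponent_le hn' ?_
    have : (0 : ℝ) ≤ ℓ := Nat.cast_nonneg ℓ
    nlinarith
  have h2 : 0 ≤ (n : ℝ) ^ (-(ε * ℓ)) := Real.rpow_nonneg (by linarith) _
  linarith

end MainTheorem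

theorem mainTheorem8 (k : ℕ) (hk : Even k) (hk0 : 0 < k) (κ : ℝ) (hκ0 : 0 < κ) (hκ1 : κ ≤ 1) :
    ∃ K : ℝ, 1 ≤ K ∧ ∀ ℓ n : ℕ, 0 < ℓ → k / 2 ≤ ℓ → K * k * ℓ ≤ n →
      ∀ ε : ℝ, 0 < ε → ε ≤ κ / (2 + κ) →
        (∀ m : ℕ, aliceConst κ ε n k * ((n : ℝ) / ℓ) ^ ((k - 2) / 2) ≤ (m : ℝ) / n →
          randomXOR n k m
              {I | ¬ lambdaMax (kikuchiMatrix ℓ I) ≤ κ * (kikuchiDelta ℓ n k * m)} ≤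
            ENNReal.ofReal (3 * (n : ℝ) ^ (-(ε * ℓ)))) ∧
        (∀ m : ℝ≥0, aliceConst κ ε n k * ((n : ℝ) / ℓ) ^ ((k - 2) / 2) ≤ (m : ℝ) / n →
          poissonXOR n k m
              {I | ¬ lambdaMax (kikuchiMatrix ℓ I) ≤ κ * (kikuchiDelta ℓ n k * m)} ≤
            ENNReal.ofReal (3 * (n : ℝ) ^ (-(ε * ℓ)))) := by
  obtain ⟨h, rfl⟩ : ∃ h, k = 2 * h := ⟨k / 2, (Nat.two_mul_div_two_of_even hk).symm⟩
  have hh : 0 < h := by omega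
  set L : ℕ := ⌈8 * (h : ℝ) ^ 2 / κ⌉₊ + 1 with hLdef
  have hL : 8 * (h : ℝ) ^ 2 / κ ≤ L := by
    rw [hLdef]; push_cast
    linarith [Nat.le_ceil (8 * (h : ℝ) ^ 2 / κ)]
  have hL1 : (1 : ℝ) ≤ L := by rw [hLdef]; push_cast; linarith [Nat.cast_nonneg (α := ℝ) ⌈8 * (h : ℝ) ^ 2 / κ⌉₊]
  have hL0 : (0 : ℝ) < L := by linarith
  set C : ℕ := ⌈4 * (L : ℝ) / κ ^ 2⌉₊ with hC
  obtain ⟨G, hG⟩ := exists_randomXOR_sparse_le hh L C (c := (L ^ h : ℝ)⁻¹) (by positivity) hκ0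
  -- The first entry makes n/ℓ large enough for Q ≥ 1 - κ/8. The second forces log n ≥ G and log n ≥
  -- 1. The third gives m ≥ 3L log n, so that the Poisson tail e^(-m/3) is at most n^(-L).
  refine ⟨max (8 / κ) (max (Real.exp (max G 1)) (3 * L * (2 * h).choose h)),
    le_max_of_le_left (by rw [le_div_iff₀ hκ0]; linarith), ?_⟩
  intro ℓ n hℓ0 hhℓ hn ε hε0 hε1
  rw [show 2 * h / 2 = h by omega] at hhℓ
  have hℓ1 : (1 : ℝ) ≤ ℓ := by exact_mod_cast hℓ0
  have hh1 : (1 : ℝ) ≤ h := by exact_mod_cast hh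
  have hkℓ : (1 : ℝ) ≤ (2 * h : ℕ) * ℓ := by push_cast; nlinarith
  have hK : ∀ a : ℝ, 0 ≤ a → a ≤ max (8 / κ) (max (Real.exp (max G 1)) (3 * L * (2 * h).choose h)) →
      a * ((2 * h : ℕ) * ℓ) ≤ n := fun a _ ha => by
    refine le_trans (mul_le_mul_of_nonneg_right ha (by positivity)) ?_
    rw [← mul_assoc]; exact hn
  have hn8 := hK (8 / κ) (by positivity) (le_max_left _ _)
  have hnG := (le_mul_of_one_le_right (Real.exp_pos _).le hkℓ).trans
    (hK (Real.exp (max G 1)) (Real.exp_pos _).le (le_max_of_le_right (le_max_left _ _)))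
  have hnL := (le_mul_of_one_le_right (by positivity) hkℓ).trans
    (hK (3 * L * (2 * h).choose h) (by positivity) (le_max_of_le_right (le_max_right _ _)))
  have hn0 : (0 : ℝ) < n := (Real.exp_pos _).trans_le hnG
  have hn0' : 0 < n := by exact_mod_cast hn0
  have hlogG := (Real.le_log_iff_exp_le hn0).2 hnG
  have hnℓ : 2 * (ℓ + h) ≤ n := by
    have h1 : 8 * ((2 * h : ℕ) * ℓ : ℝ) ≤ n := by
      refine le_trans (mul_le_mul_of_nonneg_right ?_ (by positivity)) hn8
      rw [le_div_iff₀ hκ0]; linarith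
    have h2 : ((2 * (ℓ + h) : ℕ) : ℝ) ≤ n := by
      push_cast at h1 ⊢; nlinarith
    exact_mod_cast h2
  have hε3 : ε ≤ 1 := by
    refine hε1.trans ?_
    rw [div_le_one (by linarith)]; linarith
  have hdense := dense_regime (ε := ε) hhℓ (by omega) hn0' hκ0 hκ1
  have hcase : ∀ μ : ℝ, 0 ≤ μ → _ → _ := fun μ hμ0 hμ =>
    dense_or_sparse (n := n) hh hhℓ hκ0 hκ1 hε0 hε1 (by push_cast at hn8; exact hn8) hL hμ0 hμ
  have hsmall : ∀ μ : ℝ, _ → 3 * L * Real.log n ≤ μ := fun μ hμ =>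
    mul_log_le_of_aliceConst_le (n := n) (ℓ := ℓ) hℓ0 (by omega) hκ0 hκ1 hε0 hnL hμ
  have hsparse : ∀ μ : ℝ, 0 ≤ μ →
      aliceConst κ ε n (2 * h) * ((n : ℝ) / ℓ) ^ ((2 * h - 2) / 2) ≤ μ / n → ℓ ≤ L →
      (L ^ h : ℝ)⁻¹ * Real.log n ≤ kikuchiDelta ℓ n (2 * h) * μ →
      kikuchiDelta ℓ n (2 * h) * μ ≤ 4 * L / κ ^ 2 * Real.log n → ∀ M : ℕ, M ≤ 2 * μ →
      randomXOR n (2 * h) M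
        {I | ¬ lambdaMax (kikuchiMatrix ℓ I) ≤ κ * (kikuchiDelta ℓ n (2 * h) * μ)} ≤
        ENNReal.ofReal (((n : ℝ) ^ L)⁻¹) := by
    intro μ hμ0 hμ hℓL hlow hup
    have hlog1 : 1 ≤ Real.log n := (le_max_right G 1).trans hlogG
    refine hG n ((le_max_left _ _).trans hlogG) ℓ hhℓ hℓL hnℓ μ ?_ hlow ?_
    · have := hsmall μ hμ
      nlinarith
    · refine hup.trans (mul_le_mul_of_nonneg_right (Nat.le_ceil _) (by linarith))
  have hweak : (n : ℝ) ^ (-(ε * ℓ)) ≤ 3 * (n : ℝ) ^ (-(ε * ℓ)) := by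
    have := Real.rpow_nonneg hn0.le (-(ε * ℓ)); linarith
  refine ⟨fun m hm => ?_, fun m hm => ?_⟩
  · rcases hcase m (Nat.cast_nonneg m) hm with hd | ⟨hℓL, hlow, hup⟩
    · exact (hdense.1 m hd).trans (ENNReal.ofReal_le_ofReal hweak)
    · have hm0 : (0 : ℝ) ≤ m := Nat.cast_nonneg m
      refine (hsparse m hm0 hm hℓL hlow hup m (by linarith)).trans (ENNReal.ofReal_le_ofReal ?_)
      have h1 := two_mul_inv_pow_le (n := n) hn0' hℓL hε3
      have h2 : 0 ≤ ((n : ℝ) ^ L)⁻¹ := by positivity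
      linarith
  · rcases hcase m m.2 hm with hd | ⟨hℓL, hlow, hup⟩
    · exact (hdense.2 m hd).trans (ENNReal.ofReal_le_ofReal hweak)
    · refine (poissonXOR_le_of_forall_le_two_mul (by omega) m _ (by positivity) ?_
        (hsparse m m.2 hm hℓL hlow hup)).trans
        (ENNReal.ofReal_le_ofReal (two_mul_inv_pow_le hn0' hℓL hε3))
      have h1 : ((n : ℝ) ^ L)⁻¹ = Real.exp (-(L * Real.log n)) := by
        rw [Real.exp_neg, mul_comm, Real.exp_mul, Real.exp_log hn0, Real.rpow_natCast]
      rw [h1, Real.exp_le_exp]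
      have := hsmall m hm
      linarith
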